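/- Let the nontrivial zeros of the Riemann zeta function, counted with multiplicity, be listed in pairs $\rho=\tfrac12\pm i\tau_k$ $(k=1,2,\dots)$ with $\operatorname{Re}\tau_k>0$ and $\operatorname{Re}\tau_k$ non-decreasing. For real $v>-\tau_1^2$, let $\mathcal Z(\sigma,v)$ be the meromorphic continuation to $\sigma\in\mathbb C$ of the series $\sum_{k\ge1}(\tau_k^2+v)^{-\sigma}$, $\operatorname{Re}\sigma>\tfrac12$ (principal powers), and put $\mathcal Z(\sigma)=\mathcal Z(\sigma,0)$. For $j\ge1$ let $$\mathcal R_j=\frac{(-1)^j}{8\pi j}\,(1-2^{1-2j})\,B_{2j},$$ where $B_n$ are the Bernoulli numbers, and for $m\in\mathbb N=\{0,1,2,\dots\}$ let $$\mathcal R_m(v)=-\frac{\Gamma(m+\frac12)}{m!\,\Gamma(\frac12)}\Bigl[\frac1{4\pi}\sum_{j=1}^m\frac1{2j-1}+\frac{\log 2\pi}{4\pi}\Bigr]v^m+\sum_{j=1}^m\frac{\Gamma(\frac12+m)}{(m-j)!\,\Gamma(\frac12+j)}\,\mathcal R_j\,v^{m-j}.$$ Then: (0) For every real $v>-\tau_1^2$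 the series converges absolutely for $\operatorname{Re}\sigma>\frac12$, the continuation $\mathcal Z(\sigma,v)$ exists, and it is holomorphic except possibly at the points $\sigma=\frac12-m$, $m\in\mathbb N$. (1) For real $v$ with $|v|<\tau_1^2$ and every $\sigma\notin\{\frac12-m: m\in\mathbb N\}$, $$\mathcal Z(\sigma,v)=\sum_{\ell=0}^\infty\frac{\Gamma(1-\sigma)}{\ell!\,\Gamma(1-\sigma-\ell)}\,\mathcal Z(\sigma+\ell)\,v^\ell,$$ where $\Gamma(1-\sigma)/\Gamma(1-\sigma-\ell)$ denotes the polynomial $\prod_{j=0}^{\ell-1}(-\sigma-j)$. (2) For every $j\ge1$, $\mathcal Z(\frac12-j+\varepsilon)=\mathcal R_j\,\varepsilon^{-1}+O(1)$ as $\varepsilon\to0$. For every real $v>-\tau_1^2$ and every $m\in\mathbb N$, $$\mathcal Z(-m+\tfrac12+\varepsilon,v)=\frac1{8\pi}\,\frac{\Gamma(m+\frac12)}{m!\,\Gamma(\frac12)}\,v^m\,\varepsilon^{-2}+\mathcal R_m(v)\,\varepsilon^{-1}+O(1)\qquad(\varepsilon\to0).$$ (3) For every real $v>-\tau_1^2$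 and every $m\in\mathbb N$, $$\mathcal Z(-m,v)=\sum_{\ell=0}^m\binom m\ell\,\mathcal Z(-m+\ell)\,v^\ell .$$ -/

import Mathlib

open Filter Topology Asymptotics

/-- The nontrivial zeros `ρ` of the Riemann zeta function in the upper half-plane. By the symmetry
`ρ ↦ 1 - ρ`, and since `ζ` has no zero in the real interval `(0, 1)`, each pair `1/2 ± i τ` of
nontrivial zeros with `Re τ > 0` has exactly one member here, namely `1/2 + i τ`. -/
def upperZetaZeros : Set ℂ :=
  {ρ | riemannZeta ρ = 0 ∧ 0 < ρ.re ∧ ρ.re < 1 ∧ 0 < ρ.im}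

/-- The complex number `τ` with `ρ = 1/2 + i τ`. -/
noncomputable def zeroTau (ρ : ℂ) : ℂ := (ρ - 1 / 2) / Complex.I

theorem half_add_I_mul_zeroTau (ρ : ℂ) : 1 / 2 + Complex.I * zeroTau ρ = ρ := by
  unfold zeroTau
  rw [mul_div_cancel₀ _ Complex.I_ne_zero]
  ring

theorem zeroTau_re (ρ : ℂ) : (zeroTau ρ).re = ρ.im := by
  simp [zeroTau, Complex.div_I]

/-- The condition `v > - τ₁ ^ 2`, where `τ₁` has the least real part among all the `τ_k`: since
`τ₁` is real, it says that `v > - (Re τ_k) ^ 2` for every `k`. -/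
def IsAdmissibleShift (v : ℝ) : Prop :=
  ∀ ρ ∈ upperZetaZeros, -(zeroTau ρ).re ^ 2 < v

/-- The condition `|v| < τ₁ ^ 2`. -/
def IsSmallShift (v : ℝ) : Prop :=
  ∀ ρ ∈ upperZetaZeros, |v| < (zeroTau ρ).re ^ 2

/-- `f` is the meromorphic continuation to `ℂ` of the Dirichlet series
`∑ k, (τ_k ^ 2 + v) ^ (-σ)`, `Re σ > 1/2`, in which every zero is counted with its multiplicity
(and powers are principal values). Normal form means that `f` takes the limiting value at every
point where it is regular (and the value `0` at its poles), so that there is at most one such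
`f`. -/
def IsSecondaryZetaContinuation (v : ℝ) (f : ℂ → ℂ) : Prop :=
  MeromorphicNFOn f Set.univ ∧
    ∀ σ : ℂ, 1 / 2 < σ.re →
      HasSum (fun ρ : upperZetaZeros =>
        (analyticOrderNatAt riemannZeta (ρ : ℂ) : ℂ) * (zeroTau ρ ^ 2 + (v : ℂ)) ^ (-σ)) (f σ)

open Classical in
/-- The function `𝒵(σ, v)`: the meromorphic continuation in `σ` of `∑ k, (τ_k ^ 2 + v) ^ (-σ)`. -/
noncomputable def secondaryZeta (σ : ℂ) (v : ℝ) : ℂ :=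
  if h : ∃ f, IsSecondaryZetaContinuation v f then h.choose σ else 0

/-- The coefficient `Γ(1 - σ) / (ℓ! Γ(1 - σ - ℓ))`, as the polynomial in `σ` that it is; see
`shiftCoeff_eq_Gamma`. -/
noncomputable def shiftCoeff (σ : ℂ) (l : ℕ) : ℂ :=
  (∏ j ∈ Finset.range l, (-σ - (j : ℂ))) / (l.factorial : ℂ)

theorem shiftCoeff_eq_Gamma (σ : ℂ) (l : ℕ) (h : ∀ n : ℕ, σ ≠ (n : ℂ) + 1) :
    shiftCoeff σ l =
      Complex.Gamma (1 - σ) / ((l.factorial : ℂ) * Complex.Gamma (1 - σ - (l : ℂ))) := by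
  have key : ∏ j ∈ Finset.range l, (-σ - (j : ℂ)) =
      Complex.Gamma (1 - σ) / Complex.Gamma (1 - σ - (l : ℂ)) := by
    induction l with
    | zero =>
      have h0 : Complex.Gamma (1 - σ) ≠ 0 := by
        apply Complex.Gamma_ne_zero
        intro m hm
        exact h m (by linear_combination -hm)
      simp [h0]
    | succ l ih =>
      rw [Finset.prod_range_succ, ih]
      have e1 : (1 - σ - ((l + 1 : ℕ) : ℂ)) = -σ - l := by push_cast; ring
      have e2 : (1 - σ - (l : ℂ)) = (-σ - l) + 1 := by ring
      rw [e1, e2]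
      by_cases h0 : (-σ - (l : ℂ)) = 0
      · rw [h0, Complex.Gamma_zero]; simp
      · rw [Complex.Gamma_add_one _ h0, mul_comm (-σ - (l : ℂ)) (Complex.Gamma _),
          ← div_div, div_mul_cancel₀ _ h0]
  rw [shiftCoeff, key, div_div, mul_comm]

/-- `𝓡_j = (-1)^j / (8 π j) * (1 - 2^(1 - 2j)) * B_{2j}`, for `j ≥ 1`. -/
noncomputable def zetaResidue (j : ℕ) : ℝ :=
  (-1) ^ j / (8 * Real.pi * j) * (1 - (2 : ℝ) ^ (1 - 2 * (j : ℤ))) * (bernoulli (2 * j) : ℝ)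

/-- The polynomial `𝓡_m(v)`. -/
noncomputable def shiftedResidue (m : ℕ) (v : ℝ) : ℝ :=
  -(Real.Gamma (m + 1 / 2) / (m.factorial * Real.Gamma (1 / 2))) *
      (1 / (4 * Real.pi) * ∑ j ∈ Finset.Icc 1 m, 1 / (2 * (j : ℝ) - 1)
        + Real.log (2 * Real.pi) / (4 * Real.pi)) * v ^ m
    + ∑ j ∈ Finset.Icc 1 m,
        Real.Gamma (1 / 2 + m) / ((m - j).factorial * Real.Gamma (1 / 2 + j)) *
          zetaResidue j * v ^ (m - j)

/-! Put `ξ(s) = s (s - 1) Λ(s)`, entire of order at most one, whose zeros are the points `1/2 ± i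
τ`, and let `F(x) = (ξ'/ξ)'(1/2 + x)` for real `x ≥ 0`. The partial fraction expansion `-F(x) = ∑
(1/(x + iτ)² + 1/(x - iτ)²)`, the integral `∫₀^∞ x^(s-1) / (x + a)² dx = a^(s-2) Γ(s) Γ(2-s)` at `s
= 2 - 2σ`, and the reflection formula give, for `1/2 < Re σ < 1`, `𝒵(σ) = sin(πσ) / (π(2σ - 1)) ·
∫₀^∞ F(x) x^(1-2σ) dx` (`hasSum_zeros_pairs`, `mellin_inv_sq`, `zeroSeries_eq_mellin`).

The continuation to the left is governed by `F` at infinity. For `x > 1/2`, `F` is a trigamma term,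
minus `1/(x + 1/2)² + 1/(x - 1/2)²`, plus an exponentially small term from `ζ'/ζ`. The trigamma term
becomes a Hurwitz zeta function with parameter `1/4` over `cos(πσ)`; its values at `1 - 2j` are
Bernoulli numbers and give the simple poles at `1/2 - j` (`leftCont_laurent`). The rational terms
produce poles at `σ = -k`, which `sin(πσ)` cancels (`poleSeries_eq`). At `σ = 1/2`, the asymptotics
`F(x) ~ 1/(2x)` give the double pole, and the regularised integral of `F`, equal to `-½ log 2π`,
gives the residue (`mellinReg_one`, `nearHalf_laurent`).

For the shift, fix `r > |v|` and set aside a finite set `A` containing every zero with `|τ²| < r`.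
The other terms `(τ² + v)^(-σ)` expand by the binomial series, and their sum is `∑ shiftCoeff σ ℓ ·
𝒵_A(σ + ℓ) v^ℓ`, where `𝒵_A` omits `A`. As `𝒵_A(σ + ℓ)` decays like `r^(-ℓ)`, this series converges
locally uniformly once its first terms are split off, and only these can have poles near a given
point (`exists_shiftedZeta_eq`). The polar parts follow termwise: the double pole of `𝒵` at `1/2`
meets the derivative of the coefficient, which is where `∑ 1/(2j - 1)` comes from. At `σ = -m` the
coefficients are binomial and vanish beyond `m`, while the terms of `A` recombine by the binomial
theorem (`shiftedZeta_neg_natCast`). -/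

/-! ### The entire part of the completed zeta function on vertical strips. -/

section CompletedZetaBound

open HurwitzZeta Set

/-- The kernel is a theta series with non-negative terms, and its term at `n = 0` is 1. -/
theorem one_le_evenKernel_zero {t : ℝ} (ht : 0 < t) : 1 ≤ evenKernel 0 t := by
  have h := hasSum_int_evenKernel 0 ht
  have := h.summable.le_tsum (0 : ℤ) (fun j _ => by positivity)
  rw [h.tsum_eq] at this
  simpa using this

/-- `Λ₀` is a Mellin transform of `f_modif`, and positivity of `f_modif` is what lets real points
dominate a strip. Below 1 the functional equation turns `θ(t) - t^(-1/2)` into `t^(-1/2) (θ(1/t) -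
1)`; at `t = 1` the modified function is 0 by definition. -/
theorem exists_f_modif_eq (t : ℝ) (ht : 0 < t) :
    ∃ φ : ℝ, 0 ≤ φ ∧ (hurwitzEvenFEPair 0).f_modif t = (φ : ℂ) := by
  rcases lt_trichotomy t 1 with h | rfl | h
  · refine ⟨evenKernel 0 t - t ^ (-(1 / 2) : ℝ), ?_, ?_⟩
    · rw [evenKernel_functional_equation, ← evenKernel_eq_cosKernel_of_zero, Real.rpow_neg ht.le,
        one_div]
      have := one_le_evenKernel_zero (one_div_pos.2 ht)
      have h2 : 0 < (t ^ (1 / 2 : ℝ))⁻¹ := by positivity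
      nlinarith
    · simp [WeakFEPair.f_modif, hurwitzEvenFEPair, h, h.le, ht]
  · exact ⟨0, le_rfl, by simp [WeakFEPair.f_modif]⟩
  · refine ⟨evenKernel 0 t - 1, by linarith [one_le_evenKernel_zero ht], ?_⟩
    simp [WeakFEPair.f_modif, hurwitzEvenFEPair, h, not_lt.2 h.le]

/-- On a vertical strip, the entire function `Λ₀` is bounded by its values at real points. -/
theorem norm_completedRiemannZeta₀_le {a b : ℝ} {s : ℂ} (ha : a ≤ s.re) (hb : s.re ≤ b) :
    ‖completedRiemannZeta₀ s‖ ≤ ‖completedRiemannZeta₀ a‖ + ‖completedRiemannZeta₀ b‖ := by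
  set P := hurwitzEvenFEPair 0 with hP
  have hconv : ∀ s : ℂ, MellinConvergent P.f_modif s := fun s =>
    (P.isStrongFEPair_toStrongFEPair.hasMellin s).1
  have hint : ∀ s : ℂ, MeasureTheory.IntegrableOn (fun t : ℝ => t ^ (s.re - 1) * ‖P.f_modif t‖) (Ioi 0) := by
    intro s
    refine MeasureTheory.IntegrableOn.congr_fun (hconv s).norm (fun t ht => ?_) measurableSet_Ioi
    simp only [norm_smul]
    rw [Complex.norm_cpow_eq_rpow_re_of_pos ht]
    simp
  have hle : ∀ s : ℂ, ‖P.Λ₀ s‖ ≤ ∫ t in Ioi (0 : ℝ), t ^ (s.re - 1) * ‖P.f_modif t‖ := by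
    intro s
    refine (MeasureTheory.norm_integral_le_integral_norm _).trans_eq ?_
    refine MeasureTheory.setIntegral_congr_fun measurableSet_Ioi fun t ht => ?_
    simp only [norm_smul]
    rw [Complex.norm_cpow_eq_rpow_re_of_pos ht]
    simp
  have heq : ∀ x : ℝ, ‖P.Λ₀ x‖ = ∫ t in Ioi (0 : ℝ), t ^ (x - 1) * ‖P.f_modif t‖ := by
    intro x
    have : P.Λ₀ x = ((∫ t in Ioi (0 : ℝ), t ^ (x - 1) * ‖P.f_modif t‖ : ℝ) : ℂ) := by
      rw [← integral_complex_ofReal]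
      refine MeasureTheory.setIntegral_congr_fun measurableSet_Ioi fun t ht => ?_
      obtain ⟨φ, hφ, h⟩ := exists_f_modif_eq t ht
      simp only [smul_eq_mul]
      rw [h, Complex.norm_of_nonneg hφ, Complex.ofReal_mul, Complex.ofReal_cpow (le_of_lt ht)]
      push_cast
      rfl
    rw [this, Complex.norm_of_nonneg]
    exact MeasureTheory.setIntegral_nonneg measurableSet_Ioi fun t (ht : 0 < t) => by positivity
  have hintR : ∀ x : ℝ, MeasureTheory.IntegrableOn (fun t : ℝ => t ^ (x - 1) * ‖P.f_modif t‖)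
      (Ioi 0) := fun x => by simpa using hint (x : ℂ)
  -- For `t ≥ 1` the power of `t` grows with the exponent, so the one belonging to `b` dominates;
  -- for `t ≤ 1` the one belonging to `a` does. Their sum dominates everywhere.
  have key : ‖P.Λ₀ (s / 2)‖ ≤ ‖P.Λ₀ ((a / 2 : ℝ) : ℂ)‖ + ‖P.Λ₀ ((b / 2 : ℝ) : ℂ)‖ := by
    rw [heq, heq, ← MeasureTheory.integral_add (hintR _) (hintR _)]
    refine (hle _).trans (MeasureTheory.setIntegral_mono_on (hint _)
      ((hintR (a / 2)).add (hintR (b / 2))) measurableSet_Ioi fun t ht => ?_)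
    have ht : 0 < t := ht
    rw [← add_mul]
    refine mul_le_mul_of_nonneg_right ?_ (norm_nonneg _)
    have hre : (s / 2).re = s.re / 2 := by simp
    rw [hre]
    rcases le_total 1 t with h | h
    · have := Real.rpow_le_rpow_of_exponent_le h (by linarith : s.re / 2 - 1 ≤ b / 2 - 1)
      have : 0 ≤ t ^ (a / 2 - 1) := by positivity
      linarith
    · have := Real.rpow_le_rpow_of_exponent_ge ht h (by linarith : a / 2 - 1 ≤ s.re / 2 - 1)
      have : 0 ≤ t ^ (b / 2 - 1) := by positivity
      linarith
  have hdef : ∀ s, completedRiemannZeta₀ s = P.Λ₀ (s / 2) / 2 := fun s => rfl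
  simp only [hdef, norm_div, ← add_div]
  push_cast at key
  gcongr

end CompletedZetaBound

/-! ### The function `ξ`: location and multiplicity of its zeros. -/

/-- `Λ₀(1) = (γ - log 4π)/2 + 1`, and the crude bounds `1/2 < γ < 2/3` and `2 < log 4π < 3` suffice.
The constant `1/3` is small enough to keep the zeros of `ξ` at distance more than 1 from `1/2`. -/
theorem norm_completedRiemannZeta₀_one_lt : ‖completedRiemannZeta₀ 1‖ < 1 / 3 := by
  rw [completedRiemannZeta₀_one]
  have e : (((Real.eulerMascheroniConstant : ℂ) - Complex.log (4 * (Real.pi : ℂ))) / 2 + 1) =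
      (((Real.eulerMascheroniConstant - Real.log (4 * Real.pi)) / 2 + 1 : ℝ) : ℂ) := by
    push_cast
    rw [Complex.ofReal_log (by positivity)]
    push_cast
    rfl
  rw [e, Complex.norm_real, Real.norm_eq_abs, abs_lt]
  have h1 := Real.eulerMascheroniConstant_lt_two_thirds
  have h2 := Real.one_half_lt_eulerMascheroniConstant
  have h3 : 2 < Real.log (4 * Real.pi) := by
    rw [Real.lt_log_iff_exp_lt (by positivity)]
    have : Real.exp 2 = Real.exp 1 * Real.exp 1 := by rw [← Real.exp_add]; norm_num
    rw [this]
    nlinarith [Real.exp_one_lt_d9, Real.pi_gt_three, Real.exp_pos 1]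
  have h4 : Real.log (4 * Real.pi) < 3 := by
    rw [Real.log_lt_iff_lt_exp (by positivity)]
    have : Real.exp 3 = Real.exp 1 * Real.exp 1 * Real.exp 1 := by
      rw [← Real.exp_add, ← Real.exp_add]; norm_num
    rw [this]
    have h5 := Real.exp_one_gt_d9
    have h6 : 7 < Real.exp 1 * Real.exp 1 := by nlinarith
    nlinarith [Real.pi_lt_d2]
  constructor <;> linarith

/-- The Riemann function `ξ(s) = s (s - 1) π^{-s/2} Γ(s/2) ζ(s)`, an entire function. -/
noncomputable def riemannXi (s : ℂ) : ℂ := s * (s - 1) * completedRiemannZeta₀ s + 1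

theorem differentiable_riemannXi : Differentiable ℂ riemannXi := by
  have := differentiable_completedZeta₀
  unfold riemannXi
  fun_prop

theorem riemannXi_eq {s : ℂ} (h0 : s ≠ 0) (h1 : s ≠ 1) :
    riemannXi s = s * (s - 1) * completedRiemannZeta s := by
  have h2 : 1 - s ≠ 0 := sub_ne_zero.2 h1.symm
  rw [completedRiemannZeta_eq, riemannXi]
  field_simp
  ring

theorem riemannXi_one_sub (s : ℂ) : riemannXi (1 - s) = riemannXi s := by
  rw [riemannXi, riemannXi, completedRiemannZeta₀_one_sub]
  ring

theorem riemannXi_eq_riemannZeta {s : ℂ} (h0 : s ≠ 0) (h1 : s ≠ 1) (hG : s.Gammaℝ ≠ 0) :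
    riemannXi s = s * (s - 1) * (s.Gammaℝ * riemannZeta s) := by
  rw [riemannXi_eq h0 h1, riemannZeta_def_of_ne_zero h0, mul_div_cancel₀ _ hG]

theorem riemannXi_ne_zero_of_one_le_re {s : ℂ} (hs : 1 ≤ s.re) : riemannXi s ≠ 0 := by
  rcases eq_or_ne s 1 with rfl | h1
  · simp [riemannXi]
  have h0 : s ≠ 0 := by rintro rfl; norm_num at hs
  have hG := Complex.Gammaℝ_ne_zero_of_re_pos (by linarith : 0 < s.re)
  rw [riemannXi_eq_riemannZeta h0 h1 hG]
  exact mul_ne_zero (mul_ne_zero h0 (sub_ne_zero.2 h1))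
    (mul_ne_zero hG (riemannZeta_ne_zero_of_one_le_re hs))

/-- Zeros of `ξ` lie in the critical strip, and are not close to the real axis. -/
theorem riemannXi_eq_zero {s : ℂ} (hs : riemannXi s = 0) :
    0 < s.re ∧ s.re < 1 ∧ 1 < ‖s - 1 / 2‖ ∧ s.im ≠ 0 := by
  have h1 : s.re < 1 := by
    by_contra h
    exact riemannXi_ne_zero_of_one_le_re (not_lt.1 h) hs
  have h0 : 0 < s.re := by
    by_contra h
    refine riemannXi_ne_zero_of_one_le_re (s := 1 - s) ?_ (by rwa [riemannXi_one_sub])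
    simp only [Complex.sub_re, Complex.one_re]
    linarith
  -- In the critical strip `|Λ₀(s)| ≤ |Λ₀(0)| + |Λ₀(1)| = 2 |Λ₀(1)| < 2/3`, whereas `ξ(s) = 0` says
  -- `s (s - 1) Λ₀(s) = -1`. Hence `|s (s - 1)| > 3/2`, so `|s - 1/2|² > 5/4`, which a real point of
  -- the strip cannot satisfy.
  have hb := norm_completedRiemannZeta₀_le (a := 0) (b := 1) h0.le h1.le
  have h01 := completedRiemannZeta₀_one_sub 0
  rw [sub_zero] at h01
  rw [Complex.ofReal_zero, Complex.ofReal_one, ← h01] at hb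
  have hb1 := norm_completedRiemannZeta₀_one_lt
  have hprod : ‖s * (s - 1)‖ * ‖completedRiemannZeta₀ s‖ = 1 := by
    rw [← norm_mul, ← norm_neg, ← norm_one (α := ℂ)]
    congr 1
    rw [riemannXi] at hs
    linear_combination -hs
  have hlt : 3 / 2 < ‖s * (s - 1)‖ := by
    have : ‖completedRiemannZeta₀ s‖ < 2 / 3 := by linarith
    nlinarith [norm_nonneg (s * (s - 1)), norm_nonneg (completedRiemannZeta₀ s)]
  have hsq : s * (s - 1) = (s - 1 / 2) ^ 2 - 1 / 4 := by ring
  have hle : ‖s * (s - 1)‖ ≤ ‖s - 1 / 2‖ ^ 2 + 1 / 4 := by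
    rw [hsq]
    refine (norm_sub_le _ _).trans_eq ?_
    rw [norm_pow]
    norm_num
  have h3 : 1 < ‖s - 1 / 2‖ := by nlinarith [norm_nonneg (s - 1 / 2)]
  refine ⟨h0, h1, h3, fun him => ?_⟩
  have h4 : ‖s - 1 / 2‖ = |s.re - 1 / 2| := by
    have : s - 1 / 2 = ((s.re - 1 / 2 : ℝ) : ℂ) := by
      apply Complex.ext <;> simp [him]
    rw [this, Complex.norm_real, Real.norm_eq_abs]
  rw [h4] at h3
  have : |s.re - 1 / 2| ≤ 1 / 2 := abs_le.2 ⟨by linarith, by linarith⟩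
  linarith

/-- In the critical strip, the functions `ξ` and `ζ` have the same zeros with the same
multiplicities. -/
theorem analyticOrderNatAt_riemannXi {s : ℂ} (h0 : 0 < s.re) (h1 : s.re < 1) :
    analyticOrderNatAt riemannXi s = analyticOrderNatAt riemannZeta s := by
  have hs0 : s ≠ 0 := by rintro rfl; simp at h0
  have hs1 : s ≠ 1 := by rintro rfl; simp at h1
  -- The double inverse uses that `1 / Gammaℝ` is entire.
  have hG : AnalyticAt ℂ (fun s => s * (s - 1) * ((Complex.Gammaℝ s)⁻¹)⁻¹) s := by
    have : AnalyticAt ℂ (fun s => (Complex.Gammaℝ s)⁻¹) s :=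
      Complex.differentiable_Gammaℝ_inv.analyticAt s
    have h := this.inv (inv_ne_zero (Complex.Gammaℝ_ne_zero_of_re_pos h0))
    exact (analyticAt_id.mul (analyticAt_id.sub analyticAt_const)).mul h
  have hG0 : s * (s - 1) * ((Complex.Gammaℝ s)⁻¹)⁻¹ ≠ 0 := by
    rw [inv_inv]
    exact mul_ne_zero (mul_ne_zero hs0 (sub_ne_zero.2 hs1))
      (Complex.Gammaℝ_ne_zero_of_re_pos h0)
  have hζ : AnalyticAt ℂ riemannZeta s := analyticOn_riemannZeta s hs1
  unfold analyticOrderNatAt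
  congr 1
  have hev : riemannXi =ᶠ[𝓝 s] (fun s => s * (s - 1) * ((Complex.Gammaℝ s)⁻¹)⁻¹) * riemannZeta := by
    have h2 : ∀ᶠ z : ℂ in 𝓝 s, 0 < z.re :=
      Complex.continuous_re.continuousAt.eventually_const_lt h0
    filter_upwards [h2, isOpen_ne.mem_nhds hs1] with z hz hz1
    have hz0 : z ≠ 0 := by rintro rfl; simp at hz
    rw [riemannXi_eq_riemannZeta hz0 hz1 (Complex.Gammaℝ_ne_zero_of_re_pos hz), Pi.mul_apply,
      inv_inv]
    ring
  rw [analyticOrderAt_congr hev, analyticOrderAt_mul hG hζ,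
    hG.analyticOrderAt_eq_zero.2 hG0, zero_add]

theorem analyticOrderNatAt_riemannXi_one_sub (s : ℂ) :
    analyticOrderNatAt riemannXi (1 - s) = analyticOrderNatAt riemannXi s := by
  unfold analyticOrderNatAt
  congr 1
  rw [← analyticOrderAt_comp_of_deriv_ne_zero (f := riemannXi) (g := fun w => 1 - w) (z₀ := s)
    (by fun_prop) (by simp)]
  congr 1
  funext w
  exact riemannXi_one_sub w

/-- At `2n` everything is explicit: `Gammaℝ(2n) = π^(-n) Γ(n)` and `ζ(2n) ≤ ζ(2) ≤ 2`. Together with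
the strip bound this controls the growth of `ξ` in the whole plane. -/
theorem norm_completedRiemannZeta₀_two_mul_le {n : ℕ} (hn : 1 ≤ n) :
    ‖completedRiemannZeta₀ ((2 * n : ℕ) : ℂ)‖ ≤ 2 * (n : ℝ) ^ n + 2 := by
  have hn0 : (n : ℂ) ≠ 0 := by exact_mod_cast (by omega : n ≠ 0)
  have hcast : (((2 * n : ℕ) : ℂ)) = 2 * (n : ℂ) := by push_cast; ring
  have hre : (1 : ℝ) < ((2 * n : ℕ) : ℂ).re := by
    rw [Complex.natCast_re]; exact_mod_cast (by omega : 1 < 2 * n)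
  have h0 : ((2 * n : ℕ) : ℂ) ≠ 0 := by exact_mod_cast (by omega : 2 * n ≠ 0)
  have e := completedRiemannZeta_eq ((2 * n : ℕ) : ℂ)
  have hΛ : completedRiemannZeta ((2 * n : ℕ) : ℂ) =
      Complex.Gammaℝ ((2 * n : ℕ) : ℂ) * riemannZeta ((2 * n : ℕ) : ℂ) := by
    rw [riemannZeta_def_of_ne_zero h0,
      mul_div_cancel₀ _ (Complex.Gammaℝ_ne_zero_of_re_pos (by linarith))]
  have hζ : ‖riemannZeta ((2 * n : ℕ) : ℂ)‖ ≤ 2 := by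
    have hs := zeta_nat_eq_tsum_of_gt_one (k := 2 * n) (by omega)
    have h2 := hasSum_zeta_two
    rw [hs]
    refine tsum_of_norm_bounded h2 (fun i => ?_) |>.trans ?_
    · rw [norm_div, norm_one, norm_pow, Complex.norm_natCast]
      rcases Nat.eq_zero_or_pos i with rfl | hi
      · simp [show n ≠ 0 by omega]
      · have hi' : (1 : ℝ) ≤ i := by exact_mod_cast hi
        exact one_div_le_one_div_of_le (by positivity) (pow_le_pow_right₀ hi' (by omega))
    · nlinarith [Real.pi_lt_d2, Real.pi_pos]
  have hG : ‖Complex.Gammaℝ ((2 * n : ℕ) : ℂ)‖ ≤ (n : ℝ) ^ n := by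
    rw [Complex.Gammaℝ_def, hcast, mul_div_cancel_left₀ _ two_ne_zero, norm_mul]
    have h1 : ‖(Real.pi : ℂ) ^ (-(2 * (n : ℂ)) / 2)‖ ≤ 1 := by
      rw [Complex.norm_cpow_eq_rpow_re_of_pos Real.pi_pos]
      refine Real.rpow_le_one_of_one_le_of_nonpos (by linarith [Real.pi_gt_three]) ?_
      have : (-(2 * (n : ℂ)) / 2) = ((-(n : ℝ) : ℝ) : ℂ) := by push_cast; ring
      rw [this, Complex.ofReal_re]
      simp
    have h2 : ‖Complex.Gamma n‖ ≤ (n : ℝ) ^ n := by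
      obtain ⟨k, rfl⟩ : ∃ k, n = k + 1 := ⟨n - 1, by omega⟩
      push_cast
      rw [Complex.Gamma_nat_eq_factorial, Complex.norm_natCast]
      have h3 : k.factorial ≤ (k + 1) ^ (k + 1) :=
        (Nat.factorial_le (Nat.le_succ k)).trans (Nat.factorial_le_pow (k + 1))
      exact_mod_cast h3
    calc _ ≤ 1 * (n : ℝ) ^ n := by gcongr
      _ = _ := one_mul _
  have h3 : completedRiemannZeta₀ ((2 * n : ℕ) : ℂ) =
      Complex.Gammaℝ ((2 * n : ℕ) : ℂ) * riemannZeta ((2 * n : ℕ) : ℂ)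
        + 1 / ((2 * n : ℕ) : ℂ) + 1 / (1 - ((2 * n : ℕ) : ℂ)) := by
    rw [← hΛ, e]; ring
  rw [h3]
  have h4 : ‖(1 : ℂ) / ((2 * n : ℕ) : ℂ)‖ ≤ 1 := by
    rw [norm_div, norm_one, Complex.norm_natCast]
    exact div_le_one_of_le₀ (by exact_mod_cast (by omega : 1 ≤ 2 * n)) (by positivity)
  have h5 : ‖(1 : ℂ) / (1 - ((2 * n : ℕ) : ℂ))‖ ≤ 1 := by
    rw [norm_div, norm_one]
    refine div_le_one_of_le₀ ?_ (norm_nonneg _)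
    have := norm_sub_norm_le ((2 * n : ℕ) : ℂ) 1
    rw [norm_one, Complex.norm_natCast, norm_sub_rev] at this
    have h6 : (2 : ℝ) ≤ ((2 * n : ℕ) : ℝ) := by exact_mod_cast (by omega : 2 ≤ 2 * n)
    linarith
  calc _ ≤ ‖Complex.Gammaℝ ((2 * n : ℕ) : ℂ) * riemannZeta ((2 * n : ℕ) : ℂ)‖ + 1 + 1 := by
        refine (norm_add₃_le).trans ?_
        gcongr
    _ ≤ (n : ℝ) ^ n * 2 + 1 + 1 := by
        rw [norm_mul]; gcongr
    _ = _ := by ring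

/-! ### Entire functions of finite order: zero counting and partial fractions. -/

/-- An entire function is a power of `z - ρ` times an entire function which does not vanish
at `ρ`. -/
theorem Differentiable.exists_eq_pow_mul {f : ℂ → ℂ} (hf : Differentiable ℂ f) {ρ : ℂ}
    (hρ : analyticOrderAt f ρ ≠ ⊤) :
    ∃ g : ℂ → ℂ, Differentiable ℂ g ∧ g ρ ≠ 0 ∧
      ∀ z, f z = (z - ρ) ^ analyticOrderNatAt f ρ * g z := by
  obtain ⟨g, hg, hg0, hfg⟩ := (hf.analyticAt ρ).analyticOrderAt_ne_top.1 hρ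
  set n := analyticOrderNatAt f ρ
  -- The removable singularity of `f / (z - ρ)^n` is filled with the value of the local factor.
  refine ⟨Function.update (fun z => f z / (z - ρ) ^ n) ρ (g ρ), ?_, by simpa using hg0, ?_⟩
  · intro z
    rcases eq_or_ne z ρ with rfl | hz
    · refine hg.differentiableAt.congr_of_eventuallyEq ?_
      filter_upwards [hfg] with w hw
      rcases eq_or_ne w z with rfl | hwz
      · simp
      · rw [Function.update_of_ne hwz, hw, smul_eq_mul,
          mul_div_cancel_left₀ _ (pow_ne_zero _ (sub_ne_zero.2 hwz))]
    · have h1 : DifferentiableAt ℂ (fun z => f z / (z - ρ) ^ n) z :=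
        (hf z).div (by fun_prop) (pow_ne_zero _ (sub_ne_zero.2 hz))
      refine h1.congr_of_eventuallyEq ?_
      filter_upwards [isOpen_ne.mem_nhds hz] with w hw
      exact Function.update_of_ne hw _ _
  · intro z
    rcases eq_or_ne z ρ with rfl | hz
    · simpa using hfg.self_of_nhds
    · rw [Function.update_of_ne hz, mul_div_cancel₀ _ (pow_ne_zero _ (sub_ne_zero.2 hz))]

theorem Differentiable.analyticOrderAt_ne_top {f : ℂ → ℂ} (hf : Differentiable ℂ f) {c : ℂ}
    (hc : f c ≠ 0) (z : ℂ) : analyticOrderAt f z ≠ ⊤ := by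
  have h : AnalyticOnNhd ℂ f Set.univ := fun z _ => hf.analyticAt z
  refine h.analyticOrderAt_ne_top_of_isPreconnected (x := c) isPreconnected_univ trivial trivial ?_
  rw [(hf.analyticAt c).analyticOrderAt_eq_zero.2 hc]
  simp

/-- Division of an entire function by the canonical factors of finitely many of its zeros. -/
theorem Differentiable.exists_eq_prod_mul {f : ℂ → ℂ} (hf : Differentiable ℂ f) (h0 : f 0 ≠ 0)
    (S : Finset ℂ) (hS : (0 : ℂ) ∉ S) :
    ∃ g : ℂ → ℂ, Differentiable ℂ g ∧ (∀ ρ ∈ S, g ρ ≠ 0) ∧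
      (∀ ρ, ρ ∉ S → analyticOrderAt g ρ = analyticOrderAt f ρ) ∧
      ∀ z, f z = (∏ ρ ∈ S, (1 - z / ρ) ^ analyticOrderNatAt f ρ) * g z := by
  induction S using Finset.induction_on with
  | empty => exact ⟨f, hf, by simp, by simp, by simp⟩
  | insert ρ S hρ ih =>
    obtain ⟨g, hg, hgS, hgo, hfg⟩ := ih (fun h => hS (Finset.mem_insert_of_mem h))
    have hρ0 : ρ ≠ 0 := fun h => hS (by simp [h])
    have hg0 : g 0 ≠ 0 := fun h => h0 (by rw [hfg, h, mul_zero])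
    obtain ⟨k, hk, hkρ, hgk⟩ := hg.exists_eq_pow_mul (hg.analyticOrderAt_ne_top hg0 ρ)
    set n := analyticOrderNatAt g ρ with hn
    have hn' : n = analyticOrderNatAt f ρ := by
      rw [hn, analyticOrderNatAt, hgo ρ hρ, analyticOrderNatAt]
    have hc : (-ρ) ^ n ≠ 0 := pow_ne_zero _ (neg_ne_zero.2 hρ0)
    have hpow : ∀ z, (z - ρ) ^ n = (-ρ) ^ n * (1 - z / ρ) ^ n := by
      intro z
      rw [← mul_pow]
      congr 1
      field_simp
      ring
    -- The constant `(-ρ)^n` converts `(z - ρ)^n` into the canonical factor `(1 - z/ρ)^n`, which is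
    -- 1 at the origin.
    refine ⟨fun z => (-ρ) ^ n * k z, by fun_prop, ?_, ?_, ?_⟩
    · intro σ hσ
      rcases Finset.mem_insert.1 hσ with rfl | hσ
      · exact mul_ne_zero hc hkρ
      · refine mul_ne_zero hc fun h => hgS σ hσ ?_
        rw [hgk, h, mul_zero]
    · intro σ hσ
      rw [Finset.mem_insert, not_or] at hσ
      rw [← hgo σ hσ.2]
      have e1 : analyticOrderAt (fun z => (-ρ) ^ n * k z) σ = analyticOrderAt k σ := by
        have := analyticOrderAt_mul (f := fun _ : ℂ => (-ρ) ^ n) (g := k) (z₀ := σ)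
          analyticAt_const (hk.analyticAt σ)
        rw [(analyticAt_const).analyticOrderAt_eq_zero.2 hc, zero_add] at this
        exact this
      have h2 : AnalyticAt ℂ (fun z : ℂ => (z - ρ) ^ n) σ := by fun_prop
      have e2 : analyticOrderAt g σ = analyticOrderAt k σ := by
        have := analyticOrderAt_mul h2 (hk.analyticAt σ)
        rw [h2.analyticOrderAt_eq_zero.2 (pow_ne_zero _ (sub_ne_zero.2 hσ.1)), zero_add] at this
        rw [← this]
        congr 1
        funext z
        exact hgk z
      rw [e1, e2]
    · intro z
      rw [Finset.prod_insert hρ, ← hn', hfg, hgk z, hpow]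
      ring

/-- A zero-free holomorphic function on a disc has a holomorphic logarithm. -/
theorem exists_log_of_ball {g : ℂ → ℂ} {R : ℝ} (hR : 0 < R)
    (hg : DifferentiableOn ℂ g (Metric.ball 0 R)) (h0 : ∀ z ∈ Metric.ball (0 : ℂ) R, g z ≠ 0) :
    ∃ L : ℂ → ℂ, L 0 = 0 ∧ (∀ z ∈ Metric.ball (0 : ℂ) R, HasDerivAt L (logDeriv g z) z) ∧
      ∀ z ∈ Metric.ball (0 : ℂ) R, g z = g 0 * Complex.exp (L z) := by
  have hd : DifferentiableOn ℂ (logDeriv g) (Metric.ball 0 R) :=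
    (hg.deriv Metric.isOpen_ball).div hg h0
  obtain ⟨L, hL⟩ := hd.isExactOn_ball
  refine ⟨fun z => L z - L 0, by simp, fun z hz => (hL z hz).sub_const _, ?_⟩
  -- Since `L' = g'/g`, the product `g · exp(-L)` has derivative 0 and is constant on the ball.
  have key : ∀ z ∈ Metric.ball (0 : ℂ) R, HasDerivAt
      (fun z => g z * Complex.exp (-(L z - L 0))) 0 z := by
    intro z hz
    have h1 := ((hg z hz).differentiableAt (Metric.isOpen_ball.mem_nhds hz)).hasDerivAt
    have h2 := (((hL z hz).sub_const (L 0)).neg).cexp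
    refine (h1.mul h2).congr_deriv ?_
    simp only [Pi.neg_apply, logDeriv_apply]
    field_simp [h0 z hz]
    ring
  intro z hz
  have h := (convex_ball (0 : ℂ) R).is_const_of_fderivWithin_eq_zero (𝕜 := ℂ)
    (f := fun z => g z * Complex.exp (-(L z - L 0)))
    (fun z hz => (key z hz).differentiableAt.differentiableWithinAt)
    (fun z hz => by
      rw [fderivWithin_of_isOpen Metric.isOpen_ball hz, (key z hz).hasFDerivAt.fderiv]
      ext; simp) hz (Metric.mem_ball_self hR)
  simp only [sub_self, neg_zero, Complex.exp_zero, mul_one] at h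
  rw [← h, mul_assoc, ← Complex.exp_add]
  simp

theorem Differentiable.finite_zeros {f : ℂ → ℂ} (hf : Differentiable ℂ f) (h0 : f 0 ≠ 0) (R : ℝ) :
    {ρ : ℂ | f ρ = 0 ∧ ‖ρ‖ ≤ R}.Finite := by
  have h : AnalyticOnNhd ℂ f Set.univ := fun z _ => hf.analyticAt z
  have h1 := h.preimage_zero_mem_codiscrete (x := 0) h0
  rw [mem_codiscrete'] at h1
  have h2 : IsCompact (Metric.closedBall (0 : ℂ) R) := isCompact_closedBall 0 R
  have h3 := (h2.inter_right h1.1.isClosed_compl).finite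
    ((by simpa using h1.2 : IsDiscrete (f ⁻¹' {0}ᶜ)ᶜ).mono Set.inter_subset_right)
  refine h3.subset ?_
  rintro ρ ⟨h4, h5⟩
  simpa [h4] using h5

/-- Each canonical factor has modulus at least `3 - 1` on the circle of radius `6R`; dividing by the
factors therefore lowers the maximum there by a power of 2 that counts the zeros. -/
theorem two_le_norm_one_sub_div {R : ℝ} {z ρ : ℂ} (hz : ‖z‖ = 6 * R)
    (hρ : ‖ρ‖ ≤ 2 * R) (hρ0 : ρ ≠ 0) : 2 ≤ ‖1 - z / ρ‖ := by
  have h1 : 3 ≤ ‖z / ρ‖ := by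
    rw [norm_div, hz, le_div_iff₀ (norm_pos_iff.2 hρ0)]
    linarith
  have h2 := norm_sub_norm_le (z / ρ) 1
  rw [norm_one, norm_sub_rev] at h2
  linarith

/-- Jensen-type bounds for the number of zeros of an entire function in a disc, and for the
second derivative of its logarithm at the centre. -/
theorem entire_zeros_bounds {f : ℂ → ℂ} (hf : Differentiable ℂ f) (h0 : f 0 ≠ 0)
    {R M : ℝ} (hR : 0 < R) (hM : ∀ z, ‖z‖ ≤ 6 * R → ‖f z‖ ≤ M) (S : Finset ℂ)
    (hS : ∀ ρ, ρ ∈ S ↔ f ρ = 0 ∧ ‖ρ‖ ≤ 2 * R) :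
    (∑ ρ ∈ S, (analyticOrderNatAt f ρ : ℝ)) * Real.log 2 ≤ Real.log (M / ‖f 0‖) ∧
    ‖deriv (logDeriv f) 0 + ∑ ρ ∈ S, (analyticOrderNatAt f ρ : ℂ) / ρ ^ 2‖ ≤
      4 * (Real.log (M / ‖f 0‖) + 1) / R ^ 2 := by
  have hS0 : (0 : ℂ) ∉ S := fun h => h0 ((hS 0).1 h).1
  have hSne : ∀ ρ ∈ S, ρ ≠ 0 := fun ρ h h' => hS0 (h' ▸ h)
  obtain ⟨g, hg, hgS, hgo, hfg⟩ := hf.exists_eq_prod_mul h0 S hS0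
  set n : ℂ → ℕ := fun ρ => analyticOrderNatAt f ρ with hn
  have hfn : 0 < ‖f 0‖ := norm_pos_iff.2 h0
  have hg0 : g 0 = f 0 := by rw [hfg 0]; simp
  have hMpos : ‖f 0‖ ≤ M := hM 0 (by simpa using hR.le)
  have hM0 : 0 < M := hfn.trans_le hMpos
  have hprod : ∀ z : ℂ, ‖z‖ = 6 * R →
      (2 : ℝ) ^ (∑ ρ ∈ S, n ρ) ≤ ‖∏ ρ ∈ S, (1 - z / ρ) ^ n ρ‖ := by
    intro z hz
    rw [norm_prod, ← Finset.prod_pow_eq_pow_sum]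
    refine Finset.prod_le_prod (fun _ _ => by positivity) fun ρ hρ => ?_
    rw [norm_pow]
    exact pow_le_pow_left₀ (by norm_num)
      (two_le_norm_one_sub_div hz ((hS ρ).1 hρ).2 (hSne ρ hρ)) _
  -- The estimate is clear on the circle of radius `6R`, where the factors are large, and passes
  -- inside by the maximum principle. At the origin, where `g 0 = f 0`, it bounds the number of
  -- zeros.
  have hgb : ∀ z : ℂ, ‖z‖ ≤ 6 * R → ‖g z‖ ≤ M / 2 ^ (∑ ρ ∈ S, n ρ) := by
    intro z hz
    refine Complex.norm_le_of_forall_mem_frontier_norm_le (U := Metric.ball 0 (6 * R))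
      Metric.isBounded_ball hg.diffContOnCl (fun w hw => ?_) ?_
    · rw [frontier_ball _ (by positivity), mem_sphere_zero_iff_norm] at hw
      rw [le_div_iff₀ (by positivity)]
      calc ‖g w‖ * 2 ^ (∑ ρ ∈ S, n ρ) ≤ ‖g w‖ * ‖∏ ρ ∈ S, (1 - w / ρ) ^ n ρ‖ := by
            gcongr; exact hprod w hw
        _ = ‖f w‖ := by rw [hfg w, norm_mul, mul_comm]
        _ ≤ M := hM w hw.le
    · rw [closure_ball _ (by positivity)]
      simpa using hz
  have hcount : (2 : ℝ) ^ (∑ ρ ∈ S, n ρ) ≤ M / ‖f 0‖ := by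
    have := hgb 0 (by simpa using hR.le)
    rw [hg0, le_div_iff₀ (by positivity)] at this
    rw [le_div_iff₀ hfn]
    linarith
  constructor
  · have := Real.log_le_log (by positivity) hcount
    rw [Real.log_pow] at this
    push_cast at this
    exact this
  have hgM : ∀ z : ℂ, ‖z‖ ≤ 6 * R → ‖g z‖ ≤ M := fun z hz =>
    (hgb z hz).trans (div_le_self hM0.le (one_le_pow₀ (by norm_num)))
  have hgne : ∀ z ∈ Metric.ball (0 : ℂ) (2 * R), g z ≠ 0 := by
    intro z hz hgz
    have hfz : f z = 0 := by rw [hfg, hgz, mul_zero]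
    exact hgS z ((hS z).2 ⟨hfz, (mem_ball_zero_iff.1 hz).le⟩) hgz
  obtain ⟨L, hL0, hL, hLexp⟩ := exists_log_of_ball (R := 2 * R) (by positivity)
    hg.differentiableOn hgne
  -- The added 1 keeps `A` positive, as Borel–Carathéodory requires, even when `M = ‖f 0‖`.
  set A := Real.log (M / ‖f 0‖) + 1 with hA
  have hA0 : 0 < A := by
    have : 0 ≤ Real.log (M / ‖f 0‖) := Real.log_nonneg ((one_le_div hfn).2 hMpos)
    linarith
  have hLd : DifferentiableOn ℂ L (Metric.ball 0 (2 * R)) := fun z hz =>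
    (hL z hz).differentiableAt.differentiableWithinAt
  have hLre : Set.MapsTo L (Metric.ball 0 (2 * R)) {z | z.re ≤ A} := by
    intro z hz
    have h1 := hLexp z hz
    have h2 : ‖g z‖ ≤ M := hgM z (by rw [mem_ball_zero_iff] at hz; linarith)
    rw [h1, norm_mul, Complex.norm_exp, hg0] at h2
    have h3 : Real.exp (L z).re ≤ M / ‖f 0‖ := by
      rw [le_div_iff₀ hfn]; linarith
    have h4 := Real.log_le_log (Real.exp_pos _) h3
    rw [Real.log_exp] at h4
    simp only [Set.mem_ofPred_eq]
    linarith
  -- Borel–Carathéodory on the ball of radius `2R`, read on the circle of radius `R`, costs `2R /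
  -- (2R - R) = 2`. Cauchy's estimate for the second derivative then gives `2! · 2A / R²`.
  have hLb : ∀ z ∈ Metric.sphere (0 : ℂ) R, ‖L z‖ ≤ 2 * A := by
    intro z hz
    rw [mem_sphere_zero_iff_norm] at hz
    have := Complex.borelCaratheodory_zero hA0 hLd hLre (by positivity)
      (z := z) (by rw [mem_ball_zero_iff]; linarith) hL0
    rw [hz] at this
    refine this.trans_eq ?_
    field_simp
    ring
  have hsub : Metric.closedBall (0 : ℂ) R ⊆ Metric.ball 0 (2 * R) :=
    Metric.closedBall_subset_ball (by linarith)
  have hcauchy := Complex.norm_iteratedDeriv_le_of_forall_mem_sphere_norm_le 2 hR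
    (hLd.diffContOnCl_ball hsub) hLb
  have hLder : iteratedDeriv 2 L 0 = deriv (logDeriv g) 0 := by
    rw [iteratedDeriv_succ, iteratedDeriv_one]
    refine Filter.EventuallyEq.deriv_eq ?_
    filter_upwards [Metric.isOpen_ball.mem_nhds
      (Metric.mem_ball_self (by positivity : 0 < 2 * R))] with z hz
    exact (hL z hz).deriv
  have hsplit : deriv (logDeriv f) 0 =
      -∑ ρ ∈ S, (n ρ : ℂ) / ρ ^ 2 + deriv (logDeriv g) 0 := by
    have hev : logDeriv f =ᶠ[𝓝 0] fun z => -∑ ρ ∈ S, (n ρ : ℂ) / (ρ - z) + logDeriv g z := by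
      filter_upwards [hf.continuous.continuousAt.eventually_ne h0] with z hz
      have hgz : g z ≠ 0 := fun h => hz (by rw [hfg, h, mul_zero])
      have hpz : ∏ ρ ∈ S, (1 - z / ρ) ^ n ρ ≠ 0 := fun h => hz (by rw [hfg, h, zero_mul])
      have hpz' := Finset.prod_ne_zero_iff.1 hpz
      have hfe : f = fun z => (∏ ρ ∈ S, (1 - z / ρ) ^ n ρ) * g z := funext hfg
      rw [hfe, logDeriv_mul (f := fun z => ∏ ρ ∈ S, (1 - z / ρ) ^ n ρ) z hpz hgz (by fun_prop) (hg z),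
        logDeriv_prod hpz' (fun _ _ => by fun_prop)]
      congr 1
      rw [← Finset.sum_neg_distrib]
      refine Finset.sum_congr rfl fun ρ hρ => ?_
      have hρ0 := hSne ρ hρ
      have hd : HasDerivAt (fun z : ℂ => 1 - z / ρ) (-(1 / ρ)) z :=
        ((hasDerivAt_id z).div_const ρ).const_sub 1
      rcases Nat.eq_zero_or_pos (n ρ) with h | h
      · simp [h]
      have h1 : 1 - z / ρ ≠ 0 := fun h' => hpz' ρ hρ (by rw [h', zero_pow h.ne'])
      have h2 : ρ - z ≠ 0 := fun h' => h1 (by rw [← sub_eq_zero.1 h', div_self hρ0, sub_self])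
      rw [logDeriv_fun_pow hd.differentiableAt, logDeriv_apply, hd.deriv]
      have h3 : 1 - z / ρ = (ρ - z) / ρ := by field_simp
      rw [h3]
      field_simp
    rw [hev.deriv_eq]
    have hgl : DifferentiableAt ℂ (logDeriv g) 0 := by
      have hg1 : DifferentiableAt ℂ (deriv g) 0 :=
        (hg.contDiff (n := 2)).differentiable_deriv_two 0
      exact hg1.div (hg 0) (by rwa [hg0])
    have hs : HasDerivAt (fun z : ℂ => -∑ ρ ∈ S, (n ρ : ℂ) / (ρ - z))
        (-∑ ρ ∈ S, (n ρ : ℂ) / ρ ^ 2) 0 := by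
      refine HasDerivAt.fun_neg (HasDerivAt.fun_sum fun ρ hρ => ?_)
      have hρ0 := hSne ρ hρ
      have := ((hasDerivAt_id (0 : ℂ)).const_sub ρ).inv (by simpa using hρ0)
      refine (this.const_mul (n ρ : ℂ)).congr_deriv ?_ |>.congr_of_eventuallyEq ?_
      · simp; ring
      · exact Filter.Eventually.of_forall fun z => by simp [div_eq_mul_inv]
    exact (hs.add hgl.hasDerivAt).deriv
  rw [hsplit]
  have : -∑ ρ ∈ S, (n ρ : ℂ) / ρ ^ 2 + deriv (logDeriv g) 0 + ∑ ρ ∈ S, (n ρ : ℂ) / ρ ^ 2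
      = deriv (logDeriv g) 0 := by ring
  rw [this, ← hLder]
  refine hcauchy.trans_eq ?_
  norm_num [Nat.factorial]
  ring

theorem analyticOrderNatAt_eq_zero_of_ne {f : ℂ → ℂ} {z : ℂ} (hz : f z ≠ 0) :
    analyticOrderNatAt f z = 0 := by
  by_contra h
  exact hz (apply_eq_zero_of_analyticOrderNatAt_ne_zero h)

/-- Zero counting and the second logarithmic derivative at the origin for an entire function of
finite order. -/
theorem entire_zeros_growth {f : ℂ → ℂ} (hf : Differentiable ℂ f) (h0 : f 0 ≠ 0)
    {B C p : ℝ} (hB : 0 ≤ B) (hC : 0 ≤ C) (hp : 0 < p)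
    (hgr : ∀ z, ‖f z‖ ≤ Real.exp (C * (B + ‖z‖) ^ p)) :
    ∃ K : ℝ, ∀ R : ℝ, 1 ≤ R → ∀ S : Finset ℂ, (∀ ρ, ρ ∈ S ↔ f ρ = 0 ∧ ‖ρ‖ ≤ 2 * R) →
      (∑ ρ ∈ S, (analyticOrderNatAt f ρ : ℝ)) ≤ K * R ^ p ∧
      ‖deriv (logDeriv f) 0 + ∑ ρ ∈ S, (analyticOrderNatAt f ρ : ℂ) / ρ ^ 2‖ ≤ K * R ^ (p - 2) := by
  have hfn : 0 < ‖f 0‖ := norm_pos_iff.2 h0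
  set K₀ := C * (B + 6) ^ p + |Real.log ‖f 0‖| + 1 with hK₀
  have hK₀pos : 0 < K₀ := by positivity
  have hlog2 : 0 < Real.log 2 := Real.log_pos (by norm_num)
  refine ⟨max (K₀ / Real.log 2) (4 * K₀), fun R hR S hS => ?_⟩
  have hR0 : 0 < R := by linarith
  have hRp : 1 ≤ R ^ p := Real.one_le_rpow hR hp.le
  obtain ⟨h1, h2⟩ := entire_zeros_bounds hf h0 hR0 (M := Real.exp (C * (B + 6 * R) ^ p))
    (fun z hz => (hgr z).trans (by gcongr)) S hS
  -- For `R ≥ 1`, `B + 6R ≤ (B + 6) R` and constants are absorbed by `R^p ≥ 1`.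
  have hle : Real.log (Real.exp (C * (B + 6 * R) ^ p) / ‖f 0‖) + 1 ≤ K₀ * R ^ p := by
    rw [Real.log_div (Real.exp_ne_zero _) hfn.ne', Real.log_exp]
    have h3 : (B + 6 * R) ^ p ≤ (B + 6) ^ p * R ^ p := by
      rw [← Real.mul_rpow (by positivity) hR0.le]
      gcongr
      nlinarith
    have h4 : C * (B + 6 * R) ^ p ≤ C * (B + 6) ^ p * R ^ p := by
      rw [mul_assoc]; gcongr
    have h5 : -Real.log ‖f 0‖ ≤ |Real.log ‖f 0‖| * R ^ p :=
      (neg_le_abs _).trans (le_mul_of_one_le_right (abs_nonneg _) hRp)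
    rw [hK₀]
    nlinarith
  constructor
  · calc _ ≤ (K₀ * R ^ p) / Real.log 2 := by
          rw [le_div_iff₀ hlog2]; linarith
      _ = K₀ / Real.log 2 * R ^ p := by ring
      _ ≤ _ := by gcongr; exact le_max_left _ _
  · refine h2.trans ?_
    calc _ ≤ 4 * (K₀ * R ^ p) / R ^ 2 := by gcongr
      _ = 4 * K₀ * R ^ (p - 2) := by
          rw [Real.rpow_sub hR0, Real.rpow_two]; ring
      _ ≤ _ := by gcongr; exact le_max_right _ _

/-- A dyadic form of partial summation: a sum of `|ρ|^(-q)` is reduced to counting zeros in discs of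
radius `2 · 2^k`. If `k` is the first index with `x ≤ 2 · 2^k` and `k > 0`, then `x > 2^k` and the
single term `2^(-qk)` suffices; for `k = 0` the factor `δ^(-q)` does. -/
theorem inv_rpow_le_tsum_dyadic {q δ x : ℝ} (hq : 0 < q) (hδ : 0 < δ) (hδ1 : δ ≤ 1) (hx : δ ≤ x) :
    1 / x ^ q ≤ δ ^ (-q) * ∑' k : ℕ, (if x ≤ 2 * 2 ^ k then ((2 : ℝ) ^ (-q)) ^ k else 0) := by
  have hx0 : 0 < x := hδ.trans_le hx
  have h2q : (2 : ℝ) ^ (-q) < 1 := Real.rpow_lt_one_of_one_lt_of_neg (by norm_num) (by linarith)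
  have h2q0 : 0 < (2 : ℝ) ^ (-q) := by positivity
  have hsum : Summable fun k : ℕ => (if x ≤ 2 * 2 ^ k then ((2 : ℝ) ^ (-q)) ^ k else 0) := by
    refine Summable.of_nonneg_of_le (fun k => ?_) (fun k => ?_)
      (summable_geometric_of_lt_one h2q0.le h2q)
    · split_ifs <;> positivity
    · split_ifs
      · exact le_rfl
      · positivity
  have hex : ∃ k : ℕ, x ≤ 2 * 2 ^ k := by
    obtain ⟨k, hk⟩ := pow_unbounded_of_one_lt x (by norm_num : (1 : ℝ) < 2)
    exact ⟨k, by linarith⟩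
  classical
  set k := Nat.find hex with hk
  have hk1 : x ≤ 2 * 2 ^ k := Nat.find_spec hex
  have hterm := hsum.le_tsum k (fun j _ => by split_ifs <;> positivity)
  rw [if_pos hk1] at hterm
  have hδq : 1 ≤ δ ^ (-q) := Real.one_le_rpow_of_pos_of_le_one_of_nonpos hδ hδ1 (by linarith)
  calc 1 / x ^ q ≤ δ ^ (-q) * ((2 : ℝ) ^ (-q)) ^ k := by
        rw [one_div, ← Real.rpow_neg hx0.le]
        rcases Nat.eq_zero_or_pos k with h | h
        · rw [h, pow_zero, mul_one]
          exact Real.rpow_le_rpow_of_nonpos hδ hx (by linarith)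
        · have h3 := Nat.find_min hex (m := k - 1) (by omega)
          rw [not_le] at h3
          have h4 : (2 : ℝ) * 2 ^ (k - 1) = 2 ^ k := by
            rw [← pow_succ']; congr 1; omega
          rw [h4] at h3
          calc x ^ (-q) ≤ ((2 : ℝ) ^ k) ^ (-q) :=
                Real.rpow_le_rpow_of_nonpos (by positivity) h3.le (by linarith)
            _ = ((2 : ℝ) ^ (-q)) ^ k := by
                rw [← Real.rpow_natCast, ← Real.rpow_natCast, ← Real.rpow_mul (by norm_num),
                  ← Real.rpow_mul (by norm_num), mul_comm]
            _ ≤ _ := le_mul_of_one_le_left (by positivity) hδq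
    _ ≤ _ := by gcongr

/-- After exchanging the sum over zeros with the dyadic one, the level `k` contributes at most `K
2^(pk) · 2^(-qk)`, a geometric series because `p < q`. -/
theorem entire_summable_zeros {f : ℂ → ℂ} (hf : Differentiable ℂ f) (h0 : f 0 ≠ 0)
    {B C p q : ℝ} (hB : 0 ≤ B) (hC : 0 ≤ C) (hp : 0 < p) (hpq : p < q)
    (hgr : ∀ z, ‖f z‖ ≤ Real.exp (C * (B + ‖z‖) ^ p)) :
    Summable fun ρ : ℂ => (analyticOrderNatAt f ρ : ℝ) / ‖ρ‖ ^ q := by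
  obtain ⟨K, hK⟩ := entire_zeros_growth hf h0 hB hC hp hgr
  set n : ℂ → ℝ := fun ρ => (analyticOrderNatAt f ρ : ℝ) with hn
  have hn0 : ∀ ρ, 0 ≤ n ρ := fun ρ => Nat.cast_nonneg _
  have hfin : ∀ R, {ρ : ℂ | f ρ = 0 ∧ ‖ρ‖ ≤ R}.Finite := hf.finite_zeros h0
  obtain ⟨δ, hδ, hδ1, hδf⟩ : ∃ δ : ℝ, 0 < δ ∧ δ ≤ 1 ∧ ∀ ρ, f ρ = 0 → δ ≤ ‖ρ‖ := by
    obtain ⟨ε, hε, h⟩ := Metric.eventually_nhds_iff.1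
      (hf.continuous.continuousAt.eventually_ne h0)
    refine ⟨min ε 1, by positivity, min_le_right _ _, fun ρ hρ => ?_⟩
    by_contra hlt
    rw [not_le] at hlt
    exact h (by simpa using hlt.trans_le (min_le_left _ _)) hρ
  have hq : 0 < q := hp.trans hpq
  have h2q : (2 : ℝ) ^ (-q) < 1 := Real.rpow_lt_one_of_one_lt_of_neg (by norm_num) (by linarith)
  have h2q0 : 0 < (2 : ℝ) ^ (-q) := by positivity
  have h2pq : (2 : ℝ) ^ (p - q) < 1 := Real.rpow_lt_one_of_one_lt_of_neg (by norm_num) (by linarith)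
  set e : ℂ → ℕ → ℝ := fun ρ k => if ‖ρ‖ ≤ 2 * 2 ^ k then ((2 : ℝ) ^ (-q)) ^ k else 0 with he
  have he0 : ∀ ρ k, 0 ≤ e ρ k := fun ρ k => by simp only [he]; split_ifs <;> positivity
  have hesum : ∀ ρ, Summable (e ρ) := fun ρ => by
    refine Summable.of_nonneg_of_le (he0 ρ) (fun k => ?_)
      (summable_geometric_of_lt_one h2q0.le h2q)
    simp only [he]
    split_ifs
    · exact le_rfl
    · positivity
  refine summable_of_sum_le (c := δ ^ (-q) * ∑' k : ℕ, K * ((2 : ℝ) ^ (p - q)) ^ k)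
    (fun ρ => div_nonneg (hn0 ρ) (by positivity)) fun F => ?_
  have hterm : ∀ ρ ∈ F, n ρ / ‖ρ‖ ^ q ≤ δ ^ (-q) * ∑' k, n ρ * e ρ k := by
    intro ρ _
    rcases eq_or_ne (f ρ) 0 with h | h
    · rw [tsum_mul_left, ← mul_assoc, mul_comm _ (n ρ), mul_assoc, div_eq_mul_one_div]
      exact mul_le_mul_of_nonneg_left (inv_rpow_le_tsum_dyadic hq hδ hδ1 (hδf ρ h)) (hn0 ρ)
    · have : n ρ = 0 := by simp [hn, analyticOrderNatAt_eq_zero_of_ne h]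
      simp [this]
  refine (Finset.sum_le_sum hterm).trans ?_
  rw [← Finset.mul_sum, ← Summable.tsum_finsetSum fun ρ _ => (hesum ρ).mul_left _]
  refine mul_le_mul_of_nonneg_left ?_ (by positivity)
  refine Summable.tsum_le_tsum (fun k => ?_)
    (summable_sum fun ρ _ => (hesum ρ).mul_left _)
    ((summable_geometric_of_lt_one (by positivity) h2pq).mul_left _)
  set S := (hfin (2 * 2 ^ k)).toFinset with hS
  have hSK := (hK (2 ^ k) (one_le_pow₀ (by norm_num)) S (by intro ρ; simp [hS])).1
  calc ∑ ρ ∈ F, n ρ * e ρ k ≤ ∑ ρ ∈ S, n ρ * ((2 : ℝ) ^ (-q)) ^ k := by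
        classical
        have hle : ∑ ρ ∈ F, n ρ * e ρ k ≤ ∑ ρ ∈ S ∪ F, n ρ * e ρ k :=
          Finset.sum_le_sum_of_subset_of_nonneg Finset.subset_union_right
            fun ρ _ _ => mul_nonneg (hn0 ρ) (he0 ρ k)
        refine hle.trans_eq ?_
        rw [← Finset.sum_subset (Finset.subset_union_left (s₁ := S) (s₂ := F))]
        · refine Finset.sum_congr rfl fun ρ hρ => ?_
          rw [hS, Set.Finite.mem_toFinset] at hρ
          simp [he, hρ.2]
        · intro ρ _ hρ
          rcases eq_or_ne (f ρ) 0 with h | h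
          · have : ¬ ‖ρ‖ ≤ 2 * 2 ^ k := fun h' => hρ (by
              rw [hS, Set.Finite.mem_toFinset]; exact ⟨h, h'⟩)
            simp [he, this]
          · simp [hn, analyticOrderNatAt_eq_zero_of_ne h]
    _ = (∑ ρ ∈ S, n ρ) * ((2 : ℝ) ^ (-q)) ^ k := by rw [Finset.sum_mul]
    _ ≤ (K * ((2 : ℝ) ^ k) ^ p) * ((2 : ℝ) ^ (-q)) ^ k := by gcongr
    _ = K * ((2 : ℝ) ^ (p - q)) ^ k := by
        rw [mul_assoc, ← Real.rpow_natCast, ← Real.rpow_mul (by norm_num), mul_comm (k : ℝ) p,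
          Real.rpow_mul (by norm_num), Real.rpow_natCast, ← mul_pow,
          ← Real.rpow_add (by norm_num), sub_eq_add_neg]

/-- This stands in for Hadamard's factorisation. The sum over zeros with `|ρ| ≤ 2N` differs from
`-(log f)''(0)` by `O(N^(p-2))`, which tends to 0 as `p < 2`; by absolute convergence these partial
sums also tend to the full sum. -/
theorem entire_hasSum_zeros_zero {f : ℂ → ℂ} (hf : Differentiable ℂ f) (h0 : f 0 ≠ 0)
    {B C p : ℝ} (hB : 0 ≤ B) (hC : 0 ≤ C) (hp : 0 < p) (hp2 : p < 2)
    (hgr : ∀ z, ‖f z‖ ≤ Real.exp (C * (B + ‖z‖) ^ p)) :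
    HasSum (fun ρ : ℂ => (analyticOrderNatAt f ρ : ℂ) / ρ ^ 2) (-deriv (logDeriv f) 0) := by
  have hsum := entire_summable_zeros hf h0 hB hC hp hp2 hgr
  obtain ⟨K, hK⟩ := entire_zeros_growth hf h0 hB hC hp hgr
  have hnorm : ∀ ρ : ℂ, ‖(analyticOrderNatAt f ρ : ℂ) / ρ ^ 2‖ =
      (analyticOrderNatAt f ρ : ℝ) / ‖ρ‖ ^ (2 : ℝ) := fun ρ => by simp
  have hsum' : Summable fun ρ : ℂ => (analyticOrderNatAt f ρ : ℂ) / ρ ^ 2 :=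
    Summable.of_norm (by simpa only [hnorm] using hsum)
  rw [hsum'.hasSum_iff]
  set u : ℕ → ℂ → ℂ := fun N ρ => if ‖ρ‖ ≤ 2 * (N : ℝ) then
    (analyticOrderNatAt f ρ : ℂ) / ρ ^ 2 else 0 with hu
  have hlim : Tendsto (fun N => ∑' ρ, u N ρ) atTop
      (𝓝 (∑' ρ : ℂ, (analyticOrderNatAt f ρ : ℂ) / ρ ^ 2)) := by
    refine tendsto_tsum_of_dominated_convergence hsum (fun ρ => ?_)
      (Eventually.of_forall fun N ρ => ?_)
    · refine tendsto_const_nhds.congr' ?_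
      filter_upwards [eventually_ge_atTop ⌈‖ρ‖⌉₊] with N hN
      have : ‖ρ‖ ≤ N := Nat.ceil_le.1 hN
      simp only [hu]
      rw [if_pos (by linarith [norm_nonneg ρ])]
    · rw [← hnorm]
      simp only [hu]
      split_ifs
      · exact le_rfl
      · rw [norm_zero]
        exact norm_nonneg _
  have hlim2 : Tendsto (fun N => ∑' ρ, u N ρ) atTop (𝓝 (-deriv (logDeriv f) 0)) := by
    rw [tendsto_iff_norm_sub_tendsto_zero]
    have hz : Tendsto (fun N : ℕ => K * (N : ℝ) ^ (p - 2)) atTop (𝓝 0) := by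
      have := (tendsto_rpow_neg_atTop (y := 2 - p) (by linarith)).comp
        tendsto_natCast_atTop_atTop
      simpa using this.const_mul K
    refine squeeze_zero' (Eventually.of_forall fun _ => norm_nonneg _) ?_ hz
    filter_upwards [eventually_ge_atTop 1] with N hN
    set S := (hf.finite_zeros h0 (2 * (N : ℝ))).toFinset with hS
    have h1 := (hK N (by exact_mod_cast hN) S (by intro ρ; simp [hS])).2
    have h2 : ∑' ρ, u N ρ = ∑ ρ ∈ S, (analyticOrderNatAt f ρ : ℂ) / ρ ^ 2 := by
      rw [tsum_eq_sum (s := S)]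
      · refine Finset.sum_congr rfl fun ρ hρ => ?_
        have : ‖ρ‖ ≤ 2 * (N : ℝ) := by
          rw [hS, Set.Finite.mem_toFinset] at hρ
          exact hρ.2
        simp [hu, this]
      · intro ρ hρ
        by_cases h : ‖ρ‖ ≤ 2 * (N : ℝ)
        · have : f ρ ≠ 0 := fun h' => hρ (by rw [hS, Set.Finite.mem_toFinset]; exact ⟨h', h⟩)
          simp [hu, analyticOrderNatAt_eq_zero_of_ne this]
        · simp [hu, h]
    rw [h2, sub_neg_eq_add, add_comm]
    exact h1
  exact tendsto_nhds_unique hlim hlim2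

theorem analyticOrderNatAt_comp_const_add (f : ℂ → ℂ) (c z : ℂ) :
    analyticOrderNatAt (fun w => f (c + w)) z = analyticOrderNatAt f (c + z) := by
  unfold analyticOrderNatAt
  congr 1
  exact analyticOrderAt_comp_of_deriv_ne_zero (f := f) (g := fun w => c + w) (z₀ := z)
    (by fun_prop) (by simp)

theorem growth_comp_const_add {f : ℂ → ℂ} {C p : ℝ} (hC : 0 ≤ C) (hp : 0 < p)
    (hgr : ∀ z, ‖f z‖ ≤ Real.exp (C * (1 + ‖z‖) ^ p)) (c z : ℂ) :
    ‖f (c + z)‖ ≤ Real.exp (C * (1 + ‖c‖ + ‖z‖) ^ p) := by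
  refine (hgr _).trans (Real.exp_le_exp.2 (mul_le_mul_of_nonneg_left ?_ hC))
  refine Real.rpow_le_rpow (by positivity) ?_ hp.le
  linarith [norm_add_le c z]

/-- The Dirichlet-type series over the zeros of an entire function of order less than `q`
converges. -/
theorem entire_summable_order_div {f : ℂ → ℂ} (hf : Differentiable ℂ f) {c : ℂ} (hc : f c ≠ 0)
    {C p q : ℝ} (hC : 0 ≤ C) (hp : 0 < p) (hpq : p < q)
    (hgr : ∀ z, ‖f z‖ ≤ Real.exp (C * (1 + ‖z‖) ^ p)) :
    Summable fun ρ : ℂ => (analyticOrderNatAt f ρ : ℝ) / ‖ρ - c‖ ^ q := by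
  have h := entire_summable_zeros (f := fun w => f (c + w)) (by fun_prop) (by simpa using hc)
    (by positivity) hC hp hpq (growth_comp_const_add hC hp hgr c)
  rw [← (Equiv.addLeft c).summable_iff]
  refine h.congr fun ρ => ?_
  simp [analyticOrderNatAt_comp_const_add]

/-- The partial fraction expansion of the second logarithmic derivative of an entire function of
order less than two. -/
theorem entire_hasSum_deriv_logDeriv {f : ℂ → ℂ} (hf : Differentiable ℂ f) {c : ℂ} (hc : f c ≠ 0)
    {C p : ℝ} (hC : 0 ≤ C) (hp : 0 < p) (hp2 : p < 2)
    (hgr : ∀ z, ‖f z‖ ≤ Real.exp (C * (1 + ‖z‖) ^ p)) :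
    HasSum (fun ρ : ℂ => (analyticOrderNatAt f ρ : ℂ) / (c - ρ) ^ 2)
      (-deriv (logDeriv f) c) := by
  have h := entire_hasSum_zeros_zero (f := fun w => f (c + w)) (by fun_prop) (by simpa using hc)
    (by positivity) hC hp hp2 (growth_comp_const_add hC hp hgr c)
  have hl : logDeriv (fun w => f (c + w)) = fun w => logDeriv f (c + w) := by
    funext w
    rw [logDeriv_apply, logDeriv_apply, deriv_comp_const_add]
  rw [hl, deriv_comp_const_add, add_zero] at h
  rw [← (Equiv.addLeft c).hasSum_iff]
  convert! h using 2 with ρ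
  simp [analyticOrderNatAt_comp_const_add]

/-! ### The order of `ξ` and sums over its zeros. -/

/-- The function `ξ` has order at most one. -/
theorem exists_norm_riemannXi_le {p : ℝ} (hp : 1 < p) :
    ∃ C : ℝ, 0 ≤ C ∧ ∀ s, ‖riemannXi s‖ ≤ Real.exp (C * (1 + ‖s‖) ^ p) := by
  have hp1 : 0 < p - 1 := by linarith
  refine ⟨(3 + 3 / (p - 1)) * 2 ^ p, by positivity, fun s => ?_⟩
  -- With `‖s‖ + 1 ≤ n` the strip `[1 - 2n, 2n]` contains `s`, and the functional equation
  -- identifies both end values with `Λ₀(2n)`, which is at most `2 n^n + 2`.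
  set n := ⌈‖s‖⌉₊ + 1 with hn
  have hn1 : 1 ≤ n := by omega
  have hn1' : (1 : ℝ) ≤ n := by exact_mod_cast hn1
  have hsn : ‖s‖ + 1 ≤ n := by
    rw [hn]; push_cast; linarith [Nat.le_ceil ‖s‖]
  set x := 2 * (1 + ‖s‖) with hx
  have hnx : (n : ℝ) ≤ x := by
    rw [hn]; push_cast; linarith [(Nat.ceil_lt_add_one (norm_nonneg s)).le, norm_nonneg s]
  have hx1 : 1 ≤ x := hn1'.trans hnx
  have hx0 : 0 < x := by linarith
  have hre := abs_le.1 (Complex.abs_re_le_norm s)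
  have h1 := norm_completedRiemannZeta₀_le (a := 1 - 2 * n) (b := 2 * n) (s := s)
    (by linarith) (by linarith)
  have h2 := norm_completedRiemannZeta₀_two_mul_le hn1
  have e1 : completedRiemannZeta₀ ((1 - 2 * n : ℝ) : ℂ) =
      completedRiemannZeta₀ ((2 * n : ℕ) : ℂ) := by
    rw [← completedRiemannZeta₀_one_sub]; congr 1; push_cast; ring
  have e2 : ((2 * n : ℝ) : ℂ) = ((2 * n : ℕ) : ℂ) := by push_cast; ring
  rw [e1, e2] at h1
  have h3 : ‖completedRiemannZeta₀ s‖ ≤ 4 * (n : ℝ) ^ n + 4 := by linarith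
  have h4 : ‖s * (s - 1)‖ ≤ (n : ℝ) ^ 2 := by
    rw [norm_mul, sq]
    have := norm_sub_le s 1
    rw [norm_one] at this
    gcongr <;> linarith
  have hnn : (1 : ℝ) ≤ (n : ℝ) ^ n := one_le_pow₀ hn1'
  have h5 : ‖riemannXi s‖ ≤ 9 * (n : ℝ) ^ (n + 2) := by
    have h51 : ‖riemannXi s‖ ≤ ‖s * (s - 1)‖ * ‖completedRiemannZeta₀ s‖ + 1 := by
      rw [riemannXi, ← norm_mul]
      exact (norm_add_le _ _).trans (by simp)
    have h52 : ‖s * (s - 1)‖ * ‖completedRiemannZeta₀ s‖ ≤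
        (n : ℝ) ^ 2 * (4 * (n : ℝ) ^ n + 4) := by gcongr
    have h53 : (1 : ℝ) ≤ (n : ℝ) ^ 2 := one_le_pow₀ hn1'
    rw [pow_add]
    nlinarith
  -- This trades the growth `x log x` of the exponent for `x^p`, any `p > 1`.
  have hlogx : Real.log x ≤ x ^ (p - 1) / (p - 1) := Real.log_le_rpow_div hx0.le hp1
  have hxp : 1 ≤ x ^ p := Real.one_le_rpow hx1 (by linarith)
  have hxx : x * x ^ (p - 1) = x ^ p := by
    rw [← Real.rpow_one_add' hx0.le (by linarith)]; congr 1; ring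
  calc ‖riemannXi s‖ ≤ 9 * (n : ℝ) ^ (n + 2) := h5
    _ ≤ Real.exp 3 * Real.exp (3 * x * Real.log x) := by
        have h9 : (9 : ℝ) ≤ Real.exp 3 := by
          have : Real.exp 3 = Real.exp 1 ^ 3 := by rw [← Real.exp_nat_mul]; norm_num
          rw [this]
          have : (2.7 : ℝ) ^ 3 ≤ Real.exp 1 ^ 3 := by
            gcongr; linarith [Real.exp_one_gt_d9]
          norm_num at this
          linarith
        have : (n : ℝ) ^ (n + 2) ≤ Real.exp (3 * x * Real.log x) := by
          rw [← Real.exp_log (by positivity : 0 < (n : ℝ) ^ (n + 2)), Real.log_pow]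
          refine Real.exp_le_exp.2 ?_
          have hl : Real.log n ≤ Real.log x := Real.log_le_log (by positivity) hnx
          have hl0 : 0 ≤ Real.log n := Real.log_nonneg hn1'
          have : ((n + 2 : ℕ) : ℝ) ≤ 3 * x := by push_cast; linarith
          gcongr
        gcongr
    _ = Real.exp (3 + 3 * x * Real.log x) := (Real.exp_add _ _).symm
    _ ≤ Real.exp ((3 + 3 / (p - 1)) * 2 ^ p * (1 + ‖s‖) ^ p) := by
        refine Real.exp_le_exp.2 ?_
        rw [mul_assoc (3 + 3 / (p - 1)), ← Real.mul_rpow (by norm_num) (by positivity), ← hx]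
        calc 3 + 3 * x * Real.log x ≤ 3 * x ^ p + 3 * x * (x ^ (p - 1) / (p - 1)) := by
              gcongr; linarith
          _ = 3 * x ^ p + 3 / (p - 1) * (x * x ^ (p - 1)) := by ring
          _ = _ := by rw [hxx]; ring

theorem riemannXi_half_add_ofReal_ne_zero (x : ℝ) : riemannXi (1 / 2 + x) ≠ 0 := fun h =>
  (riemannXi_eq_zero h).2.2.2 (by simp)

theorem hasSum_riemannXi {c : ℂ} (hc : riemannXi c ≠ 0) :
    HasSum (fun ρ : ℂ => (analyticOrderNatAt riemannXi ρ : ℂ) / (c - ρ) ^ 2)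
      (-deriv (logDeriv riemannXi) c) := by
  obtain ⟨C, hC, h⟩ := exists_norm_riemannXi_le (p := 3 / 2) (by norm_num)
  exact entire_hasSum_deriv_logDeriv differentiable_riemannXi hc hC (by norm_num) (by norm_num) h

theorem mem_upperZetaZeros_iff {ρ : ℂ} :
    ρ ∈ upperZetaZeros ↔ riemannXi ρ = 0 ∧ 0 < ρ.im := by
  constructor
  · rintro ⟨h0, h1, h2, h3⟩
    refine ⟨?_, h3⟩
    have hs0 : ρ ≠ 0 := by rintro rfl; simp at h1
    have hs1 : ρ ≠ 1 := by rintro rfl; simp at h2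
    rw [riemannXi_eq_riemannZeta hs0 hs1 (Complex.Gammaℝ_ne_zero_of_re_pos h1), h0]
    simp
  · rintro ⟨h0, h3⟩
    obtain ⟨h1, h2, -, -⟩ := riemannXi_eq_zero h0
    have hs0 : ρ ≠ 0 := by rintro rfl; simp at h1
    have hs1 : ρ ≠ 1 := by rintro rfl; simp at h2
    have hG := Complex.Gammaℝ_ne_zero_of_re_pos h1
    rw [riemannXi_eq_riemannZeta hs0 hs1 hG] at h0
    refine ⟨?_, h1, h2, h3⟩
    have := mul_ne_zero hs0 (sub_ne_zero.2 hs1)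
    simpa [this, hG, hs0, sub_ne_zero.2 hs1] using h0

/-- The multiplicity of a zero of the zeta function. -/
noncomputable abbrev zetaMult (ρ : upperZetaZeros) : ℕ := analyticOrderNatAt riemannZeta (ρ : ℂ)

theorem analyticOrderNatAt_riemannXi_upper (ρ : upperZetaZeros) :
    analyticOrderNatAt riemannXi (ρ : ℂ) = zetaMult ρ :=
  analyticOrderNatAt_riemannXi ρ.2.2.1 ρ.2.2.2.1

theorem zetaMult_pos (ρ : upperZetaZeros) : 0 < zetaMult ρ := by
  rw [← analyticOrderNatAt_riemannXi_upper, Nat.pos_iff_ne_zero]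
  have h := (mem_upperZetaZeros_iff.1 ρ.2).1
  have htop := differentiable_riemannXi.analyticOrderAt_ne_top (c := 1)
    (riemannXi_ne_zero_of_one_le_re (by simp)) (ρ : ℂ)
  intro h0
  have h1 : analyticOrderAt riemannXi (ρ : ℂ) = 0 := by
    rw [← Nat.cast_analyticOrderNatAt htop, h0]; simp
  exact (differentiable_riemannXi.analyticAt _).analyticOrderAt_eq_zero.1 h1 h

theorem sub_half_eq (ρ : ℂ) : ρ - 1 / 2 = Complex.I * zeroTau ρ := by
  rw [eq_comm, ← sub_eq_zero]
  have := half_add_I_mul_zeroTau ρ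
  linear_combination this

theorem norm_zeroTau (ρ : ℂ) : ‖zeroTau ρ‖ = ‖ρ - 1 / 2‖ := by
  rw [sub_half_eq]; simp

theorem one_lt_norm_zeroTau (ρ : upperZetaZeros) : 1 < ‖zeroTau ρ‖ := by
  rw [norm_zeroTau]
  exact (riemannXi_eq_zero (mem_upperZetaZeros_iff.1 ρ.2).1).2.2.1

theorem zeroTau_re_pos (ρ : upperZetaZeros) : 0 < (zeroTau ρ).re := by
  rw [zeroTau_re]; exact ρ.2.2.2.2

theorem abs_zeroTau_im_lt (ρ : upperZetaZeros) : |(zeroTau ρ).im| < 1 / 2 := by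
  have h : (zeroTau ρ).im = 1 / 2 - (ρ : ℂ).re := by
    have := congrArg Complex.re (half_add_I_mul_zeroTau ρ)
    simp at this
    norm_num at this ⊢
    linarith
  rw [h, abs_lt]
  have := ρ.2.2.1
  have := ρ.2.2.2.1
  constructor <;> linarith

/-- Sums over the zeros, taken in the upper half-plane. -/
theorem summable_zetaMult_div {q : ℝ} (hq : 1 < q) :
    Summable fun ρ : upperZetaZeros => (zetaMult ρ : ℝ) / ‖zeroTau ρ‖ ^ q := by
  obtain ⟨C, hC, h⟩ := exists_norm_riemannXi_le (p := (1 + q) / 2) (by linarith)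
  have h0 : riemannXi (1 / 2) ≠ 0 := by simpa using riemannXi_half_add_ofReal_ne_zero 0
  have := entire_summable_order_div differentiable_riemannXi h0 hC (by linarith)
    (by linarith : (1 + q) / 2 < q) h
  refine (this.comp_injective (Subtype.coe_injective (p := (· ∈ upperZetaZeros)))).congr
    fun ρ => ?_
  simp only [Function.comp_apply]
  rw [norm_zeroTau, analyticOrderNatAt_riemannXi_upper]

/-- A summable family has countable support, and no term of this one vanishes. Termwise integration
over the zeros needs countability. -/
instance : Countable upperZetaZeros := by
  have h := (summable_zetaMult_div (q := 2) (by norm_num)).countable_support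
  have hu : Function.support (fun ρ : upperZetaZeros => (zetaMult ρ : ℝ) / ‖zeroTau ρ‖ ^ (2 : ℝ))
      = Set.univ := by
    ext ρ
    simp only [Function.mem_support, Set.mem_univ, iff_true]
    have := zetaMult_pos ρ
    have := one_lt_norm_zeroTau ρ
    positivity
  rw [hu] at h
  exact Set.countable_univ_iff.1 h

/-- The partial fraction expansion of `(ξ'/ξ)'` on the real axis, with the zeros taken in pairs. -/
theorem hasSum_zeros_pairs (x : ℝ) :
    HasSum (fun ρ : upperZetaZeros => (zetaMult ρ : ℂ) *
        (1 / ((x : ℂ) + Complex.I * zeroTau ρ) ^ 2 + 1 / ((x : ℂ) - Complex.I * zeroTau ρ) ^ 2))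
      (-deriv (logDeriv riemannXi) (1 / 2 + x)) := by
  classical
  have hs := hasSum_riemannXi (riemannXi_half_add_ofReal_ne_zero x)
  set c : ℂ := 1 / 2 + x with hc
  set g : ℂ → ℂ := fun ρ => (analyticOrderNatAt riemannXi ρ : ℂ) / (c - ρ) ^ 2 with hg
  have hg0 : ∀ ρ : ℂ, riemannXi ρ ≠ 0 → g ρ = 0 := fun ρ h => by
    simp [hg, analyticOrderNatAt_eq_zero_of_ne h]
  -- There are no real zeros, so the two open half-planes exhaust the sum; the reflection `ρ ↦ 1 -
  -- ρ` carries the lower half onto the upper zeros with equal multiplicities.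
  set V : Set ℂ := {ρ | ρ.im < 0} with hV
  have h1 : HasSum (fun ρ : upperZetaZeros => g ρ) (∑' ρ : ℂ, upperZetaZeros.indicator g ρ) := by
    have := (hs.summable.indicator upperZetaZeros).hasSum
    exact hasSum_subtype_iff_indicator.2 this
  have h2 : HasSum (fun ρ : upperZetaZeros => g (1 - ρ)) (∑' ρ : ℂ, V.indicator g ρ) := by
    have := (hs.summable.indicator V).hasSum
    rw [← (Equiv.subLeft (1 : ℂ)).hasSum_iff] at this
    refine hasSum_subtype_iff_indicator (f := fun ρ => g (1 - ρ)) |>.2 ?_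
    have hfun : (upperZetaZeros.indicator fun ρ => g (1 - ρ)) =
        V.indicator g ∘ (Equiv.subLeft (1 : ℂ)) := ?_
    · rw [hfun]; exact this
    funext ρ
    simp only [Function.comp_apply, Equiv.subLeft_apply, Set.indicator_apply]
    by_cases hρ : ρ ∈ upperZetaZeros
    · have : 1 - ρ ∈ V := by simpa [hV] using (mem_upperZetaZeros_iff.1 hρ).2
      rw [if_pos hρ, if_pos this]
    · rw [if_neg hρ]
      by_cases hρV : 1 - ρ ∈ V
      · rw [if_pos hρV, hg0]
        intro h
        refine hρ (mem_upperZetaZeros_iff.2 ⟨by rwa [riemannXi_one_sub] at h, ?_⟩)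
        simpa [hV] using hρV
      · rw [if_neg hρV]
  have h3 := h1.add h2
  have h4 : ∑' ρ : ℂ, upperZetaZeros.indicator g ρ + ∑' ρ : ℂ, V.indicator g ρ
      = -deriv (logDeriv riemannXi) c := by
    rw [← (hs.summable.indicator upperZetaZeros).tsum_add (hs.summable.indicator V), ← hs.tsum_eq]
    refine tsum_congr fun ρ => ?_
    by_cases h0 : riemannXi ρ = 0
    · have him := (riemannXi_eq_zero h0).2.2.2
      rcases lt_or_gt_of_ne him with h | h
      · have a1 : ρ ∉ upperZetaZeros := fun h' => by
          have := (mem_upperZetaZeros_iff.1 h').2; linarith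
        rw [Set.indicator_of_notMem a1, Set.indicator_of_mem (show ρ ∈ V from h), zero_add]
      · have a1 : ρ ∈ upperZetaZeros := mem_upperZetaZeros_iff.2 ⟨h0, h⟩
        rw [Set.indicator_of_mem a1, Set.indicator_of_notMem (show ρ ∉ V from not_lt.2 h.le),
          add_zero]
    · simp [Set.indicator_apply, hg0 ρ h0]
  rw [h4] at h3
  convert! h3 using 2 with ρ
  have e1 : c - (ρ : ℂ) = x - Complex.I * zeroTau ρ := by rw [← sub_half_eq, hc]; ring
  have e2 : c - (1 - (ρ : ℂ)) = x + Complex.I * zeroTau ρ := by rw [← sub_half_eq, hc]; ring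
  simp only [hg]
  rw [analyticOrderNatAt_riemannXi_one_sub, e1, e2, analyticOrderNatAt_riemannXi_upper]
  ring

/-! ### The Mellin transform of `1 / (x + a)²`. -/

section MellinInvSq

open MeasureTheory Set

/-- A point `a` of the slit plane is away from the negative real axis, quantitatively. -/
theorem mul_le_norm_ofReal_add {a : ℂ} {κ : ℝ} (hκ : κ ≤ 1) (hκ0 : 0 ≤ κ)
    (h : -κ * ‖a‖ ≤ a.re) {x : ℝ} (hx : 0 ≤ x) :
    (1 - κ) / 2 * (x + ‖a‖) ≤ ‖(x : ℂ) + a‖ := by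
  have h1 : ‖(x : ℂ) + a‖ ^ 2 = x ^ 2 + 2 * x * a.re + ‖a‖ ^ 2 := by
    rw [Complex.sq_norm, Complex.sq_norm, Complex.normSq_apply, Complex.normSq_apply]
    simp
    ring
  have hn := norm_nonneg a
  have h2 : ((1 - κ) / 2 * (x + ‖a‖)) ^ 2 ≤ ‖(x : ℂ) + a‖ ^ 2 := by
    rw [h1]
    have h3 : -(2 * κ * (x * ‖a‖)) ≤ 2 * x * a.re := by nlinarith
    have h4 : ((1 - κ) / 2) ^ 2 ≤ (1 - κ) / 2 := by nlinarith
    have h5 : (x + ‖a‖) ^ 2 ≤ 2 * (x ^ 2 + ‖a‖ ^ 2) := by nlinarith [sq_nonneg (x - ‖a‖)]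
    have h6 : ((1 - κ) / 2 * (x + ‖a‖)) ^ 2 ≤ (1 - κ) * (x ^ 2 + ‖a‖ ^ 2) := by
      rw [mul_pow]
      nlinarith [sq_nonneg (x + ‖a‖)]
    nlinarith [sq_nonneg (x - ‖a‖)]
  exact le_of_sq_le_sq h2 (norm_nonneg _) 

theorem exists_mul_le_norm_ofReal_add {a : ℂ} (ha : a ∈ Complex.slitPlane) :
    ∃ c : ℝ, 0 < c ∧ ∀ x : ℝ, 0 ≤ x → c * (x + ‖a‖) ≤ ‖(x : ℂ) + a‖ := by
  have hpos : 0 < ‖a‖ := norm_pos_iff.2 (Complex.slitPlane_ne_zero ha)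
  have hlt : -a.re < ‖a‖ := by
    rcases Complex.mem_slitPlane_iff.1 ha with h | h
    · linarith
    · refine (neg_le_abs _).trans_lt (Complex.abs_re_lt_norm.2 h)
  set κ := max 0 (-a.re / ‖a‖) with hκ
  have h1 : κ < 1 := max_lt one_pos ((div_lt_one hpos).2 hlt)
  refine ⟨(1 - κ) / 2, by linarith, fun x hx =>
    mul_le_norm_ofReal_add h1.le (le_max_left _ _) ?_ hx⟩
  have h2 : -a.re / ‖a‖ ≤ κ := le_max_right _ _
  rw [div_le_iff₀ hpos] at h2
  linarith

theorem ofReal_add_ne_zero {a : ℂ} (ha : a ∈ Complex.slitPlane) {x : ℝ} (hx : 0 ≤ x) :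
    (x : ℂ) + a ≠ 0 := by
  obtain ⟨c, hc, h⟩ := exists_mul_le_norm_ofReal_add ha
  have := h x hx
  have hpos : 0 < ‖a‖ := norm_pos_iff.2 (Complex.slitPlane_ne_zero ha)
  rw [← norm_pos_iff]
  exact lt_of_lt_of_le (by positivity) this

/-- Mellin convergence for functions with a bound `C / (x + 1) ^ 2`. -/
theorem mellinConvergent_of_norm_le {f : ℝ → ℂ} {C : ℝ} (hf : ContinuousOn f (Ioi 0))
    (hC : ∀ x, 0 < x → ‖f x‖ ≤ C / (x + 1) ^ 2) {s : ℂ} (h0 : 0 < s.re) (h2 : s.re < 2) :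
    MellinConvergent f s := by
  have hC0 : 0 ≤ C := by
    have := (norm_nonneg _).trans (hC 1 one_pos)
    norm_num at this
    linarith
  refine mellinConvergent_of_isBigO_rpow (a := 2) (b := 0)
    (hf.locallyIntegrableOn measurableSet_Ioi) ?_ h2 ?_ h0
  · refine IsBigO.of_bound C ?_
    filter_upwards [eventually_gt_atTop 0] with x hx
    refine (hC x hx).trans ?_
    rw [Real.norm_of_nonneg (by positivity), Real.rpow_neg hx.le, Real.rpow_two, div_eq_mul_inv]
    gcongr
    linarith
  · refine IsBigO.of_bound C ?_
    filter_upwards [self_mem_nhdsWithin] with x hx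
    have hx : 0 < x := hx
    refine (hC x hx).trans ?_
    rw [neg_zero, Real.rpow_zero, norm_one, mul_one]
    exact div_le_self hC0 (one_le_pow₀ (by linarith))

theorem mellinConvergent_inv_sq {a : ℂ} (ha : a ∈ Complex.slitPlane) {s : ℂ} (h0 : 0 < s.re)
    (h2 : s.re < 2) : MellinConvergent (fun x : ℝ => 1 / ((x : ℂ) + a) ^ 2) s := by
  obtain ⟨c, hc, h⟩ := exists_mul_le_norm_ofReal_add ha
  have hpos : 0 < ‖a‖ := norm_pos_iff.2 (Complex.slitPlane_ne_zero ha)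
  set d := c * min ‖a‖ 1 with hd
  have hd0 : 0 < d := by positivity
  refine mellinConvergent_of_norm_le (C := 1 / d ^ 2) ?_ (fun x hx => ?_) h0 h2
  · refine continuousOn_const.div (by fun_prop) fun x hx => pow_ne_zero _ ?_
    exact ofReal_add_ne_zero ha (le_of_lt hx)
  · have h3 : d * (x + 1) ≤ ‖(x : ℂ) + a‖ := by
      refine le_trans ?_ (h x hx.le)
      rw [hd, mul_assoc]
      gcongr
      have h4 : min ‖a‖ 1 ≤ 1 := min_le_right _ _
      have h5 : min ‖a‖ 1 ≤ ‖a‖ := min_le_left _ _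
      nlinarith
    rw [norm_div, norm_one, norm_pow, div_div, ← mul_pow]
    gcongr

/-- For positive `a`, `1/(x + a)² = ∫₀^∞ t e^(-(x + a)t) dt`; by Fubini the double integral
separates into two Gamma integrals, in `x` and then in `t`. -/
theorem mellin_inv_sq_of_pos {a : ℝ} (ha : 0 < a) {s : ℂ} (h0 : 0 < s.re) (h2 : s.re < 2) :
    mellin (fun x : ℝ => 1 / ((x : ℂ) + a) ^ 2) s =
      (a : ℂ) ^ (s - 2) * Complex.Gamma s * Complex.Gamma (2 - s) := by
  have hslit : (a : ℂ) ∈ Complex.slitPlane := Complex.ofReal_mem_slitPlane.2 ha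
  have hconv := mellinConvergent_inv_sq hslit h0 h2
  set F : ℝ × ℝ → ℂ := fun p =>
    ((p.1 : ℂ) ^ (s - 1)) * ((p.2 : ℂ) * Complex.exp (-(((p.1 + a : ℝ) : ℂ) * p.2))) with hF
  have hFm : AEStronglyMeasurable F
      ((volume.restrict (Ioi (0 : ℝ))).prod (volume.restrict (Ioi (0 : ℝ)))) := by
    apply Measurable.aestronglyMeasurable
    fun_prop
  have hre : ∀ x : ℝ, 0 < x → ∫ t in Ioi (0 : ℝ), t * Real.exp (-((x + a) * t)) = 1 / (x + a) ^ 2 := by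
    intro x hx
    have := Real.integral_rpow_mul_exp_neg_mul_Ioi (a := 2) (r := x + a) two_pos (by positivity)
    norm_num at this
    simpa using this
  have hint : ∀ x : ℝ, 0 < x → IntegrableOn (fun t : ℝ => t * Real.exp (-((x + a) * t))) (Ioi 0) := by
    intro x hx
    have := integrableOn_rpow_mul_exp_neg_mul_rpow (p := 1) (s := 1) (b := x + a) (by norm_num)
      one_pos (by positivity)
    refine this.congr_fun (fun t ht => ?_) measurableSet_Ioi
    simp only [Real.rpow_one, neg_mul]
  have hnorm : ∀ x : ℝ, 0 < x → ∀ t : ℝ, 0 < t →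
      ‖F (x, t)‖ = x ^ (s.re - 1) * (t * Real.exp (-((x + a) * t))) := by
    intro x hx t ht
    simp only [hF, norm_mul]
    rw [Complex.norm_cpow_eq_rpow_re_of_pos hx, Complex.norm_exp, Complex.norm_of_nonneg ht.le]
    simp
  have hFi : Integrable F
      ((volume.restrict (Ioi (0 : ℝ))).prod (volume.restrict (Ioi (0 : ℝ)))) := by
    rw [integrable_prod_iff hFm]
    constructor
    · filter_upwards [ae_restrict_mem measurableSet_Ioi] with x hx
      have h3 : Integrable (fun t : ℝ => ((t * Real.exp (-((x + a) * t)) : ℝ) : ℂ))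
        (volume.restrict (Ioi 0)) := (hint x hx).ofReal
      refine (h3.const_mul ((x : ℂ) ^ (s - 1))).congr (Eventually.of_forall fun t => ?_)
      simp [hF]
    · have h4 : Integrable (fun x : ℝ => ‖(x : ℂ) ^ (s - 1) • (1 / ((x : ℂ) + a) ^ 2)‖)
        (volume.restrict (Ioi 0)) := hconv.norm
      refine h4.congr ?_
      filter_upwards [ae_restrict_mem measurableSet_Ioi] with x hx
      have hx : 0 < x := hx
      rw [setIntegral_congr_fun measurableSet_Ioi fun t ht => hnorm x hx t ht,
        integral_const_mul, hre x hx, norm_smul, Complex.norm_cpow_eq_rpow_re_of_pos hx]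
      congr 1
      rw [norm_div, norm_one, norm_pow, ← Complex.ofReal_add, Complex.norm_of_nonneg (by positivity)]
  have hswap := integral_integral_swap (f := fun x t => F (x, t)) hFi
  have hleft : ∫ x in Ioi (0 : ℝ), ∫ t in Ioi (0 : ℝ), F (x, t) =
      mellin (fun x : ℝ => 1 / ((x : ℂ) + a) ^ 2) s := by
    refine setIntegral_congr_fun measurableSet_Ioi fun x hx => ?_
    have hx : 0 < x := hx
    have h5 : ∫ t in Ioi (0 : ℝ), F (x, t) = (x : ℂ) ^ (s - 1) *
        ((∫ t in Ioi (0 : ℝ), t * Real.exp (-((x + a) * t)) : ℝ) : ℂ) := by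
      rw [← integral_complex_ofReal, ← integral_const_mul]
      refine integral_congr_ae (Eventually.of_forall fun t => ?_)
      simp [hF]
    simp only [smul_eq_mul]
    rw [h5, hre x hx]
    push_cast
    rfl
  have hright : ∫ t in Ioi (0 : ℝ), ∫ x in Ioi (0 : ℝ), F (x, t) =
      (a : ℂ) ^ (s - 2) * Complex.Gamma s * Complex.Gamma (2 - s) := by
    have h6 : ∀ t ∈ Ioi (0 : ℝ), ∫ x in Ioi (0 : ℝ), F (x, t) =
        Complex.Gamma s * ((t : ℂ) ^ ((2 - s) - 1) * Complex.exp (-(a * t))) := by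
      intro t ht
      have ht : 0 < t := ht
      have h7 := Complex.integral_cpow_mul_exp_neg_mul_Ioi h0 ht
      have h8 : ∀ x : ℝ, F (x, t) = (t : ℂ) * Complex.exp (-(a * t)) *
          ((x : ℂ) ^ (s - 1) * Complex.exp (-(t * x))) := by
        intro x
        simp only [hF]
        have : Complex.exp (-(((x + a : ℝ) : ℂ) * t)) =
            Complex.exp (-(a * t)) * Complex.exp (-(t * x)) := by
          rw [← Complex.exp_add]; congr 1; push_cast; ring
        rw [this]; ring
      simp only [h8]
      rw [integral_const_mul, h7]
      have ht0 : (t : ℂ) ≠ 0 := Complex.ofReal_ne_zero.2 ht.ne'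
      have h9 : (t : ℂ) ^ ((2 - s) - 1) = t * (1 / (t : ℂ)) ^ s := by
        rw [show (2 - s) - 1 = 1 + -s by ring, Complex.cpow_add _ _ ht0, Complex.cpow_one,
          Complex.cpow_neg, one_div, Complex.inv_cpow]
        rw [Complex.arg_ofReal_of_nonneg ht.le]
        exact Real.pi_pos.ne
      rw [h9]; ring
    rw [setIntegral_congr_fun measurableSet_Ioi h6, integral_const_mul]
    have h10 := Complex.integral_cpow_mul_exp_neg_mul_Ioi (a := 2 - s) (r := a)
      (by simp; linarith) ha
    rw [h10, one_div, Complex.inv_cpow, ← Complex.cpow_neg, neg_sub]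
    · ring
    · rw [Complex.arg_ofReal_of_nonneg ha.le]
      exact Real.pi_pos.ne
  rw [← hleft, hswap, hright]

/-- Differentiation under the integral: for `b` within `d/2` of `a` the denominators stay above
`(d/2)(x + 1)`, so the derivatives are dominated by a multiple of the integrand with `a = 1`. -/
theorem differentiableAt_mellin_inv_sq {a : ℂ} (ha : a ∈ Complex.slitPlane) {s : ℂ}
    (h0 : 0 < s.re) (h2 : s.re < 2) :
    DifferentiableAt ℂ (fun a : ℂ => mellin (fun x : ℝ => 1 / ((x : ℂ) + a) ^ 2) s) a := by
  obtain ⟨c, hc, h⟩ := exists_mul_le_norm_ofReal_add ha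
  have hpos : 0 < ‖a‖ := norm_pos_iff.2 (Complex.slitPlane_ne_zero ha)
  set d := c * min ‖a‖ 1 with hd
  have hd0 : 0 < d := by positivity
  have hbd : ∀ x : ℝ, 0 ≤ x → d * (x + 1) ≤ ‖(x : ℂ) + a‖ := by
    intro x hx
    refine le_trans ?_ (h x hx)
    rw [hd, mul_assoc]
    gcongr
    have h4 : min ‖a‖ 1 ≤ 1 := min_le_right _ _
    have h5 : min ‖a‖ 1 ≤ ‖a‖ := min_le_left _ _
    nlinarith
  have hbd' : ∀ b ∈ Metric.ball a (d / 2), ∀ x : ℝ, 0 ≤ x → d / 2 * (x + 1) ≤ ‖(x : ℂ) + b‖ := by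
    intro b hb x hx
    have h1 := hbd x hx
    have h3 : ‖(x : ℂ) + a‖ ≤ ‖(x : ℂ) + b‖ + ‖a - b‖ := by
      have : (x : ℂ) + a = (x + b) + (a - b) := by ring
      rw [this]; exact norm_add_le _ _
    rw [mem_ball_iff_norm, norm_sub_rev] at hb
    nlinarith
  have hne : ∀ b ∈ Metric.ball a (d / 2), ∀ x : ℝ, 0 ≤ x → (x : ℂ) + b ≠ 0 := by
    intro b hb x hx h'
    have := hbd' b hb x hx
    rw [h', norm_zero] at this
    have : 0 < d / 2 * (x + 1) := by positivity
    linarith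
  have hbound : Integrable (fun x : ℝ => (2 / (d / 2) ^ 3) *
      ‖(x : ℂ) ^ (s - 1) • (1 / ((x : ℂ) + (1 : ℝ)) ^ 2)‖) (volume.restrict (Ioi 0)) :=
    (mellinConvergent_inv_sq (a := ((1 : ℝ) : ℂ)) (by simp) h0 h2).norm.const_mul _
  refine (hasDerivAt_integral_of_dominated_loc_of_deriv_le (𝕜 := ℂ)
    (μ := volume.restrict (Ioi (0 : ℝ)))
    (F := fun b x => (x : ℂ) ^ (s - 1) • (1 / ((x : ℂ) + b) ^ 2))
    (F' := fun b x => (x : ℂ) ^ (s - 1) • (-2 / ((x : ℂ) + b) ^ 3))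
    (Metric.ball_mem_nhds a (half_pos hd0)) ?_ (mellinConvergent_inv_sq ha h0 h2) ?_ ?_
    hbound ?_).2.differentiableAt
  · refine Eventually.of_forall fun b => ?_
    apply Measurable.aestronglyMeasurable
    fun_prop
  · apply Measurable.aestronglyMeasurable
    fun_prop
  · filter_upwards [ae_restrict_mem measurableSet_Ioi] with x hx b hb
    have hx : 0 < x := hx
    rw [norm_smul, norm_smul, mul_left_comm]
    gcongr
    rw [norm_div, norm_pow, norm_div, norm_one, norm_pow, ← Complex.ofReal_add,
      Complex.norm_of_nonneg (by positivity : 0 ≤ x + 1), norm_neg, Complex.norm_ofNat, div_mul_div_comm,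
      mul_one]
    refine div_le_div_of_nonneg_left (by norm_num) (by positivity) ?_
    calc (d / 2) ^ 3 * (x + 1) ^ 2 ≤ (d / 2) ^ 3 * (x + 1) ^ 3 := by
          gcongr <;> linarith
      _ = (d / 2 * (x + 1)) ^ 3 := by ring
      _ ≤ _ := by gcongr; exact hbd' b hb x hx.le
  · filter_upwards [ae_restrict_mem measurableSet_Ioi] with x hx b hb
    have h3 := hne b hb x (le_of_lt hx)
    have h4 : HasDerivAt (fun b : ℂ => 1 / ((x : ℂ) + b) ^ 2) (-2 / ((x : ℂ) + b) ^ 3) b := by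
      have := (((hasDerivAt_id b).const_add (x : ℂ)).pow 2).inv (pow_ne_zero _ h3)
      refine (this.congr_deriv ?_).congr_of_eventuallyEq
        (Eventually.of_forall fun y => by simp)
      simp
      field_simp
    simp only [smul_eq_mul]
    exact h4.const_mul _

/-- Both sides are analytic in `a` on the slit plane and agree at positive reals accumulating at 1.
-/
theorem mellin_inv_sq {a : ℂ} (ha : a ∈ Complex.slitPlane) {s : ℂ} (h0 : 0 < s.re)
    (h2 : s.re < 2) :
    mellin (fun x : ℝ => 1 / ((x : ℂ) + a) ^ 2) s =
      a ^ (s - 2) * Complex.Gamma s * Complex.Gamma (2 - s) := by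
  have hA : AnalyticOnNhd ℂ (fun a : ℂ => mellin (fun x : ℝ => 1 / ((x : ℂ) + a) ^ 2) s)
      Complex.slitPlane :=
    DifferentiableOn.analyticOnNhd (fun a ha =>
      (differentiableAt_mellin_inv_sq ha h0 h2).differentiableWithinAt) Complex.isOpen_slitPlane
  have hB : AnalyticOnNhd ℂ (fun a : ℂ => a ^ (s - 2) * Complex.Gamma s * Complex.Gamma (2 - s))
      Complex.slitPlane :=
    DifferentiableOn.analyticOnNhd (fun a ha =>
      (((differentiableAt_id.cpow_const ha).mul_const _).mul_const _).differentiableWithinAt)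
      Complex.isOpen_slitPlane
  refine hA.eqOn_of_preconnected_of_frequently_eq hB
    (Complex.starConvex_one_slitPlane.isPathConnected (by simp)).isConnected.isPreconnected (z₀ := 1) (by simp) ?_ ha
  have hseq : Tendsto (fun n : ℕ => ((1 + 1 / ((n : ℝ) + 1) : ℝ) : ℂ)) atTop (𝓝[≠] 1) := by
    refine tendsto_nhdsWithin_iff.2 ⟨?_, Eventually.of_forall fun n => ?_⟩
    · have : Tendsto (fun n : ℕ => 1 + 1 / ((n : ℝ) + 1)) atTop (𝓝 (1 + 0)) :=
        tendsto_const_nhds.add tendsto_one_div_add_atTop_nhds_zero_nat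
      rw [add_zero] at this
      have h3 := (Complex.continuous_ofReal.tendsto (1 : ℝ)).comp this
      simpa [Function.comp_def] using h3
    · intro h
      have h5 := Complex.ofReal_injective (h : ((1 + 1 / ((n : ℝ) + 1) : ℝ) : ℂ) = ((1 : ℝ) : ℂ))
      have : 0 < 1 / ((n : ℝ) + 1) := by positivity
      linarith
  refine hseq.frequently (Frequently.of_forall fun n => ?_)
  exact mellin_inv_sq_of_pos (by positivity) h0 h2

end MellinInvSq

/-! ### Termwise Mellin transforms of sums of inverse squares. -/

section MellinSum

open MeasureTheory Set

/-- Termwise Mellin transformation of a sum of functions `c i / (x + a i) ^ 2`. -/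
theorem hasSum_mellin_inv_sq {ι : Type*} [Countable ι] {a c : ι → ℂ}
    (ha : ∀ i, a i ∈ Complex.slitPlane) (hre : ∀ i, -(1 / 2) * ‖a i‖ ≤ (a i).re) {s : ℂ}
    (h0 : 0 < s.re) (h2 : s.re < 2) (hs : Summable fun i => ‖c i‖ * ‖a i‖ ^ (s.re - 2)) :
    HasSum (fun i => c i * ((a i) ^ (s - 2) * Complex.Gamma s * Complex.Gamma (2 - s)))
      (mellin (fun x : ℝ => ∑' i, c i * (1 / ((x : ℂ) + a i) ^ 2)) s) := by
  set B : ℝ := ‖mellin (fun x : ℝ => 1 / ((x : ℂ) + (1 : ℝ)) ^ 2) s‖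
  have hpos : ∀ i, 0 < ‖a i‖ := fun i => norm_pos_iff.2 (Complex.slitPlane_ne_zero (ha i))
  set G : ι → ℝ → ℂ := fun i x => (x : ℂ) ^ (s - 1) • (c i * (1 / ((x : ℂ) + a i) ^ 2)) with hG
  have hGi : ∀ i, Integrable (G i) (volume.restrict (Ioi 0)) := fun i => by
    have := (mellinConvergent_inv_sq (ha i) h0 h2).const_smul (c i)
    exact this
  have hreal : ∀ r : ℝ, 0 < r → ∫ x in Ioi (0 : ℝ), x ^ (s.re - 1) / (x + r) ^ 2 =
      r ^ (s.re - 2) * (Real.Gamma s.re * Real.Gamma (2 - s.re)) := by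
    intro r hr
    have h3 := mellin_inv_sq_of_pos hr (s := (s.re : ℂ)) (by simpa) (by simpa)
    have h4 : mellin (fun x : ℝ => 1 / ((x : ℂ) + r) ^ 2) (s.re : ℂ) =
        ((∫ x in Ioi (0 : ℝ), x ^ (s.re - 1) / (x + r) ^ 2 : ℝ) : ℂ) := by
      rw [mellin, ← integral_complex_ofReal]
      refine setIntegral_congr_fun measurableSet_Ioi fun x hx => ?_
      have hx : 0 < x := hx
      simp only [smul_eq_mul]
      push_cast
      rw [Complex.ofReal_cpow hx.le]
      push_cast
      ring
    rw [h4] at h3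
    have h5 : (r : ℂ) ^ ((s.re : ℂ) - 2) * Complex.Gamma s.re * Complex.Gamma (2 - s.re) =
        ((r ^ (s.re - 2) * (Real.Gamma s.re * Real.Gamma (2 - s.re)) : ℝ) : ℂ) := by
      push_cast
      rw [Complex.ofReal_cpow hr.le, ← Complex.Gamma_ofReal, ← Complex.Gamma_ofReal]
      push_cast
      ring
    rw [h5] at h3
    exact_mod_cast h3
  have hreali : ∀ r : ℝ, 0 < r →
      IntegrableOn (fun x : ℝ => x ^ (s.re - 1) / (x + r) ^ 2) (Ioi (0 : ℝ)) := by
    intro r hr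
    have h3 : IntegrableOn _ _ _ :=
      (mellinConvergent_inv_sq (a := (r : ℂ)) (Complex.ofReal_mem_slitPlane.2 hr) h0 h2).norm
    refine h3.congr_fun (fun x hx => ?_) measurableSet_Ioi
    have hx : 0 < x := hx
    simp only []
    rw [norm_smul, Complex.norm_cpow_eq_rpow_re_of_pos hx, norm_div, norm_one, norm_pow,
      ← Complex.ofReal_add, Complex.norm_of_nonneg (by positivity)]
    simp [div_eq_mul_inv]
  -- The sector condition gives `|x + a| ≥ (x + |a|)/4`, whence the factor `16`; the remaining real
  -- integral scales as `|a|^(Re s - 2)`.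
  have hGn : ∀ i, ∫ x in Ioi (0 : ℝ), ‖G i x‖ ≤
      (16 * (Real.Gamma s.re * Real.Gamma (2 - s.re))) * (‖c i‖ * ‖a i‖ ^ (s.re - 2)) := by
    intro i
    calc ∫ x in Ioi (0 : ℝ), ‖G i x‖ ≤
        ∫ x in Ioi (0 : ℝ), (16 * ‖c i‖) * (x ^ (s.re - 1) / (x + ‖a i‖) ^ 2) := by
          refine setIntegral_mono_on (hGi i).norm ((hreali _ (hpos i)).const_mul _)
            measurableSet_Ioi fun x hx => ?_
          have hx : 0 < x := hx
          have h6 := mul_le_norm_ofReal_add (by norm_num) (by norm_num) (hre i) hx.le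
          have h7 : ((x + ‖a i‖) / 4) ^ 2 ≤ ‖(x : ℂ) + a i‖ ^ 2 := by
            have := hpos i
            gcongr
            linarith
          rw [hG]
          simp only [norm_smul, norm_mul, norm_div, norm_one, norm_pow]
          rw [Complex.norm_cpow_eq_rpow_re_of_pos hx, Complex.sub_re, Complex.one_re]
          have := hpos i
          calc x ^ (s.re - 1) * (‖c i‖ * (1 / ‖(x : ℂ) + a i‖ ^ 2)) ≤
              x ^ (s.re - 1) * (‖c i‖ * (1 / ((x + ‖a i‖) / 4) ^ 2)) := by gcongr
            _ = _ := by field_simp; ring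
      _ = _ := by
          rw [integral_const_mul, hreal _ (hpos i)]
          ring
  have hsum := hasSum_integral_of_summable_integral_norm hGi
    (Summable.of_nonneg_of_le (fun i => integral_nonneg fun x => norm_nonneg _) hGn
      (hs.mul_left _))
  have h8 : ∀ i, ∫ x in Ioi (0 : ℝ), G i x =
      c i * ((a i) ^ (s - 2) * Complex.Gamma s * Complex.Gamma (2 - s)) := by
    intro i
    rw [← mellin_inv_sq (ha i) h0 h2]
    exact mellin_const_smul _ _ (c i)
  simp only [h8] at hsum
  convert! hsum using 1
  refine setIntegral_congr_fun measurableSet_Ioi fun x _ => ?_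
  simp only [hG, smul_eq_mul]
  rw [tsum_mul_left]

end MellinSum

/-! ### The digamma function on the positive axis. -/

section Digamma

open Set

theorem digamma_ofReal {x : ℝ} (hx : 0 < x) :
    Complex.digamma x = ((deriv (fun y => Real.log (Real.Gamma y)) x : ℝ) : ℂ) := by
  have hG := Real.Gamma_pos_of_pos hx
  have hd : DifferentiableAt ℝ Real.Gamma x :=
    Real.differentiableAt_Gamma fun m h => by
      have : (0 : ℝ) ≤ m := m.cast_nonneg
      linarith
  have hdc : DifferentiableAt ℂ Complex.Gamma x :=
    Complex.differentiableAt_Gamma _ fun m h => by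
      have h1 : x = -m := by exact_mod_cast h
      have : (0 : ℝ) ≤ m := m.cast_nonneg
      linarith
  have h1 : HasDerivAt (fun y : ℝ => Complex.Gamma y) (deriv Complex.Gamma x) x :=
    hdc.hasDerivAt.comp_ofReal
  have h2 : HasDerivAt (fun y : ℝ => Complex.Gamma y) ((deriv Real.Gamma x : ℝ) : ℂ) x := by
    simpa only [Complex.Gamma_ofReal] using hd.hasDerivAt.ofReal_comp
  rw [Complex.digamma_def, logDeriv_apply, h1.unique h2, Complex.Gamma_ofReal,
    deriv.log hd hG.ne']
  push_cast
  rfl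

/-- By log-convexity of `Γ`, the slope of `log Γ` over `[x, x + 1]`, which is `log x`, lies between
the derivatives at the endpoints; the recurrence `ψ(x + 1) = ψ(x) + 1/x` brings the right one back
to `x`. -/
theorem log_sub_le_digamma_le {x : ℝ} (hx : 0 < x) :
    Real.log x - 1 / x ≤ deriv (fun y => Real.log (Real.Gamma y)) x ∧
      deriv (fun y => Real.log (Real.Gamma y)) x ≤ Real.log x := by
  have hconv := Real.convexOn_log_Gamma
  have hdiff : ∀ y : ℝ, 0 < y → DifferentiableAt ℝ (fun y => Real.log (Real.Gamma y)) y :=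
    fun y hy => (Real.differentiableAt_Gamma fun m h => by
      have : (0 : ℝ) ≤ m := m.cast_nonneg
      linarith).log (Real.Gamma_pos_of_pos hy).ne'
  have hslope : slope (Real.log ∘ Real.Gamma) x (x + 1) = Real.log x := by
    rw [slope_def_field, Function.comp, Function.comp, Real.Gamma_add_one hx.ne',
      Real.log_mul hx.ne' (Real.Gamma_pos_of_pos hx).ne']
    ring
  have hx1 : (0 : ℝ) < x + 1 := by linarith
  have h1 := hconv.deriv_le_slope (mem_Ioi.2 hx) (mem_Ioi.2 hx1) (by linarith)
    (hdiff x hx)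
  have h2 := hconv.slope_le_deriv (mem_Ioi.2 hx) (mem_Ioi.2 hx1) (by linarith)
    (hdiff _ hx1)
  rw [hslope] at h1 h2
  refine ⟨?_, h1⟩
  have h3 := Complex.digamma_apply_add_one (x : ℂ) fun m h => by
    have h1 : x = -m := by exact_mod_cast h
    have : (0 : ℝ) ≤ m := m.cast_nonneg
    linarith
  have h4 : Complex.digamma ((x : ℂ) + 1) = Complex.digamma ((x + 1 : ℝ) : ℂ) := by push_cast; rfl
  rw [h4, digamma_ofReal hx, digamma_ofReal hx1] at h3
  have h5 : deriv (fun y => Real.log (Real.Gamma y)) (x + 1) =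
      deriv (fun y => Real.log (Real.Gamma y)) x + x⁻¹ := by exact_mod_cast h3
  have h6 : deriv (Real.log ∘ Real.Gamma) (x + 1) = 
    deriv (fun y => Real.log (Real.Gamma y)) (x + 1) := rfl
  rw [h6, h5] at h2
  rw [one_div]
  linarith

theorem norm_digamma_sub_log_le {x : ℝ} (hx : 0 < x) :
    ‖Complex.digamma x - (Real.log x : ℂ)‖ ≤ 1 / x := by
  obtain ⟨h1, h2⟩ := log_sub_le_digamma_le hx
  rw [digamma_ofReal hx, ← Complex.ofReal_sub, Complex.norm_real, Real.norm_eq_abs, abs_le]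
  have : 0 < 1 / x := by positivity
  constructor <;> linarith

theorem digamma_add_natCast {x : ℝ} (hx : 0 < x) (N : ℕ) :
    Complex.digamma ((x + N : ℝ) : ℂ) =
      Complex.digamma x + ∑ n ∈ Finset.range N, 1 / ((x : ℂ) + n) := by
  induction N with
  | zero => simp
  | succ N ih =>
    have h3 := Complex.digamma_apply_add_one ((x + N : ℝ) : ℂ) fun m h => by
      have h1 : x + N = -m := by exact_mod_cast h
      have : (0 : ℝ) ≤ m := m.cast_nonneg
      have : (0 : ℝ) ≤ N := N.cast_nonneg
      linarith
    rw [Finset.sum_range_succ, ← add_assoc, ← ih]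
    have h4 : ((x + ((N + 1 : ℕ) : ℝ) : ℝ) : ℂ) = ((x + N : ℝ) : ℂ) + 1 := by push_cast; ring
    rw [h4, h3]
    push_cast
    rw [one_div]

theorem summable_inv_add_natCast_sq {x : ℝ} (hx : 0 < x) :
    Summable fun n : ℕ => 1 / (x + n) ^ 2 := by
  have h := Real.summable_one_div_nat_add_rpow x 2
  refine (h.2 (by norm_num)).congr fun n => ?_
  have : 0 < (n : ℝ) + x := by positivity
  rw [abs_of_pos this, Real.rpow_two, add_comm]

/-- The recurrence telescopes the partial sums to `ψ(x) - ψ(y) + ψ(y + N) - ψ(x + N)`. The last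
difference tends to 0, because `ψ(z) - log z` does and so does `log((y + N)/(x + N))`. -/
theorem hasSum_digamma_sub {x y : ℝ} (hx : 0 < x) (hy : 0 < y) :
    HasSum (fun n : ℕ => 1 / ((y : ℂ) + n) - 1 / ((x : ℂ) + n))
      (Complex.digamma x - Complex.digamma y) := by
  have hne : ∀ {z : ℝ}, 0 < z → ∀ n : ℕ, (z : ℂ) + n ≠ 0 := by
    intro z hz n
    have : 0 < z + n := by positivity
    exact_mod_cast this.ne'
  have hs : Summable (fun n : ℕ => 1 / ((y : ℂ) + n) - 1 / ((x : ℂ) + n)) := by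
    set m := min x y with hm
    have hm0 : 0 < m := lt_min hx hy
    refine Summable.of_norm_bounded ((summable_inv_add_natCast_sq hm0).mul_left |x - y|)
      fun n => ?_
    rw [div_sub_div _ _ (hne hy n) (hne hx n), norm_div, norm_mul]
    have h1 : (1 * ((x : ℂ) + n) - ((y : ℂ) + n) * 1) = ((x - y : ℝ) : ℂ) := by push_cast; ring
    have h2 : ∀ z : ℝ, 0 < z → ‖(z : ℂ) + n‖ = z + n := fun z hz => by
      have h3 : (z : ℂ) + n = ((z + n : ℝ) : ℂ) := by push_cast; rfl
      rw [h3, Complex.norm_of_nonneg (by positivity)]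
    rw [h1, h2 y hy, h2 x hx, Complex.norm_real, Real.norm_eq_abs, ← div_eq_mul_one_div, sq]
    have h4 := min_le_left x y
    have h5 := min_le_right x y
    gcongr
  refine (hs.hasSum_iff_tendsto_nat).2 ?_
  have hpart : ∀ N : ℕ, ∑ n ∈ Finset.range N, (1 / ((y : ℂ) + n) - 1 / ((x : ℂ) + n)) =
      (Complex.digamma x - Complex.digamma y) +
        ((Complex.digamma ((y + N : ℝ) : ℂ) - Real.log (y + N)) -
          (Complex.digamma ((x + N : ℝ) : ℂ) - Real.log (x + N)) +
          ((Real.log ((y + N) / (x + N)) : ℝ) : ℂ)) := by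
    intro N
    rw [Finset.sum_sub_distrib, digamma_add_natCast hx, digamma_add_natCast hy,
      Real.log_div (by positivity) (by positivity)]
    push_cast
    ring
  simp only [hpart]
  have hat : ∀ z : ℝ, Tendsto (fun N : ℕ => z + (N : ℝ)) atTop atTop := fun z =>
    tendsto_atTop_add_const_left _ _ tendsto_natCast_atTop_atTop
  have hz : ∀ z : ℝ, 0 < z → Tendsto (fun N : ℕ => Complex.digamma ((z + N : ℝ) : ℂ) -
      (Real.log (z + N) : ℂ)) atTop (𝓝 0) := by
    intro z hz
    have h1 : Tendsto (fun N : ℕ => 1 / (z + (N : ℝ))) atTop (𝓝 0) := by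
      exact (hat z).inv_tendsto_atTop.congr fun N => by simp
    exact squeeze_zero_norm (fun N => norm_digamma_sub_log_le (by positivity)) h1
  have hl : Tendsto (fun N : ℕ => ((Real.log ((y + N) / (x + N)) : ℝ) : ℂ)) atTop (𝓝 0) := by
    have h1 : Tendsto (fun N : ℕ => (y + (N : ℝ)) / (x + N)) atTop (𝓝 1) := by
      have h2 : Tendsto (fun N : ℕ => 1 + (y - x) * (x + (N : ℝ))⁻¹) atTop (𝓝 (1 + (y - x) * 0)) :=
        tendsto_const_nhds.add ((hat x).inv_tendsto_atTop.const_mul _)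
      rw [mul_zero, add_zero] at h2
      refine h2.congr fun N => ?_
      have : 0 < x + (N : ℝ) := by positivity
      field_simp
      ring
    have h3 := (Real.continuousAt_log one_ne_zero).tendsto.comp h1
    rw [Real.log_one] at h3
    simpa [Function.comp_def] using (Complex.continuous_ofReal.tendsto 0).comp h3
  simpa using tendsto_const_nhds.add (((hz y hy).sub (hz x hx)).add hl)

/-- Termwise differentiation of the series for `ψ(y) - ψ(1)` on `y > x/2`. Working along the real
line is enough, since `ψ` is complex differentiable at `x`. -/
theorem deriv_digamma_ofReal {x : ℝ} (hx : 0 < x) :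
    deriv Complex.digamma x = ∑' n : ℕ, 1 / ((x : ℂ) + n) ^ 2 := by
  have hne : ∀ {z : ℝ}, 0 < z → ∀ n : ℕ, (z : ℂ) + n ≠ 0 := by
    intro z hz n
    have : 0 < z + n := by positivity
    exact_mod_cast this.ne'
  have han : AnalyticAt ℂ Complex.Gamma x := by
    rw [Complex.analyticAt_iff_eventually_differentiableAt]
    have : ∀ᶠ z : ℂ in 𝓝 (x : ℂ), 0 < z.re :=
      (isOpen_lt continuous_const Complex.continuous_re).mem_nhds (by simpa)
    filter_upwards [this] with z hz
    refine Complex.differentiableAt_Gamma _ fun m h => ?_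
    rw [h] at hz
    have : (0 : ℝ) ≤ m := m.cast_nonneg
    simp at hz
    linarith
  have hd : DifferentiableAt ℂ Complex.digamma x := by
    rw [Complex.digamma_def]
    exact (han.deriv.div han (Complex.Gamma_ne_zero_of_re_pos (by simpa))).differentiableAt
  have h1 : HasDerivAt (fun y : ℝ => Complex.digamma y) (deriv Complex.digamma x) x :=
    hd.hasDerivAt.comp_ofReal
  have h2 : HasDerivAt (fun y : ℝ => ∑' n : ℕ, (1 / (((1 : ℝ) : ℂ) + n) - 1 / ((y : ℂ) + n)))
      (∑' n : ℕ, 1 / ((x : ℂ) + n) ^ 2) x := by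
    refine hasDerivAt_tsum_of_isPreconnected (t := Ioi (x / 2)) (y₀ := x)
      (u := fun n : ℕ => 1 / (x / 2 + n) ^ 2)
      (g := fun (n : ℕ) (y : ℝ) => 1 / (((1 : ℝ) : ℂ) + n) - 1 / ((y : ℂ) + n))
      (g' := fun n y => 1 / ((y : ℂ) + n) ^ 2)
      (summable_inv_add_natCast_sq (half_pos hx)) isOpen_Ioi
      isPreconnected_Ioi (fun n y hy => ?_) (fun n y hy => ?_) (mem_Ioi.2 (by linarith))
      (hasSum_digamma_sub hx one_pos).summable (mem_Ioi.2 (by linarith))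
    · have hy : x / 2 < y := hy
      have hy0 : 0 < y := by linarith
      have h3 : HasDerivAt (fun z : ℂ => 1 / (((1 : ℝ) : ℂ) + n) - 1 / (z + n))
          (1 / ((y : ℂ) + n) ^ 2) (y : ℂ) := by
        have := ((((hasDerivAt_id (y : ℂ)).add_const (n : ℂ)).inv (hne hy0 n)).const_sub
          (1 / (((1 : ℝ) : ℂ) + n)))
        refine (this.congr_deriv ?_).congr_of_eventuallyEq
          (Eventually.of_forall fun y => by simp)
        simp [neg_div]
      exact h3.comp_ofReal
    · have hy : x / 2 < y := hy
      have h3 : (y : ℂ) + n = ((y + n : ℝ) : ℂ) := by push_cast; rfl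
      have hy0 : 0 < y := by linarith
      rw [h3, norm_div, norm_one, norm_pow, Complex.norm_of_nonneg (by positivity)]
      gcongr
  refine h1.unique ?_
  have h4 : (fun y : ℝ => Complex.digamma y) =ᶠ[𝓝 x] fun y : ℝ =>
      Complex.digamma ((1 : ℝ) : ℂ) +
        ∑' n : ℕ, (1 / (((1 : ℝ) : ℂ) + n) - 1 / ((y : ℂ) + n)) := by
    filter_upwards [lt_mem_nhds hx] with y hy
    rw [(hasSum_digamma_sub hy one_pos).tsum_eq]
    ring
  exact (h2.const_add _).congr_of_eventuallyEq h4

end Digamma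

/-! ### Asymptotics of the trigamma function. -/

section DigammaAsymptotics

open Set

/-- `∑ 1/(x + n)²` is compared with the telescoping `∑ 1/((x + n)(x + n + 1)) = 1/x`: the difference
of the terms is `1/(x + n) ≤ 1/x` times the telescoping term. -/
theorem norm_deriv_digamma_sub_le {x : ℝ} (hx : 0 < x) :
    ‖deriv Complex.digamma x - 1 / (x : ℂ)‖ ≤ 1 / x ^ 2 := by
  have hx1 : (0 : ℝ) < x + 1 := by linarith
  have htel := hasSum_digamma_sub hx1 hx
  have h3 := digamma_add_natCast hx 1
  simp only [Nat.cast_one, Finset.sum_range_one, Nat.cast_zero, add_zero] at h3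
  rw [h3, add_sub_cancel_left] at htel
  have hval : ∀ n : ℕ, 1 / ((x : ℂ) + n) - 1 / (((x + 1 : ℝ) : ℂ) + n) =
      ((1 / ((x + n) * (x + n + 1)) : ℝ) : ℂ) := by
    intro n
    have h1 : (x : ℂ) + n ≠ 0 := by
      have : 0 < x + n := by positivity
      exact_mod_cast this.ne'
    have h2 : (x : ℂ) + n + 1 ≠ 0 := by
      have : 0 < x + n + 1 := by positivity
      exact_mod_cast this.ne'
    have h2' : (x : ℂ) + 1 + n ≠ 0 := by rwa [add_right_comm]
    push_cast
    field_simp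
    ring
  have htri : HasSum (fun n : ℕ => 1 / ((x : ℂ) + n) ^ 2) (deriv Complex.digamma x) := by
    rw [deriv_digamma_ofReal hx]
    refine Summable.hasSum ?_
    refine Complex.ofRealCLM.summable (summable_inv_add_natCast_sq hx) |>.congr fun n => ?_
    simp
  have hdiff := htri.sub htel
  have htel' : HasSum (fun n : ℕ => 1 / ((x + n) * (x + n + 1))) (1 / x) := by
    simp only [hval] at htel
    have h4 : (1 : ℂ) / x = ((1 / x : ℝ) : ℂ) := by push_cast; rfl
    rw [h4] at htel
    exact_mod_cast htel
  have hle : ‖deriv Complex.digamma x - 1 / (x : ℂ)‖ ≤ 1 / x * (1 / x) := by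
    rw [← hdiff.tsum_eq]
    refine tsum_of_norm_bounded (htel'.mul_left (1 / x)) fun n => ?_
    rw [hval]
    have h5 : 1 / ((x : ℂ) + n) ^ 2 - ((1 / ((x + n) * (x + n + 1)) : ℝ) : ℂ) =
        ((1 / (x + n) * (1 / ((x + n) * (x + n + 1))) : ℝ) : ℂ) := by
      have h1 : (x : ℂ) + n ≠ 0 := by
        have : 0 < x + n := by positivity
        exact_mod_cast this.ne'
      have h2 : (x : ℂ) + n + 1 ≠ 0 := by
        have : 0 < x + n + 1 := by positivity
        exact_mod_cast this.ne'
      push_cast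
      field_simp
      ring
    rw [h5, Complex.norm_of_nonneg (by positivity)]
    gcongr
    linarith [(n.cast_nonneg : (0 : ℝ) ≤ n)]
  refine hle.trans (le_of_eq ?_)
  field_simp

theorem analyticAt_digamma {z : ℂ} (hz : 0 < z.re) : AnalyticAt ℂ Complex.digamma z := by
  have han : AnalyticAt ℂ Complex.Gamma z := by
    rw [Complex.analyticAt_iff_eventually_differentiableAt]
    have : ∀ᶠ z : ℂ in 𝓝 z, 0 < z.re :=
      (isOpen_lt continuous_const Complex.continuous_re).mem_nhds hz
    filter_upwards [this] with z hz
    refine Complex.differentiableAt_Gamma _ fun m h => ?_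
    rw [h] at hz
    have : (0 : ℝ) ≤ m := m.cast_nonneg
    simp at hz
    linarith
  rw [Complex.digamma_def]
  exact han.deriv.div han (Complex.Gamma_ne_zero_of_re_pos hz)

end DigammaAsymptotics

/-! ### The logarithmic derivative of `ξ` to the right of 1. -/

section LogDerivXi

/-- With no term at `n = 1` the series starts at `n = 2`, where `n^(c - x) ≤ 2^(c - x)` for `x ≥ c`.
-/
theorem norm_LSeries_ofReal_le {f : ℕ → ℂ} (h1 : f 1 = 0) {c : ℝ}
    (hf : LSeriesSummable f c) :
    ∃ C : ℝ, 0 ≤ C ∧ ∀ x : ℝ, c ≤ x → ‖LSeries f x‖ ≤ C * (2 : ℝ) ^ (-x) := by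
  refine ⟨(∑' n, ‖LSeries.term f c n‖) * 2 ^ c, by positivity, fun x hx => ?_⟩
  have hb : ∀ n, ‖LSeries.term f x n‖ ≤ ‖LSeries.term f c n‖ * (2 : ℝ) ^ (c - x) := by
    intro n
    rcases lt_or_ge n 2 with hn | hn
    · interval_cases n
      · simp
      · simp [LSeries.term, h1]
    · have hn0 : n ≠ 0 := by omega
      have hnp : (0 : ℝ) < n := by positivity
      rw [LSeries.norm_term_eq, LSeries.norm_term_eq, if_neg hn0, if_neg hn0]
      simp only [Complex.ofReal_re]
      have h3 : (n : ℝ) ^ (c - x) ≤ (2 : ℝ) ^ (c - x) :=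
        Real.rpow_le_rpow_of_nonpos two_pos (by exact_mod_cast hn) (by linarith)
      calc ‖f n‖ / (n : ℝ) ^ x = ‖f n‖ / (n : ℝ) ^ c * (n : ℝ) ^ (c - x) := by
            rw [Real.rpow_sub hnp]
            have : (n : ℝ) ^ c ≠ 0 := (Real.rpow_pos_of_pos hnp _).ne'
            field_simp
        _ ≤ _ := by gcongr
  have h4 := tsum_of_norm_bounded ((hf.norm.hasSum).mul_right ((2 : ℝ) ^ (c - x))) hb
  refine h4.trans (le_of_eq ?_)
  rw [sub_eq_add_neg, Real.rpow_add two_pos]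
  ring

open ArithmeticFunction in
theorem logDeriv_riemannZeta_eq {s : ℂ} (hs : 1 < s.re) :
    logDeriv riemannZeta s = -LSeries (fun n => ((Λ n : ℝ) : ℂ)) s := by
  rw [LSeries_vonMangoldt_eq_deriv_riemannZeta_div hs, logDeriv_apply]
  ring

open ArithmeticFunction in
theorem exists_norm_logDeriv_riemannZeta_le :
    ∃ C : ℝ, 0 ≤ C ∧ ∀ x : ℝ, 3 / 2 ≤ x →
      ‖logDeriv riemannZeta x‖ ≤ C * (2 : ℝ) ^ (-x) ∧
      ‖deriv (logDeriv riemannZeta) x‖ ≤ C * (2 : ℝ) ^ (-x) := by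
  set f : ℕ → ℂ := fun n => ((Λ n : ℝ) : ℂ) with hf
  have hf1 : f 1 = 0 := by simp [hf]
  have hsum : ∀ s : ℂ, 1 < s.re → LSeriesSummable f s := fun s hs =>
    LSeriesSummable_vonMangoldt hs
  have habs : ∀ s : ℂ, 1 < s.re → LSeries.abscissaOfAbsConv f < s.re := by
    intro s hs
    have h1 : LSeries.abscissaOfAbsConv f ≤ (1 : ℝ) :=
      LSeries.abscissaOfAbsConv_le_of_forall_lt_LSeriesSummable fun y hy => hsum _ (by simpa)
    exact h1.trans_lt (by exact_mod_cast hs)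
  obtain ⟨C₁, h10, h1⟩ := norm_LSeries_ofReal_le (c := 3 / 2) hf1 (hsum _ (by norm_num))
  obtain ⟨C₂, h20, h2⟩ := norm_LSeries_ofReal_le (f := LSeries.logMul f) (c := 3 / 2)
    (by simp [LSeries.logMul])
    (LSeriesSummable_logMul_of_lt_re (habs _ (by norm_num)))
  refine ⟨C₁ + C₂, by positivity, fun x hx => ?_⟩
  have hp : (0 : ℝ) < 2 ^ (-x) := by positivity
  have hx1 : 1 < ((x : ℝ) : ℂ).re := by simp; linarith
  constructor
  · rw [logDeriv_riemannZeta_eq hx1, norm_neg]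
    exact (h1 x hx).trans (by gcongr; linarith)
  · have h3 : logDeriv riemannZeta =ᶠ[𝓝 (x : ℂ)] fun s => -LSeries f s := by
      filter_upwards [(isOpen_lt continuous_const Complex.continuous_re).mem_nhds hx1] with s hs
      exact logDeriv_riemannZeta_eq hs
    rw [h3.deriv_eq, deriv.fun_neg, LSeries_deriv (habs _ hx1), neg_neg]
    exact (h2 x hx).trans (by gcongr; linarith)

theorem analyticAt_logDeriv_riemannZeta {s : ℂ} (hs : 1 < s.re) :
    AnalyticAt ℂ (logDeriv riemannZeta) s := by
  have h : AnalyticAt ℂ riemannZeta s := by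
    rw [Complex.analyticAt_iff_eventually_differentiableAt]
    filter_upwards [(isOpen_lt continuous_const Complex.continuous_re).mem_nhds hs] with z hz
    exact differentiableAt_riemannZeta fun h => by simp [h] at hz
  exact h.deriv.div h (riemannZeta_ne_zero_of_one_lt_re hs)

theorem logDeriv_riemannXi_eq {s : ℂ} (hs : 1 < s.re) :
    logDeriv riemannXi s = 1 / s + 1 / (s - 1) - Real.log Real.pi / 2
      + Complex.digamma (s / 2) / 2 + logDeriv riemannZeta s := by
  have hne0 : s ≠ 0 := fun h => by simp [h] at hs; linarith
  have hne1 : s - 1 ≠ 0 := fun h => by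
    rw [sub_eq_zero] at h
    simp [h] at hs
  have hζ := riemannZeta_ne_zero_of_one_lt_re hs
  have hs2 : 0 < (s / 2).re := by simp; linarith
  have hΓ := Complex.Gamma_ne_zero_of_re_pos hs2
  have hπ : (Real.pi : ℂ) ≠ 0 := by exact_mod_cast Real.pi_ne_zero
  have hdΓ : DifferentiableAt ℂ Complex.Gamma (s / 2) :=
    Complex.differentiableAt_Gamma _ fun m h => by
      rw [h] at hs2
      have : (0 : ℝ) ≤ m := m.cast_nonneg
      simp at hs2
      linarith
  have hdζ : DifferentiableAt ℂ riemannZeta s :=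
    differentiableAt_riemannZeta fun h => by simp [h] at hs
  have hev : riemannXi =ᶠ[𝓝 s] fun z => (z * (z - 1)) *
      (((Real.pi : ℂ) ^ (-z / 2) * Complex.Gamma (z / 2)) * riemannZeta z) := by
    filter_upwards [(isOpen_lt continuous_const Complex.continuous_re).mem_nhds hs] with z hz
    have hz' : 1 < z.re := hz
    rw [riemannXi_eq_riemannZeta (fun h => by simp [h] at hz'; linarith)
      (fun h => by simp [h] at hz') (Complex.Gammaℝ_ne_zero_of_re_pos (by linarith))]
    rfl
  have hlog : logDeriv riemannXi s = logDeriv (fun z => (z * (z - 1)) *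
      (((Real.pi : ℂ) ^ (-z / 2) * Complex.Gamma (z / 2)) * riemannZeta z)) s := by
    rw [logDeriv_apply, logDeriv_apply, hev.deriv_eq, hev.eq_of_nhds]
  have hd1 : HasDerivAt (fun z : ℂ => -z / 2) (-1 / 2) s := ((hasDerivAt_id s).neg).div_const 2
  have hd2 : HasDerivAt (fun z : ℂ => z / 2) (1 / 2) s := (hasDerivAt_id s).div_const 2
  have hdpow := hd1.const_cpow (c := (Real.pi : ℂ)) (Or.inl hπ)
  have hdΓ' : HasDerivAt (fun z : ℂ => Complex.Gamma (z / 2))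
      (deriv Complex.Gamma (s / 2) * (1 / 2)) s := hdΓ.hasDerivAt.comp s hd2
  have hpow : (Real.pi : ℂ) ^ (-s / 2) ≠ 0 := by simp [Complex.cpow_eq_zero_iff, hπ]
  rw [hlog, logDeriv_mul (f := fun z : ℂ => z * (z - 1)) (g := fun z =>
      ((Real.pi : ℂ) ^ (-z / 2) * Complex.Gamma (z / 2)) * riemannZeta z) s
      (mul_ne_zero hne0 hne1) (mul_ne_zero (mul_ne_zero hpow hΓ) hζ)
      (by fun_prop) ((hdpow.differentiableAt.mul hdΓ'.differentiableAt).mul hdζ),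
    logDeriv_mul (f := fun z : ℂ => z) (g := fun z => z - 1) s hne0 hne1 (by fun_prop)
      (by fun_prop),
    logDeriv_mul (f := fun z : ℂ => (Real.pi : ℂ) ^ (-z / 2) * Complex.Gamma (z / 2))
      (g := riemannZeta) s (mul_ne_zero hpow hΓ) hζ
      (hdpow.differentiableAt.mul hdΓ'.differentiableAt) hdζ,
    logDeriv_mul (f := fun z : ℂ => (Real.pi : ℂ) ^ (-z / 2))
      (g := fun z => Complex.Gamma (z / 2)) s hpow hΓ hdpow.differentiableAt hdΓ'.differentiableAt]
  have e1 : logDeriv (fun z : ℂ => z) s = 1 / s := by simp [logDeriv_apply]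
  have e2 : logDeriv (fun z : ℂ => z - 1) s = 1 / (s - 1) := by
    rw [logDeriv_apply]
    simp
  have e3 : logDeriv (fun z : ℂ => (Real.pi : ℂ) ^ (-z / 2)) s = -Real.log Real.pi / 2 := by
    rw [logDeriv_apply, hdpow.deriv, Complex.ofReal_log Real.pi_pos.le]
    field_simp
  have e4 : logDeriv (fun z : ℂ => Complex.Gamma (z / 2)) s = Complex.digamma (s / 2) / 2 := by
    rw [logDeriv_apply, hdΓ'.deriv, Complex.digamma_def, logDeriv_apply]
    ring
  rw [e1, e2, e3, e4]
  ring

theorem deriv_logDeriv_riemannXi_eq {s : ℂ} (hs : 1 < s.re) :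
    deriv (logDeriv riemannXi) s = -1 / s ^ 2 - 1 / (s - 1) ^ 2
      + deriv Complex.digamma (s / 2) / 4 + deriv (logDeriv riemannZeta) s := by
  have hne0 : s ≠ 0 := fun h => by simp [h] at hs; linarith
  have hne1 : s - 1 ≠ 0 := fun h => by
    rw [sub_eq_zero] at h
    simp [h] at hs
  have hs2 : 0 < (s / 2).re := by simp; linarith
  have hev : logDeriv riemannXi =ᶠ[𝓝 s] fun s => s⁻¹ + (s - 1)⁻¹ - Real.log Real.pi / 2
      + Complex.digamma (s / 2) / 2 + logDeriv riemannZeta s := by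
    filter_upwards [(isOpen_lt continuous_const Complex.continuous_re).mem_nhds hs] with z hz
    rw [logDeriv_riemannXi_eq hz]
    simp
  have hd2 : HasDerivAt (fun z : ℂ => z / 2) (1 / 2) s := (hasDerivAt_id s).div_const 2
  have hψ : HasDerivAt (fun z : ℂ => Complex.digamma (z / 2))
      (deriv Complex.digamma (s / 2) * (1 / 2)) s :=
    (analyticAt_digamma hs2).differentiableAt.hasDerivAt.comp s hd2
  have hζ := (analyticAt_logDeriv_riemannZeta hs).differentiableAt.hasDerivAt
  have h := ((((hasDerivAt_inv hne0).add (((hasDerivAt_id s).sub_const 1).inv hne1)).sub_const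
    ((Real.log Real.pi : ℂ) / 2)).add (hψ.div_const 2)).add hζ
  rw [hev.deriv_eq]
  refine (h.congr_of_eventuallyEq (Eventually.of_forall fun z => ?_)).deriv.trans ?_
  · simp
  · simp only [id]
    ring

end LogDerivXi

/-! ### `(ξ'/ξ)'` on the real axis and its behaviour at infinity. -/

section XiOnLine

open Set

/-- The second logarithmic derivative of `ξ` along the real axis, centred at `1 / 2`. -/
noncomputable def xiLogDeriv₂ (x : ℝ) : ℂ := deriv (logDeriv riemannXi) (1 / 2 + x)

/-- The function `∑ n, 1 / (x + 2 n + 1 / 2) ^ 2`, the part of `xiLogDeriv₂` coming from the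
Gamma factor. -/
noncomputable def gammaPart (x : ℝ) : ℂ := deriv Complex.digamma ((x / 2 + 1 / 4 : ℝ) : ℂ) / 4

theorem analyticAt_logDeriv_riemannXi (x : ℝ) : AnalyticAt ℂ (logDeriv riemannXi) (1 / 2 + x) :=
  (differentiable_riemannXi.analyticAt _).deriv.div (differentiable_riemannXi.analyticAt _)
    (riemannXi_half_add_ofReal_ne_zero x)

theorem continuous_xiLogDeriv₂ : Continuous xiLogDeriv₂ :=
  continuous_iff_continuousAt.2 fun x =>
    ContinuousAt.comp (f := fun x : ℝ => (1 / 2 + x : ℂ))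
      (analyticAt_logDeriv_riemannXi x).deriv.continuousAt (by fun_prop)

theorem hasDerivAt_logDeriv_riemannXi (x : ℝ) :
    HasDerivAt (fun x : ℝ => logDeriv riemannXi (1 / 2 + x)) (xiLogDeriv₂ x) x := by
  have h1 : HasDerivAt (fun z : ℂ => logDeriv riemannXi (1 / 2 + z)) (xiLogDeriv₂ x) (x : ℂ) :=
    HasDerivAt.comp_const_add (1 / 2 : ℂ) (x : ℂ)
      (analyticAt_logDeriv_riemannXi x).differentiableAt.hasDerivAt
  exact h1.comp_ofReal

/-- `ξ` is symmetric about `1/2`. This is the boundary value at the origin when `xiLogDeriv₂` is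
integrated. -/
theorem logDeriv_riemannXi_half : logDeriv riemannXi (1 / 2) = 0 := by
  have h : deriv (fun s => riemannXi (1 - s)) (1 / 2) = -deriv riemannXi (1 - 1 / 2) :=
    deriv_comp_const_sub riemannXi 1 (1 / 2)
  have h2 : (fun s => riemannXi (1 - s)) = riemannXi := funext riemannXi_one_sub
  rw [h2] at h
  norm_num at h
  have h3 : deriv riemannXi (1 / 2) = 0 := self_eq_neg.1 h
  rw [logDeriv_apply, h3, zero_div]

theorem xiLogDeriv₂_eq {x : ℝ} (hx : 1 / 2 < x) :
    xiLogDeriv₂ x = gammaPart x - 1 / ((x : ℂ) + 1 / 2) ^ 2 - 1 / ((x : ℂ) - 1 / 2) ^ 2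
      + deriv (logDeriv riemannZeta) ((1 / 2 + x : ℝ) : ℂ) := by
  have hs : 1 < (1 / 2 + (x : ℂ)).re := by simp; linarith
  rw [xiLogDeriv₂, deriv_logDeriv_riemannXi_eq hs, gammaPart]
  have h1 : (1 / 2 + (x : ℂ)) / 2 = ((x / 2 + 1 / 4 : ℝ) : ℂ) := by push_cast; ring
  have h2 : (1 / 2 + (x : ℂ)) = ((1 / 2 + x : ℝ) : ℂ) := by push_cast; ring
  have h3 : 1 / 2 + (x : ℂ) - 1 = x - 1 / 2 := by ring
  rw [h1, h3, add_comm (1 / 2 : ℂ), ← h2, add_comm (1 / 2 : ℂ)]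
  ring

theorem continuousOn_gammaPart : ContinuousOn gammaPart (Ici 0) := by
  intro x hx
  have hx : 0 ≤ x := hx
  refine ContinuousAt.continuousWithinAt ?_
  have h1 : ContinuousAt (fun x : ℝ => deriv Complex.digamma ((x / 2 + 1 / 4 : ℝ) : ℂ)) x :=
    ContinuousAt.comp (f := fun x : ℝ => ((x / 2 + 1 / 4 : ℝ) : ℂ))
      (analyticAt_digamma (by rw [Complex.ofReal_re]; linarith)).deriv.continuousAt
      (by fun_prop)
  exact h1.div_const _

/-- With `z = x/2 + 1/4`, `ψ'(z)` is `1/z` up to `1/z²`, and `1/(4z) - 1/(2x) = -1/(8xz)`. -/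
theorem norm_gammaPart_sub_le {x : ℝ} (hx : 0 < x) :
    ‖gammaPart x - 1 / (2 * x)‖ ≤ 2 / x ^ 2 := by
  set z : ℝ := x / 2 + 1 / 4 with hz
  have hz0 : 0 < z := by positivity
  have h1 := norm_deriv_digamma_sub_le hz0
  have hxc : (x : ℂ) ≠ 0 := by exact_mod_cast hx.ne'
  have hzc : (z : ℂ) ≠ 0 := by exact_mod_cast hz0.ne'
  have h2 : gammaPart x - 1 / (2 * x) =
      (deriv Complex.digamma z - 1 / z) / 4 + ((-(1 / (8 * x * z)) : ℝ) : ℂ) := by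
    rw [gammaPart]
    push_cast
    field_simp
    rw [hz]
    push_cast
    ring_nf
  rw [h2]
  refine (norm_add_le _ _).trans ?_
  rw [norm_div, Complex.norm_ofNat, Complex.norm_real, norm_neg,
    Real.norm_of_nonneg (by positivity)]
  have h3 : x / 2 ≤ z := by linarith
  have h4 : 1 / z ^ 2 ≤ 1 / (x / 2) ^ 2 := by gcongr
  have h5 : 1 / (8 * x * z) ≤ 1 / (8 * x * (x / 2)) := by gcongr
  have h6 : 1 / (x / 2) ^ 2 / 4 + 1 / (8 * x * (x / 2)) ≤ 2 / x ^ 2 := by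
    have : 1 / (x / 2) ^ 2 / 4 + 1 / (8 * x * (x / 2)) = (5 / 4) / x ^ 2 := by
      field_simp; norm_num
    rw [this]
    gcongr
    norm_num
  linarith

theorem exists_norm_zetaPart_le : ∃ C : ℝ, 0 ≤ C ∧ ∀ x : ℝ, 1 ≤ x →
    ‖logDeriv riemannZeta ((1 / 2 + x : ℝ) : ℂ)‖ ≤ C * (2 : ℝ) ^ (-x) ∧
    ‖deriv (logDeriv riemannZeta) ((1 / 2 + x : ℝ) : ℂ)‖ ≤ C * (2 : ℝ) ^ (-x) := by
  obtain ⟨C, hC, h⟩ := exists_norm_logDeriv_riemannZeta_le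
  refine ⟨C, hC, fun x hx => ?_⟩
  have h2 : (2 : ℝ) ^ (-(1 / 2 + x)) ≤ (2 : ℝ) ^ (-x) := by
    apply Real.rpow_le_rpow_of_exponent_le <;> linarith
  obtain ⟨h3, h4⟩ := h (1 / 2 + x) (by linarith)
  exact ⟨h3.trans (by gcongr), h4.trans (by gcongr)⟩

theorem exists_two_rpow_neg_le (k : ℕ) : ∃ C : ℝ, 0 ≤ C ∧ ∀ x : ℝ, 1 ≤ x → 
    (2 : ℝ) ^ (-x) ≤ C / x ^ k := by
  have hl : 0 < Real.log 2 := Real.log_pos one_lt_two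
  refine ⟨k.factorial / Real.log 2 ^ k, by positivity, fun x hx => ?_⟩
  have h := Real.pow_div_factorial_le_exp (x * Real.log 2) (by positivity) k
  rw [Real.rpow_neg two_pos.le, Real.rpow_def_of_pos two_pos, mul_comm (Real.log 2),
    div_div, inv_eq_one_div, div_le_div_iff₀ (Real.exp_pos _) (by positivity), one_mul]
  rw [div_le_iff₀ (by positivity), mul_pow] at h
  linarith

theorem exists_norm_xiLogDeriv₂_sub_le : ∃ C : ℝ, 0 ≤ C ∧ ∀ x : ℝ, 1 ≤ x →
    ‖xiLogDeriv₂ x - 1 / (2 * x)‖ ≤ C / x ^ 2 := by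
  obtain ⟨C, hC, h⟩ := exists_norm_zetaPart_le
  obtain ⟨D, hD, h'⟩ := exists_two_rpow_neg_le 2
  refine ⟨2 + 1 + 4 + C * D, by positivity, fun x hx => ?_⟩
  have hx0 : 0 < x := by linarith
  have e : xiLogDeriv₂ x - 1 / (2 * x) = (gammaPart x - 1 / (2 * x))
      - ((1 / (x + 1 / 2) ^ 2 : ℝ) : ℂ) - ((1 / (x - 1 / 2) ^ 2 : ℝ) : ℂ)
      + deriv (logDeriv riemannZeta) ((1 / 2 + x : ℝ) : ℂ) := by
    rw [xiLogDeriv₂_eq (by linarith)]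
    push_cast
    ring
  rw [e]
  have h1 := norm_gammaPart_sub_le hx0
  have h2 : ‖((1 / (x + 1 / 2) ^ 2 : ℝ) : ℂ)‖ ≤ 1 / x ^ 2 := by
    rw [Complex.norm_of_nonneg (by positivity)]
    gcongr
    linarith
  have h3 : ‖((1 / (x - 1 / 2) ^ 2 : ℝ) : ℂ)‖ ≤ 4 / x ^ 2 := by
    rw [Complex.norm_of_nonneg (by positivity)]
    have h6 : (x / 2) ^ 2 ≤ (x - 1 / 2) ^ 2 := by gcongr; linarith
    calc 1 / (x - 1 / 2) ^ 2 ≤ 1 / (x / 2) ^ 2 := by gcongr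
      _ = 4 / x ^ 2 := by field_simp; norm_num
  have h4 : ‖deriv (logDeriv riemannZeta) ((1 / 2 + x : ℝ) : ℂ)‖ ≤ C * D / x ^ 2 := by
    refine (h x hx).2.trans ?_
    rw [mul_div_assoc]
    gcongr
    exact h' x hx
  have h5 : 2 / x ^ 2 + 1 / x ^ 2 + 4 / x ^ 2 + C * D / x ^ 2 = (2 + 1 + 4 + C * D) / x ^ 2 := by
    ring
  rw [← h5]
  refine (norm_add_le _ _).trans (add_le_add ((norm_sub_le _ _).trans (add_le_add
    ((norm_sub_le _ _).trans (add_le_add h1 h2)) h3)) h4)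

/-- The digamma term `½ ψ(x/2 + 1/4)` contributes `½ log x - ½ log 2` and the power of `π`
contributes `-½ log π`; all else tends to 0. Every `log 2π` in the residues originates here. -/
theorem tendsto_logDeriv_riemannXi_sub_log :
    Tendsto (fun x : ℝ => logDeriv riemannXi (1 / 2 + x) - ((1 / 2 * Real.log x : ℝ) : ℂ)) atTop
      (𝓝 ((-(1 / 2) * Real.log (2 * Real.pi) : ℝ) : ℂ)) := by
  obtain ⟨C, hC, h⟩ := exists_norm_zetaPart_le
  have ht : Tendsto (fun x : ℝ => (x / 2 + 1 / 4 : ℝ)) atTop atTop :=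
    tendsto_atTop_add_const_right _ _ (tendsto_id.atTop_div_const two_pos)
  have hψ : Tendsto (fun x : ℝ => Complex.digamma ((x / 2 + 1 / 4 : ℝ) : ℂ) -
      (Real.log (x / 2 + 1 / 4) : ℂ)) atTop (𝓝 0) := by
    have h1 : Tendsto (fun x : ℝ => 1 / (x / 2 + 1 / 4)) atTop (𝓝 0) :=
      ht.inv_tendsto_atTop.congr fun x => by simp
    refine squeeze_zero_norm' ?_ h1
    filter_upwards [eventually_gt_atTop 0] with x hx
    exact norm_digamma_sub_log_le (by positivity)
  have hinv : ∀ c : ℝ, Tendsto (fun x : ℝ => ((1 / (x + c) : ℝ) : ℂ)) atTop (𝓝 0) := by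
    intro c
    have h1 : Tendsto (fun x : ℝ => 1 / (x + c)) atTop (𝓝 0) :=
      (tendsto_atTop_add_const_right atTop c tendsto_id).inv_tendsto_atTop.congr fun x => by simp
    simpa [Function.comp_def] using (Complex.continuous_ofReal.tendsto 0).comp h1
  have hζ : Tendsto (fun x : ℝ => logDeriv riemannZeta ((1 / 2 + x : ℝ) : ℂ)) atTop (𝓝 0) := by
    obtain ⟨D, hD, h'⟩ := exists_two_rpow_neg_le 1
    have h1 : Tendsto (fun x : ℝ => C * (D / x)) atTop (𝓝 (C * 0)) :=
      (tendsto_const_nhds.div_atTop tendsto_id).const_mul C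
    rw [mul_zero] at h1
    refine squeeze_zero_norm' ?_ h1
    filter_upwards [eventually_ge_atTop 1] with x hx
    refine (h x hx).1.trans ?_
    gcongr
    simpa using h' x hx
  have hlog : Tendsto (fun x : ℝ => ((Real.log (1 / 2 + 1 / 4 * (1 / (x + 0))) : ℝ) : ℂ)) atTop
      (𝓝 ((Real.log (1 / 2) : ℝ) : ℂ)) := by
    have h1 : Tendsto (fun x : ℝ => 1 / (x + 0)) atTop (𝓝 0) :=
      (tendsto_atTop_add_const_right atTop 0 tendsto_id).inv_tendsto_atTop.congr fun x => by simp
    have h2 := (h1.const_mul (1 / 4)).const_add (1 / 2 : ℝ)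
    rw [mul_zero, add_zero] at h2
    exact (Complex.continuous_ofReal.tendsto _).comp
      (((Real.continuousAt_log (by norm_num)).tendsto).comp h2)
  have hsum := ((((hinv (1 / 2)).add (hinv (-(1 / 2)))).sub
    (tendsto_const_nhds (x := ((Real.log Real.pi : ℝ) : ℂ) / 2))).add
      ((hψ.add hlog).div_const 2)).add hζ
  have hval : (0 : ℂ) + 0 - ((Real.log Real.pi : ℝ) : ℂ) / 2
      + (0 + ((Real.log (1 / 2) : ℝ) : ℂ)) / 2 + 0 =
      ((-(1 / 2) * Real.log (2 * Real.pi) : ℝ) : ℂ) := by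
    rw [Real.log_mul two_ne_zero Real.pi_ne_zero, one_div, Real.log_inv]
    push_cast
    ring
  rw [hval] at hsum
  refine hsum.congr' ?_
  filter_upwards [eventually_ge_atTop 1] with x hx
  have hx0 : 0 < x := by linarith
  have hs : 1 < (1 / 2 + (x : ℂ)).re := by simp; linarith
  rw [logDeriv_riemannXi_eq hs]
  have h1 : (1 / 2 + (x : ℂ)) / 2 = ((x / 2 + 1 / 4 : ℝ) : ℂ) := by push_cast; ring
  have h3 : 1 / 2 + 1 / 4 * (1 / (x + 0)) = (x / 2 + 1 / 4) / x := by field_simp; ring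
  rw [h1, h3, Real.log_div (by positivity) hx0.ne']
  push_cast
  rw [add_comm (x : ℂ) (1 / 2), show (1 / 2 + (x : ℂ) - 1) = x + -(1 / 2) by ring]
  ring

end XiOnLine

/-! ### The Mellin transform of `(ξ'/ξ)'` as a Dirichlet series over the zeros. -/

section MellinXi

open Set

/-- With `L = log τ` and `|Im L| < π/2`, the principal logarithms of `iτ`, `-iτ` and `τ²` are `L +
iπ/2`, `L - iπ/2` and `2L`: none of them crosses the cut. -/
theorem zeroTau_sq_cpow (ρ : upperZetaZeros) (σ : ℂ) :
    (Complex.I * zeroTau ρ) ^ (-(2 * σ)) + (-(Complex.I * zeroTau ρ)) ^ (-(2 * σ)) =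
      2 * Complex.cos (Real.pi * σ) * (zeroTau ρ ^ 2) ^ (-σ) := by
  have hre := zeroTau_re_pos ρ
  have hne : zeroTau ρ ≠ 0 := fun h => by rw [h] at hre; simp at hre
  set L := Complex.log (zeroTau ρ) with hL
  have hexp : Complex.exp L = zeroTau ρ := Complex.exp_log hne
  have him : |L.im| < Real.pi / 2 := by
    rw [hL, Complex.log_im]
    exact Complex.abs_arg_lt_pi_div_two_iff.2 (Or.inl hre)
  obtain ⟨h1, h2⟩ := abs_lt.1 him
  have e1 : Complex.I * zeroTau ρ = Complex.exp (L + Real.pi / 2 * Complex.I) := by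
    rw [Complex.exp_add, Complex.exp_pi_div_two_mul_I, hexp, mul_comm]
  have e2 : -(Complex.I * zeroTau ρ) = Complex.exp (L - Real.pi / 2 * Complex.I) := by
    rw [sub_eq_add_neg, ← neg_mul, Complex.exp_add, neg_mul, Complex.exp_neg,
      Complex.exp_pi_div_two_mul_I, hexp, Complex.inv_I]
    ring
  have e3 : zeroTau ρ ^ 2 = Complex.exp (2 * L) := by
    rw [two_mul, Complex.exp_add, hexp, sq]
  rw [e2, e1, e3, Complex.cpow_def_of_ne_zero (Complex.exp_ne_zero _),
    Complex.cpow_def_of_ne_zero (Complex.exp_ne_zero _),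
    Complex.cpow_def_of_ne_zero (Complex.exp_ne_zero _), Complex.log_exp, Complex.log_exp,
    Complex.log_exp, Complex.cos, mul_div_cancel₀ _ two_ne_zero, add_mul (Complex.exp _), ← Complex.exp_add,
    ← Complex.exp_add, add_comm]
  · congr 2 <;> ring
  all_goals simp
  all_goals linarith [Real.pi_pos]

/-- The points `iτ` and `-iτ` form one family over a disjoint sum, to which the termwise Mellin
transform applies. The sector condition holds because `|Im τ| < 1/2` while `|τ| > 1`; this is the
use of the zero-free disc about `1/2`. -/
theorem hasSum_mellin_xiLogDeriv₂ {σ : ℂ} (h1 : 1 / 2 < σ.re) (h2 : σ.re < 1) :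
    HasSum (fun ρ : upperZetaZeros => (zetaMult ρ : ℂ) * (zeroTau ρ ^ 2) ^ (-σ) *
        (-(2 * Complex.cos (Real.pi * σ)) * Complex.Gamma (2 - 2 * σ) * Complex.Gamma (2 * σ)))
      (mellin xiLogDeriv₂ (2 - 2 * σ)) := by
  set s : ℂ := 2 - 2 * σ with hs
  have hsre : s.re = 2 - 2 * σ.re := by simp [hs]
  set a : upperZetaZeros ⊕ upperZetaZeros → ℂ :=
    Sum.elim (fun ρ => Complex.I * zeroTau ρ) (fun ρ => -(Complex.I * zeroTau ρ)) with ha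
  set c : upperZetaZeros ⊕ upperZetaZeros → ℂ :=
    Sum.elim (fun ρ => (zetaMult ρ : ℂ)) (fun ρ => (zetaMult ρ : ℂ)) with hc
  have hslit : ∀ i, a i ∈ Complex.slitPlane := by
    rintro (ρ | ρ)
    · exact Complex.mem_slitPlane_iff.2 (Or.inr <| by simpa [ha] using (zeroTau_re_pos ρ).ne')
    · exact Complex.mem_slitPlane_iff.2 (Or.inr <| by simpa [ha] using (zeroTau_re_pos ρ).ne')
  have hre : ∀ i, -(1 / 2) * ‖a i‖ ≤ (a i).re := by
    rintro (ρ | ρ)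
    · have h3 := abs_lt.1 (abs_zeroTau_im_lt ρ)
      have h4 := one_lt_norm_zeroTau ρ
      simp [ha]
      linarith [h3.2]
    · have h3 := abs_lt.1 (abs_zeroTau_im_lt ρ)
      have h4 := one_lt_norm_zeroTau ρ
      simp [ha]
      linarith [h3.1]
  have hsumm : Summable fun ρ : upperZetaZeros =>
      (zetaMult ρ : ℝ) * ‖zeroTau ρ‖ ^ (s.re - 2) := by
    refine (summable_zetaMult_div (q := 2 * σ.re) (by linarith)).congr fun ρ => ?_
    rw [hsre, show 2 - 2 * σ.re - 2 = -(2 * σ.re) by ring, Real.rpow_neg (norm_nonneg _),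
      div_eq_mul_inv]
  have hsum : Summable fun i => ‖c i‖ * ‖a i‖ ^ (s.re - 2) :=
    Summable.sum _ (by simpa [Function.comp_def, ha, hc] using hsumm)
      (by simpa [Function.comp_def, ha, hc] using hsumm)
  have key := (hasSum_mellin_inv_sq hslit hre (s := s) (by rw [hsre]; linarith)
    (by rw [hsre]; linarith) hsum).neg
  have hfun : ∀ x ∈ Ioi (0 : ℝ), (∑' i, c i * (1 / ((x : ℂ) + a i) ^ 2)) = -xiLogDeriv₂ x := by
    intro x hx
    have hx : 0 < x := hx
    have hsx : ∀ (b : upperZetaZeros → ℂ), (∀ ρ, ‖b ρ‖ = ‖zeroTau ρ‖) →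
        (∀ ρ, -(1 / 2) * ‖b ρ‖ ≤ (b ρ).re) →
        Summable fun ρ => (zetaMult ρ : ℂ) * (1 / ((x : ℂ) + b ρ) ^ 2) := by
      intro b hb hb'
      refine Summable.of_norm_bounded ((summable_zetaMult_div one_lt_two).mul_left 16) fun ρ => ?_
      have h5 := mul_le_norm_ofReal_add (by norm_num) (by norm_num) (hb' ρ) hx.le
      rw [hb] at h5
      have h6 := one_lt_norm_zeroTau ρ
      have h7 : (‖zeroTau ρ‖ / 4) ^ 2 ≤ ‖(x : ℂ) + b ρ‖ ^ 2 := by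
        gcongr
        linarith
      rw [norm_mul, norm_div, norm_one, norm_pow, Complex.norm_natCast, Real.rpow_two]
      calc (zetaMult ρ : ℝ) * (1 / ‖(x : ℂ) + b ρ‖ ^ 2) ≤
          (zetaMult ρ : ℝ) * (1 / (‖zeroTau ρ‖ / 4) ^ 2) := by gcongr
        _ = _ := by field_simp; ring
    have hl := hsx (fun ρ => Complex.I * zeroTau ρ) (by simp) fun ρ => hre (.inl ρ)
    have hr := hsx (fun ρ => -(Complex.I * zeroTau ρ)) (by simp) fun ρ => hre (.inr ρ)
    have h10 : (∑' i, c i * (1 / ((x : ℂ) + a i) ^ 2)) = _ :=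
      Summable.tsum_sum (f := fun i => c i * (1 / ((x : ℂ) + a i) ^ 2)) hl hr
    rw [h10]
    simp only [ha, hc, Sum.elim_inl, Sum.elim_inr]
    rw [← hl.tsum_add hr]
    refine Eq.trans (tsum_congr fun ρ => ?_) (hasSum_zeros_pairs x).tsum_eq
    rw [← sub_eq_add_neg, mul_add]
  have hmel : -mellin (fun x : ℝ => ∑' i, c i * (1 / ((x : ℂ) + a i) ^ 2)) s =
      mellin xiLogDeriv₂ s := by
    rw [mellin, mellin, ← MeasureTheory.integral_neg]
    refine MeasureTheory.setIntegral_congr_fun measurableSet_Ioi fun x hx => ?_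
    simp only [hfun x hx, smul_eq_mul]
    ring
  rw [hmel] at key
  have kl := key.summable.comp_injective Sum.inl_injective
  have kr := key.summable.comp_injective Sum.inr_injective
  have hadd := kl.hasSum.add kr.hasSum
  have htot := (kl.hasSum.sum kr.hasSum).unique key
  rw [htot] at hadd
  convert! hadd using 1
  ext ρ
  have e := zeroTau_sq_cpow ρ σ
  have h8 : s - 2 = -(2 * σ) := by rw [hs]; ring
  have h9 : 2 - s = 2 * σ := by rw [hs]; ring
  simp only [Function.comp, ha, hc, Sum.elim_inl, Sum.elim_inr, h8, h9]
  linear_combination -(zetaMult ρ : ℂ) * Complex.Gamma s * Complex.Gamma (2 * σ) * (-e)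

/-- The trigamma series makes `gammaPart` the sum of `1/(x + 2(n + 1/4))²`, whose transform is a
Hurwitz series with parameter `1/4`. -/
theorem mellin_gammaPart {σ : ℂ} (h1 : 1 / 2 < σ.re) (h2 : σ.re < 1) :
    mellin gammaPart (2 - 2 * σ) = Complex.Gamma (2 - 2 * σ) * Complex.Gamma (2 * σ) *
      ((2 : ℂ) ^ (-(2 * σ)) * HurwitzZeta.hurwitzZeta ((1 / 4 : ℝ) : UnitAddCircle) (2 * σ)) := by
  set s : ℂ := 2 - 2 * σ with hs
  have hsre : s.re = 2 - 2 * σ.re := by simp [hs]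
  set a : ℕ → ℂ := fun n => ((2 * (n + 1 / 4) : ℝ) : ℂ) with ha
  have han : ∀ n, ‖a n‖ = 2 * (n + 1 / 4) := fun n => Complex.norm_of_nonneg (by positivity)
  have hsum : Summable fun n => ‖(1 : ℂ)‖ * ‖a n‖ ^ (s.re - 2) := by
    have h := (Real.summable_one_div_nat_add_rpow (1 / 4) (2 * σ.re)).2 (by linarith)
    refine (h.mul_left (2 ^ (-(2 * σ.re)))).congr fun n => ?_
    have hn : (0 : ℝ) < n + 1 / 4 := by positivity
    rw [han, norm_one, one_mul, hsre, show 2 - 2 * σ.re - 2 = -(2 * σ.re) by ring,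
      Real.mul_rpow two_pos.le hn.le, abs_of_pos hn, Real.rpow_neg hn.le, one_div]
  have key := hasSum_mellin_inv_sq (a := a) (c := fun _ => 1) (s := s)
    (fun n => Complex.ofReal_mem_slitPlane.2 (by positivity))
    (fun n => by
      rw [han]
      simp only [ha, Complex.ofReal_re]
      linarith [(n.cast_nonneg : (0 : ℝ) ≤ n)])
    (by rw [hsre]; linarith) (by rw [hsre]; linarith) hsum
  have hmel : mellin (fun x : ℝ => ∑' n, 1 * (1 / ((x : ℂ) + a n) ^ 2)) s = mellin gammaPart s := by
    refine MeasureTheory.setIntegral_congr_fun measurableSet_Ioi fun x hx => ?_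
    have hx : 0 < x := hx
    simp only [gammaPart]
    rw [deriv_digamma_ofReal (by positivity), ← tsum_div_const]
    congr 2
    ext n
    have : (x : ℂ) / 2 + 1 / 4 + n ≠ 0 := by
      have h : ((x / 2 + 1 / 4 + n : ℝ) : ℂ) ≠ 0 :=
        Complex.ofReal_ne_zero.2 (by positivity)
      push_cast at h
      exact h
    have h3 : (x : ℂ) + a n = 2 * (x / 2 + 1 / 4 + n) := by
      simp only [ha]
      push_cast
      ring
    rw [h3]
    push_cast
    field_simp
    norm_num
  rw [hmel] at key
  have hH := HurwitzZeta.hasSum_hurwitzZeta_of_one_lt_re (a := 1 / 4) (s := 2 * σ)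
    ⟨by norm_num, by norm_num⟩ (by simp; linarith)
  refine key.unique ?_
  convert! hH.mul_left (Complex.Gamma s * Complex.Gamma (2 * σ) * (2 : ℂ) ^ (-(2 * σ))) using 1
  · ext n
    have hn : (0 : ℝ) < n + 1 / 4 := by positivity
    have h8 : s - 2 = -(2 * σ) := by rw [hs]; ring
    have h9 : 2 - s = 2 * σ := by rw [hs]; ring
    simp only [ha, h8, h9]
    rw [Complex.ofReal_mul, Complex.mul_cpow_ofReal_nonneg two_pos.le hn.le,
      Complex.cpow_neg ((n + 1 / 4 : ℝ) : ℂ)]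
    push_cast
    ring
  · ring

end MellinXi

/-! ### Mellin transforms cut at 1. -/

section MellinPieces

open MeasureTheory Set

theorem locallyIntegrableOn_indicator_Ioi {f : ℝ → ℂ} (hf : ContinuousOn f (Ici 1)) :
    LocallyIntegrableOn (indicator (Ioi 1) f) (Ioi 0) := by
  intro x hx
  refine ⟨Icc (x - 1) (x + 1), mem_nhdsWithin_of_mem_nhds
    (Icc_mem_nhds (by linarith) (by linarith)), ?_⟩
  rw [IntegrableOn, integrable_indicator_iff measurableSet_Ioi, IntegrableOn,
    Measure.restrict_restrict measurableSet_Ioi]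
  refine ((hf.mono Icc_subset_Ici_self).integrableOn_Icc (b := x + 1)).mono_set ?_
  rintro y ⟨h1, h2⟩
  exact ⟨le_of_lt h1, h2.2⟩

theorem locallyIntegrableOn_indicator_Ioc {f : ℝ → ℂ} (hf : ContinuousOn f (Icc 0 1)) :
    LocallyIntegrableOn (indicator (Ioc 0 1) f) (Ioi 0) := by
  refine (Integrable.locallyIntegrable ?_).locallyIntegrableOn _
  rw [integrable_indicator_iff measurableSet_Ioc]
  exact (hf.integrableOn_Icc).mono_set Ioc_subset_Icc_self

/-- Mellin transform of a function supported on `(1, ∞)`. -/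
theorem mellin_indicator_Ioi {f : ℝ → ℂ} (hf : ContinuousOn f (Ici 1)) {C a : ℝ}
    (hC : ∀ x : ℝ, 1 ≤ x → ‖f x‖ ≤ C / x ^ a) {s : ℂ} (hs : s.re < a) :
    MellinConvergent (indicator (Ioi 1) f) s ∧
      DifferentiableAt ℂ (mellin (indicator (Ioi 1) f)) s := by
  have h1 : indicator (Ioi 1) f =O[atTop] fun x : ℝ => x ^ (-a) := by
    refine IsBigO.of_bound C ?_
    filter_upwards [eventually_gt_atTop 1] with x hx
    rw [indicator_of_mem (mem_Ioi.2 hx), Real.norm_of_nonneg (by positivity),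
      Real.rpow_neg (by linarith), ← div_eq_mul_inv]
    exact hC x hx.le
  -- The function vanishes near 0, so any exponent below `s.re` is allowed there.
  have h2 : indicator (Ioi 1) f =O[𝓝[>] 0] fun x : ℝ => x ^ (-(s.re - 1)) := by
    refine IsBigO.of_bound 0 ?_
    filter_upwards [mem_nhdsWithin_of_mem_nhds (Iio_mem_nhds (zero_lt_one' ℝ))] with x hx
    rw [indicator_of_notMem fun h : x ∈ Ioi (1 : ℝ) => lt_asymm (mem_Ioi.1 h) (mem_Iio.1 hx)]
    simp
  have h3 := locallyIntegrableOn_indicator_Ioi hf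
  exact ⟨mellinConvergent_of_isBigO_rpow h3 h1 hs h2 (by linarith),
    mellin_differentiableAt_of_isBigO_rpow h3 h1 hs h2 (by linarith)⟩

/-- Mellin transform of a function supported on `(0, 1]`. -/
theorem mellin_indicator_Ioc {f : ℝ → ℂ} (hf : ContinuousOn f (Icc 0 1)) {s : ℂ}
    (hs : 0 < s.re) :
    MellinConvergent (indicator (Ioc 0 1) f) s ∧
      DifferentiableAt ℂ (mellin (indicator (Ioc 0 1) f)) s := by
  have h1 : indicator (Ioc 0 1) f =O[atTop] fun x : ℝ => x ^ (-(s.re + 1)) := by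
    refine IsBigO.of_bound 0 ?_
    filter_upwards [eventually_gt_atTop 1] with x hx
    rw [indicator_of_notMem (fun h => absurd h.2 (not_le.2 hx))]
    simp
  have h2 : indicator (Ioc 0 1) f =O[𝓝[>] 0] fun x : ℝ => x ^ (-(0 : ℝ)) := by
    obtain ⟨C, hC⟩ := isCompact_Icc.exists_bound_of_continuousOn hf
    refine IsBigO.of_bound C ?_
    filter_upwards [Ioc_mem_nhdsGT (zero_lt_one' ℝ)] with x hx
    rw [indicator_of_mem hx, neg_zero, Real.rpow_zero, norm_one, mul_one]
    exact hC x ⟨hx.1.le, hx.2⟩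
  have h3 := locallyIntegrableOn_indicator_Ioc hf
  exact ⟨mellinConvergent_of_isBigO_rpow h3 h1 (by linarith) h2 hs,
    mellin_differentiableAt_of_isBigO_rpow h3 h1 (by linarith) h2 hs⟩

theorem mellin_eq_add_indicator {f : ℝ → ℂ} {s : ℂ}
    (h1 : MellinConvergent (indicator (Ioc 0 1) f) s)
    (h2 : MellinConvergent (indicator (Ioi 1) f) s) :
    HasMellin f s (mellin (indicator (Ioc 0 1) f) s + mellin (indicator (Ioi 1) f) s) := by
  have h := hasMellin_add h1 h2
  have e : ∀ x ∈ Ioi (0 : ℝ), indicator (Ioc 0 1) f x + indicator (Ioi 1) f x = f x := by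
    intro x hx
    rcases le_or_gt x 1 with h | h
    · rw [indicator_of_mem (show x ∈ Ioc 0 1 from ⟨hx, h⟩),
        indicator_of_notMem (fun h' : x ∈ Ioi (1 : ℝ) => not_lt.2 h (mem_Ioi.1 h')), add_zero]
    · rw [indicator_of_mem (mem_Ioi.2 h),
        indicator_of_notMem (fun h' => absurd h'.2 (not_le.2 h)), zero_add]
  refine ⟨IntegrableOn.congr_fun h.1 (fun x hx => by simp only [e x hx]) measurableSet_Ioi, ?_⟩
  rw [← h.2]
  exact setIntegral_congr_fun measurableSet_Ioi fun x hx => by simp only [e x hx]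

theorem mellin_indicator_Ioi_inv {s : ℂ} (hs : s.re < 1) :
    HasMellin (indicator (Ioi 1) fun x : ℝ => 1 / (2 * (x : ℂ))) s (1 / (2 * (1 - s))) := by
  refine ⟨(mellin_indicator_Ioi (C := 1) (a := 1) ?_ (fun x hx => ?_) hs).1, ?_⟩
  · refine continuousOn_const.div (by fun_prop) fun x hx => ?_
    have : (0 : ℝ) < x := lt_of_lt_of_le one_pos hx
    simpa using this.ne'
  · rw [Real.rpow_one, norm_div, norm_one, norm_mul, Complex.norm_ofNat,
      Complex.norm_of_nonneg (by linarith)]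
    gcongr
    linarith
  · have e : mellin (indicator (Ioi 1) fun x : ℝ => 1 / (2 * (x : ℂ))) s =
        ∫ x in Ioi (1 : ℝ), 1 / 2 * (x : ℂ) ^ (s - 2) := by
      rw [mellin]
      have e1 : ∀ x : ℝ, (x : ℂ) ^ (s - 1) • indicator (Ioi 1) (fun x : ℝ => 1 / (2 * (x : ℂ))) x =
          indicator (Ioi 1) (fun x : ℝ => (x : ℂ) ^ (s - 1) • (1 / (2 * (x : ℂ)))) x := fun x => by
        by_cases h : x ∈ Ioi (1 : ℝ)
        · rw [indicator_of_mem h, indicator_of_mem h]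
        · rw [indicator_of_notMem h, indicator_of_notMem h, smul_zero]
      simp only [e1]
      rw [setIntegral_indicator measurableSet_Ioi, Ioi_inter_Ioi, sup_of_le_right zero_le_one]
      refine setIntegral_congr_fun measurableSet_Ioi fun x hx => ?_
      have hx0 : (x : ℂ) ≠ 0 := Complex.ofReal_ne_zero.2 (one_pos.trans hx).ne'
      simp only [smul_eq_mul]
      rw [show s - 1 = s - 2 + 1 by ring, Complex.cpow_add _ _ hx0, Complex.cpow_one]
      field_simp
    rw [e, integral_const_mul, integral_Ioi_cpow_of_lt (by simp; linarith) one_pos]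
    have h1 : 1 - s ≠ 0 := fun h => by
      rw [sub_eq_zero] at h
      rw [← h] at hs
      simp at hs
    have h2 : s - 2 + 1 ≠ 0 := fun h => h1 (by linear_combination -h)
    have h3 : s - 2 + 1 = -(1 - s) := by ring
    rw [Complex.ofReal_one, Complex.one_cpow, h3]
    field_simp

/-- Functions that behave like `1 / (2 x)` at infinity. -/
theorem hasMellin_of_norm_sub_le {f : ℝ → ℂ} (hf : ContinuousOn f (Ici 0)) {C : ℝ}
    (hC : ∀ x : ℝ, 1 ≤ x → ‖f x - 1 / (2 * x)‖ ≤ C / x ^ 2) {s : ℂ} (h0 : 0 < s.re)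
    (h1 : s.re < 1) :
    HasMellin f s (mellin (indicator (Ioc 0 1) f) s +
      mellin (indicator (Ioi 1) fun x => f x - 1 / (2 * x)) s + 1 / (2 * (1 - s))) := by
  have hcont : ContinuousOn (fun x : ℝ => f x - 1 / (2 * x)) (Ici 1) := by
    refine (hf.mono (Ici_subset_Ici.2 zero_le_one)).sub
      (continuousOn_const.div (by fun_prop) fun x hx => ?_)
    have : (0 : ℝ) < x := lt_of_lt_of_le one_pos hx
    simpa using this.ne'
  have hA := mellin_indicator_Ioc (hf.mono Icc_subset_Ici_self) h0
  have hB := mellin_indicator_Ioi hcont (C := C) (a := 2)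
    (fun x hx => by rw [Real.rpow_two]; exact hC x hx) (by linarith : s.re < 2)
  have hD := mellin_indicator_Ioi_inv h1
  have hBD := hasMellin_add hB.1 hD.1
  have e : (fun x => indicator (Ioi 1) (fun x => f x - 1 / (2 * x)) x +
      indicator (Ioi 1) (fun x : ℝ => 1 / (2 * (x : ℂ))) x) = indicator (Ioi 1) f := by
    ext x
    by_cases h : x ∈ Ioi (1 : ℝ)
    · simp only [indicator_of_mem h, sub_add_cancel]
    · simp only [indicator_of_notMem h, add_zero]
  rw [e] at hBD
  have := mellin_eq_add_indicator hA.1 hBD.1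
  rwa [hBD.2, hD.2, ← add_assoc] at this

end MellinPieces

/-! ### The contribution of the factor `s (s - 1)`. -/

section PoleSeries

open MeasureTheory Set

theorem hasSum_odd_mul_geometric {r : ℝ} (h : |r| < 1) :
    HasSum (fun k : ℕ => (2 * k + 1) * r ^ k) ((1 + r) / (1 - r) ^ 2) := by
  have h1 := (hasSum_coe_mul_geometric_of_norm_lt_one (𝕜 := ℝ) (r := r) (by simpa)).mul_left 2
  have h2 := h1.add (hasSum_geometric_of_abs_lt_one h)
  have h3 : 1 - r ≠ 0 := by
    have := (abs_lt.1 h).2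
    linarith
  convert! h2 using 1
  · ext k; ring
  · field_simp
    ring

/-- The value is `(2/x²)(1 + r)/(1 - r)²` with `r = 1/(4x²)`. Only even powers of `1/x` occur, so
the Mellin poles fall at integers `σ = -k`, away from the half-integers. -/
theorem hasSum_inv_sq_add_inv_sq {x : ℝ} (hx : 1 ≤ x) :
    HasSum (fun k : ℕ => 2 * (2 * k + 1) * (1 / 4) ^ k * x ^ (-(2 * k + 2) : ℝ))
      (1 / (x + 1 / 2) ^ 2 + 1 / (x - 1 / 2) ^ 2) := by
  have hx0 : 0 < x := by linarith
  have hr : |1 / (4 * x ^ 2)| < 1 := by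
    rw [abs_of_pos (by positivity), div_lt_one (by positivity)]
    nlinarith
  have h := (hasSum_odd_mul_geometric hr).mul_left (2 / x ^ 2)
  convert! h using 1
  · ext k
    have e : x ^ (2 * k + 2) = (x ^ 2) ^ k * x ^ 2 := by ring
    rw [Real.rpow_neg hx0.le, show (2 * k + 2 : ℝ) = ((2 * k + 2 : ℕ) : ℝ) by push_cast; ring,
      Real.rpow_natCast, e, div_pow, div_pow, mul_pow]
    field_simp
  · have h1' : 2 * x + 1 ≠ 0 := by linarith
    have h2' : 2 * x - 1 ≠ 0 := by linarith
    have h3 : 1 - 1 / (4 * x ^ 2) = (x + 1 / 2) * (x - 1 / 2) / x ^ 2 := by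
      field_simp
      ring
    rw [h3, show x + 1 / 2 = (2 * x + 1) / 2 by ring, show x - 1 / 2 = (2 * x - 1) / 2 by ring]
    field_simp
    ring

/-- Termwise integration of the expansion in `1/x²` over `(1, ∞)`: the `k`-th coefficient is divided
by `2k + 2 - s`. -/
theorem mellin_indicator_inv_sq_add_inv_sq {s : ℂ} (hs : s.re < 2) :
    HasMellin (indicator (Ioi 1) fun x : ℝ => 1 / ((x : ℂ) + 1 / 2) ^ 2 + 1 / ((x : ℂ) - 1 / 2) ^ 2)
      s (∑' k : ℕ, 2 * (2 * k + 1) * (1 / 4) ^ k / (2 * k + 2 - s)) := by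
  set f : ℝ → ℂ := fun x => 1 / ((x : ℂ) + 1 / 2) ^ 2 + 1 / ((x : ℂ) - 1 / 2) ^ 2 with hf
  have hfr : ∀ x : ℝ, f x = ((1 / (x + 1 / 2) ^ 2 + 1 / (x - 1 / 2) ^ 2 : ℝ) : ℂ) := fun x => by
    simp only [hf]; push_cast; rfl
  refine ⟨(mellin_indicator_Ioi (C := 5) (a := 2) ?_ (fun x hx => ?_) hs).1, ?_⟩
  · refine ContinuousOn.add (continuousOn_const.div (by fun_prop) fun x hx => ?_)
      (continuousOn_const.div (by fun_prop) fun x hx => ?_)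
    · have hx : 1 ≤ x := hx
      have : (x : ℂ) + 1 / 2 = ((x + 1 / 2 : ℝ) : ℂ) := by push_cast; rfl
      rw [this]
      exact pow_ne_zero _ (Complex.ofReal_ne_zero.2 (by linarith))
    · have hx : 1 ≤ x := hx
      have : (x : ℂ) - 1 / 2 = ((x - 1 / 2 : ℝ) : ℂ) := by push_cast; rfl
      rw [this]
      exact pow_ne_zero _ (Complex.ofReal_ne_zero.2 (by linarith))
  · rw [hfr, Complex.norm_of_nonneg (by positivity), Real.rpow_two]
    have h1 : 1 / (x + 1 / 2) ^ 2 ≤ 1 / x ^ 2 := by gcongr; linarith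
    have h6 : (x / 2) ^ 2 ≤ (x - 1 / 2) ^ 2 := by gcongr; linarith
    have h2 : 1 / (x - 1 / 2) ^ 2 ≤ 4 / x ^ 2 := by
      calc 1 / (x - 1 / 2) ^ 2 ≤ 1 / (x / 2) ^ 2 := by gcongr
        _ = 4 / x ^ 2 := by field_simp; norm_num
    have h3 : (5 : ℝ) / x ^ 2 = 1 / x ^ 2 + 4 / x ^ 2 := by ring
    linarith
  · set c : ℕ → ℝ := fun k => 2 * (2 * k + 1) * (1 / 4) ^ k with hc
    have hc0 : ∀ k, 0 ≤ c k := fun k => by positivity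
    have hcs : Summable c := by
      have := (hasSum_odd_mul_geometric (r := 1 / 4) (by norm_num [abs_of_pos])).summable
      refine (this.mul_left 2).congr fun k => ?_
      simp only [hc]; ring
    set F : ℕ → ℝ → ℂ := fun k x => (c k : ℂ) * (x : ℂ) ^ (s - (2 * k + 3)) with hF
    have hlt : ∀ k : ℕ, (s - (2 * k + 3)).re < -1 := fun k => by
      simp
      linarith [(k.cast_nonneg : (0 : ℝ) ≤ k)]
    have hFi : ∀ k, Integrable (F k) (volume.restrict (Ioi 1)) := fun k =>
      (integrableOn_Ioi_cpow_of_lt (hlt k) one_pos).const_mul _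
    have hne : ∀ k : ℕ, (2 * k + 2 - s : ℂ) ≠ 0 := fun k h => by
      have := congrArg Complex.re h
      simp at this
      linarith [(k.cast_nonneg : (0 : ℝ) ≤ k)]
    have hFint : ∀ k, ∫ x in Ioi (1 : ℝ), F k x = c k / (2 * k + 2 - s) := fun k => by
      rw [integral_const_mul, integral_Ioi_cpow_of_lt (hlt k) one_pos]
      have h1 := hne k
      have h3 : s - (2 * k + 3) + 1 = -(2 * k + 2 - s) := by ring
      rw [Complex.ofReal_one, Complex.one_cpow, h3]
      field_simp
    have hFn : ∀ k, ∫ x in Ioi (1 : ℝ), ‖F k x‖ ≤ c k * (1 / (2 - s.re)) := fun k => by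
      have e : ∀ x ∈ Ioi (1 : ℝ), ‖F k x‖ = c k * x ^ (s.re - (2 * k + 3)) := fun x hx => by
        have hx : 1 < x := hx
        rw [hF]
        simp only [norm_mul]
        rw [Complex.norm_of_nonneg (hc0 k), Complex.norm_cpow_eq_rpow_re_of_pos (by linarith)]
        simp
      rw [setIntegral_congr_fun measurableSet_Ioi e, integral_const_mul,
        integral_Ioi_rpow_of_lt (by linarith [(k.cast_nonneg : (0 : ℝ) ≤ k)]) one_pos,
        Real.one_rpow, neg_div, ← div_neg]
      have h0 := hc0 k
      have h1 := (k.cast_nonneg : (0 : ℝ) ≤ k)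
      refine mul_le_mul_of_nonneg_left (one_div_le_one_div_of_le (by linarith) (by linarith)) h0
    have hsum := hasSum_integral_of_summable_integral_norm hFi
      (Summable.of_nonneg_of_le (fun i => integral_nonneg fun x => norm_nonneg _) hFn
        (hcs.mul_right _))
    simp only [hFint] at hsum
    have e : mellin (indicator (Ioi 1) f) s = ∫ x in Ioi (1 : ℝ), ∑' k, F k x := by
      rw [mellin]
      have e1 : ∀ x : ℝ, (x : ℂ) ^ (s - 1) • indicator (Ioi 1) f x =
          indicator (Ioi 1) (fun x : ℝ => (x : ℂ) ^ (s - 1) • f x) x := fun x => by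
        by_cases h : x ∈ Ioi (1 : ℝ)
        · rw [indicator_of_mem h, indicator_of_mem h]
        · rw [indicator_of_notMem h, indicator_of_notMem h, smul_zero]
      simp only [e1]
      rw [setIntegral_indicator measurableSet_Ioi, Ioi_inter_Ioi, sup_of_le_right zero_le_one]
      refine setIntegral_congr_fun measurableSet_Ioi fun x hx => ?_
      have hx : 1 < x := hx
      have hx0 : (x : ℂ) ≠ 0 := Complex.ofReal_ne_zero.2 (by linarith)
      have h := ((Complex.hasSum_ofReal.2 (hasSum_inv_sq_add_inv_sq hx.le)).mul_left
        ((x : ℂ) ^ (s - 1))).tsum_eq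
      simp only [smul_eq_mul]
      rw [hfr, ← h]
      refine tsum_congr fun k => ?_
      simp only [hF, hc]
      rw [Complex.ofReal_mul, Complex.ofReal_cpow (by linarith)]
      have h5 : s - (2 * k + 3) = (s - 1) + ((-(2 * k + 2) : ℝ) : ℂ) := by push_cast; ring
      rw [h5, Complex.cpow_add _ _ hx0]
      ring
    rw [e, ← hsum.tsum_eq]
    refine tsum_congr fun k => ?_
    simp only [hc]
    push_cast
    rfl

/-- The entire function `sin (π z) / z`. -/
noncomputable def sinDiv (z : ℂ) : ℂ := dslope (fun z => Complex.sin (Real.pi * z)) 0 z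

theorem sinDiv_of_ne {z : ℂ} (hz : z ≠ 0) : sinDiv z = Complex.sin (Real.pi * z) / z := by
  rw [sinDiv, dslope_of_ne _ hz, slope_def_field]
  simp

theorem differentiable_sinDiv : Differentiable ℂ sinDiv := by
  have h : Differentiable ℂ fun z : ℂ => Complex.sin (Real.pi * z) := by fun_prop
  rw [← differentiableOn_univ] at h ⊢
  exact (Complex.differentiableOn_dslope univ_mem).2 h

theorem norm_cos_le (z : ℂ) : ‖Complex.cos z‖ ≤ Real.exp |z.im| := by
  have h1 : ‖Complex.exp (-z * Complex.I)‖ ≤ Real.exp |z.im| := by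
    rw [Complex.norm_exp, Real.exp_le_exp]
    simpa using le_abs_self z.im
  have h2 : ‖Complex.exp (z * Complex.I)‖ ≤ Real.exp |z.im| := by
    rw [Complex.norm_exp, Real.exp_le_exp]
    simpa using neg_le_abs z.im
  rw [Complex.cos, norm_div, Complex.norm_ofNat]
  have := norm_add_le (Complex.exp (z * Complex.I)) (Complex.exp (-z * Complex.I))
  linarith

/-- Mean value inequality from 0 in the convex strip `|Im w| ≤ R`, where the derivative `π cos(πw)`
is at most `π e^(πR)`. -/
theorem norm_sinDiv_le {z : ℂ} {R : ℝ} (hz : |z.im| ≤ R) :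
    ‖sinDiv z‖ ≤ Real.pi * Real.exp (Real.pi * R) := by
  have hR : 0 ≤ R := (abs_nonneg _).trans hz
  have key : ∀ w ∈ {w : ℂ | |w.im| ≤ R}, w ≠ 0 →
      ‖Complex.sin (Real.pi * w)‖ ≤ Real.pi * Real.exp (Real.pi * R) * ‖w‖ := by
    intro w hw _
    have hconv : Convex ℝ {w : ℂ | |w.im| ≤ R} := by
      have : {w : ℂ | |w.im| ≤ R} = Complex.imLm ⁻¹' Icc (-R) R := by
        ext w; simp [abs_le]
      rw [this]
      exact (convex_Icc _ _).linear_preimage _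
    have hd : ∀ w : ℂ, HasDerivAt (fun w : ℂ => Complex.sin (Real.pi * w))
        (Complex.cos (Real.pi * w) * Real.pi) w := fun w => by
      have := ((hasDerivAt_id w).const_mul (Real.pi : ℂ)).csin
      simpa using this
    have h1 := hconv.norm_image_sub_le_of_norm_hasDerivWithin_le
      (f := fun w : ℂ => Complex.sin (Real.pi * w)) (C := Real.pi * Real.exp (Real.pi * R))
      (fun w _ => (hd w).hasDerivWithinAt) (fun w hw => ?_)
      (show (0 : ℂ) ∈ {w : ℂ | |w.im| ≤ R} by simpa) hw
    · simpa using h1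
    · rw [norm_mul, mul_comm, Complex.norm_of_nonneg Real.pi_pos.le]
      refine mul_le_mul_of_nonneg_left ((norm_cos_le _).trans ?_) Real.pi_pos.le
      rw [Real.exp_le_exp]
      have h2 : ((Real.pi : ℂ) * w).im = Real.pi * w.im := by simp
      rw [h2, abs_mul, abs_of_pos Real.pi_pos]
      exact mul_le_mul_of_nonneg_left hw Real.pi_pos.le
  by_cases h0 : z = 0
  · have h1 : sinDiv 0 = Real.pi := by
      rw [sinDiv, dslope_same]
      have := ((hasDerivAt_id (0 : ℂ)).const_mul (Real.pi : ℂ)).csin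
      simpa using this.deriv
    rw [h0, h1, Complex.norm_of_nonneg Real.pi_pos.le]
    exact le_mul_of_one_le_right Real.pi_pos.le (Real.one_le_exp (by positivity))
  · rw [sinDiv_of_ne h0, norm_div, div_le_iff₀ (norm_pos_iff.2 h0)]
    exact key z hz h0

/-- The entire function `sin (π σ) * ∑ k, e_k / (2 k + 2 σ)`, `e_k = 2 (2 k + 1) 4 ^ (-k)`. -/
noncomputable def poleSeries (σ : ℂ) : ℂ :=
  ∑' k : ℕ, (2 * k + 1) * (1 / 4) ^ k * (-1) ^ k * sinDiv (σ + k)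

theorem differentiable_poleSeries : Differentiable ℂ poleSeries := by
  intro σ
  have hs : Summable fun k : ℕ => (2 * k + 1) * (1 / 4 : ℝ) ^ k *
      (Real.pi * Real.exp (Real.pi * (|σ.im| + 1))) :=
    (hasSum_odd_mul_geometric (r := 1 / 4) (by norm_num [abs_of_pos])).summable.mul_right _
  have hopen : IsOpen {z : ℂ | |z.im| < |σ.im| + 1} :=
    isOpen_lt (by fun_prop) continuous_const
  refine (Complex.differentiableOn_tsum_of_summable_norm hs (fun k => ?_) hopen
    (fun k z hz => ?_)).differentiableAt (hopen.mem_nhds (by simp))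
  · exact ((differentiable_sinDiv.comp (differentiable_id.add_const _)).const_mul
      _).differentiableOn
  · have hz : |z.im| < |σ.im| + 1 := hz
    rw [norm_mul]
    have h1 : ‖(2 * k + 1 : ℂ) * (1 / 4) ^ k * (-1) ^ k‖ = (2 * k + 1) * (1 / 4 : ℝ) ^ k := by
      have : (2 * k + 1 : ℂ) = ((2 * k + 1 : ℝ) : ℂ) := by push_cast; rfl
      rw [norm_mul, norm_mul, norm_pow, norm_pow, this, Complex.norm_of_nonneg (by positivity)]
      simp
    rw [h1]
    refine mul_le_mul_of_nonneg_left (norm_sinDiv_le ?_) (by positivity)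
    simpa using hz.le

/-- As `sin(π(σ + k)) = (-1)^k sin(πσ)`, the term `(-1)^k sinDiv (σ + k)` is `sin(πσ)/(σ + k)` freed
of its singularity: the sine cancels every pole `σ = -k`. -/
theorem poleSeries_eq {σ : ℂ} (hσ : 0 < σ.re) :
    poleSeries σ = Complex.sin (Real.pi * σ) *
      ∑' k : ℕ, 2 * (2 * k + 1) * (1 / 4) ^ k / (2 * k + 2 - (2 - 2 * σ)) := by
  rw [poleSeries, ← tsum_mul_left]
  refine tsum_congr fun k => ?_
  have hne : σ + k ≠ 0 := fun h => by
    have := congrArg Complex.re h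
    simp at this
    linarith [(k.cast_nonneg : (0 : ℝ) ≤ k)]
  have h1 : Complex.sin (Real.pi * (σ + k)) = (-1) ^ k * Complex.sin (Real.pi * σ) := by
    rw [mul_add, mul_comm (Real.pi : ℂ) k, Complex.sin_antiperiodic.add_nat_mul_eq]
  have h2 : (2 * k + 2 - (2 - 2 * σ) : ℂ) = 2 * (σ + k) := by ring
  have h3 : ((-1 : ℂ) ^ k) * (-1) ^ k = 1 := by rw [← mul_pow]; simp
  rw [sinDiv_of_ne hne, h1, h2]
  field_simp
  linear_combination (2 * k + 1 : ℂ) * Complex.sin (Real.pi * σ) * h3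

end PoleSeries

/-! ### The Hurwitz zeta function with parameter `1/4` at negative odd integers. -/

section HurwitzQuarter

open Set HurwitzZeta

/-- The even Hurwitz series runs over `n + 1/4` and `n + 3/4`, that is, over a quarter of the odd
integers; removing the even integers from `ζ` costs the factor `1 - 2^(-s)`. -/
theorem two_mul_hurwitzZetaEven_quarter_of_one_lt_re {s : ℂ} (hs : 1 < s.re) :
    2 * hurwitzZetaEven ((1 / 4 : ℝ) : UnitAddCircle) s =
      (4 : ℂ) ^ s * (1 - (2 : ℂ) ^ (-s)) * riemannZeta s := by
  have hs0 : s ≠ 0 := fun h => by rw [h] at hs; simp at hs; linarith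
  have h := (hasSum_nat_hurwitzZetaEven_of_mem_Icc (a := 1 / 4) ⟨by norm_num, by norm_num⟩
    hs).mul_left 2
  set f : ℕ → ℂ := fun n => 1 / (n : ℂ) ^ s with hf
  have hfs : Summable f := Complex.summable_one_div_nat_cpow.2 hs
  have hζ : riemannZeta s = ∑' n, f n := zeta_eq_tsum_one_div_nat_cpow hs
  have hev : Summable fun k => f (2 * k) :=
    hfs.comp_injective (mul_right_injective₀ two_ne_zero)
  have hod : Summable fun k => f (2 * k + 1) :=
    hfs.comp_injective ((add_left_injective 1).comp (mul_right_injective₀ two_ne_zero))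
  have hod1 : Summable fun k => f (2 * (2 * k) + 1) :=
    hod.comp_injective (mul_right_injective₀ two_ne_zero)
  have hod3 : Summable fun k => f (2 * (2 * k + 1) + 1) :=
    hod.comp_injective ((add_left_injective 1).comp (mul_right_injective₀ two_ne_zero))
  have h1 := tsum_even_add_odd hev hod
  have h2 := tsum_even_add_odd (f := fun k => f (2 * k + 1)) hod1 hod3
  have hmul : ∀ (c n : ℕ), ((c * n : ℕ) : ℂ) ^ s = (c : ℂ) ^ s * (n : ℂ) ^ s := fun c n => by
    rw [Nat.cast_mul, Complex.natCast_mul_natCast_cpow]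
  have h3 : ∑' k, f (2 * k) = (2 : ℂ) ^ (-s) * ∑' k, f k := by
    rw [← tsum_mul_left]
    refine tsum_congr fun k => ?_
    simp only [hf]
    rw [hmul, Complex.cpow_neg]
    simp [mul_comm]
  have h4 : ∀ n : ℕ, 2 * ((1 / (n + (1 / 4 : ℝ) : ℂ) ^ s + 1 / (n + 1 - (1 / 4 : ℝ) : ℂ) ^ s) / 2) =
      (4 : ℂ) ^ s * (f (2 * (2 * n) + 1) + f (2 * (2 * n + 1) + 1)) := by
    intro n
    have e1 : ((2 * (2 * n) + 1 : ℕ) : ℂ) ^ s = (4 : ℂ) ^ s * (n + (1 / 4 : ℝ) : ℂ) ^ s := by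
      have : ((2 * (2 * n) + 1 : ℕ) : ℂ) = ((4 : ℝ) : ℂ) * ((n + 1 / 4 : ℝ) : ℂ) := by
        push_cast; ring
      rw [this, Complex.mul_cpow_ofReal_nonneg (by norm_num) (by positivity)]
      push_cast
      rfl
    have e2 : ((2 * (2 * n + 1) + 1 : ℕ) : ℂ) ^ s =
        (4 : ℂ) ^ s * (n + 1 - (1 / 4 : ℝ) : ℂ) ^ s := by
      have : ((2 * (2 * n + 1) + 1 : ℕ) : ℂ) = ((4 : ℝ) : ℂ) * ((n + 3 / 4 : ℝ) : ℂ) := by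
        push_cast; ring
      rw [this, Complex.mul_cpow_ofReal_nonneg (by norm_num) (by positivity)]
      have e3 : ((n + 3 / 4 : ℝ) : ℂ) = n + 1 - (1 / 4 : ℝ) := by push_cast; ring
      rw [e3]
      push_cast
      rfl
    have h40 : (4 : ℂ) ^ s ≠ 0 := by simp [Complex.cpow_eq_zero_iff]
    simp only [hf]
    rw [e1, e2, mul_add, mul_one_div, mul_one_div, div_mul_cancel_left₀ h40,
      div_mul_cancel_left₀ h40]
    ring
  simp only [h4] at h
  have h5 := h.unique ((hod1.hasSum.add hod3.hasSum).mul_left ((4 : ℂ) ^ s))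
  rw [h5, h2, hζ]
  linear_combination (4 : ℂ) ^ s * (h1 - h3)

theorem two_mul_hurwitzZetaEven_quarter {s : ℂ} (hs : s ≠ 1) :
    2 * hurwitzZetaEven ((1 / 4 : ℝ) : UnitAddCircle) s =
      (4 : ℂ) ^ s * (1 - (2 : ℂ) ^ (-s)) * riemannZeta s := by
  have hA : AnalyticOnNhd ℂ (fun s => 2 * hurwitzZetaEven ((1 / 4 : ℝ) : UnitAddCircle) s)
      {1}ᶜ := DifferentiableOn.analyticOnNhd (fun z hz =>
    ((differentiableAt_hurwitzZetaEven _ hz).const_mul _).differentiableWithinAt)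
    isOpen_compl_singleton
  have hB : AnalyticOnNhd ℂ (fun s => (4 : ℂ) ^ s * (1 - (2 : ℂ) ^ (-s)) * riemannZeta s)
      {1}ᶜ := DifferentiableOn.analyticOnNhd (fun z hz => by
    refine DifferentiableAt.differentiableWithinAt (DifferentiableAt.mul ?_
      (differentiableAt_riemannZeta hz))
    refine DifferentiableAt.mul ?_ (DifferentiableAt.sub (differentiableAt_const _) ?_)
    · exact differentiableAt_id.const_cpow (Or.inl (by norm_num))
    · exact differentiableAt_id.neg.const_cpow (Or.inl (by norm_num)))
    isOpen_compl_singleton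
  refine hA.eqOn_of_preconnected_of_eventuallyEq hB
    (isConnected_compl_singleton_of_one_lt_rank (by simp) 1).isPreconnected
    (z₀ := 2) (by simp) ?_ hs
  filter_upwards [(isOpen_lt continuous_const Complex.continuous_re).mem_nhds
    (show (1 : ℝ) < (2 : ℂ).re by simp)] with z hz
  exact two_mul_hurwitzZetaEven_quarter_of_one_lt_re hz

/-- The odd part vanishes at negative odd integers, so only the even part counts, and it is
elementary in `ζ(1 - 2j) = -B_{2j}/(2j)`. -/
theorem hurwitzZeta_quarter_one_sub {j : ℕ} (hj : 1 ≤ j) :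
    hurwitzZeta ((1 / 4 : ℝ) : UnitAddCircle) (1 - 2 * j) =
      (2 : ℂ) ^ (-(2 * j : ℤ)) * (1 - (2 : ℂ) ^ (1 - 2 * (j : ℤ))) * bernoulli (2 * j) / (2 * j) := by
  obtain ⟨k, rfl⟩ : ∃ k, j = k + 1 := ⟨j - 1, by omega⟩
  have hodd : hurwitzZetaOdd ((1 / 4 : ℝ) : UnitAddCircle) (1 - 2 * ((k + 1 : ℕ) : ℂ)) = 0 := by
    rw [Nat.cast_succ, show (1 : ℂ) - 2 * (k + 1) = -2 * k - 1 by ring,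
      hurwitzZetaOdd_neg_two_mul_nat_sub_one]
  have hne : (1 : ℂ) - 2 * ((k + 1 : ℕ) : ℂ) ≠ 1 := fun h => by
    have h1 : ((k + 1 : ℕ) : ℂ) = 0 := by linear_combination -(1 / 2 : ℂ) * h
    exact (Nat.succ_ne_zero k) (by exact_mod_cast h1)
  have hev := two_mul_hurwitzZetaEven_quarter hne
  have hζ := riemannZeta_neg_nat_eq_bernoulli (2 * k + 1)
  have e1 : (1 : ℂ) - 2 * ((k + 1 : ℕ) : ℂ) = -((2 * k + 1 : ℕ) : ℂ) := by push_cast; ring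
  rw [hurwitzZeta, hodd, add_zero]
  rw [e1] at hev ⊢
  rw [hζ, neg_neg, Complex.cpow_neg, Complex.cpow_natCast, Complex.cpow_natCast] at hev
  have h2 : (4 : ℂ) ^ (2 * k + 1) = (2 ^ (2 * k + 1)) ^ 2 := by
    rw [← pow_mul, mul_comm _ 2, pow_mul]; norm_num
  have e2 : (2 : ℂ) ^ (-(2 * ((k + 1 : ℕ) : ℤ))) = 1 / (2 * 2 ^ (2 * k + 1)) := by
    rw [zpow_neg, show (2 * ((k + 1 : ℕ) : ℤ)) = ((2 * k + 2 : ℕ) : ℤ) by push_cast; ring,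
      zpow_natCast, pow_succ _ (2 * k + 1), one_div, mul_comm]
  have e3 : (2 : ℂ) ^ (1 - 2 * ((k + 1 : ℕ) : ℤ)) = 1 / 2 ^ (2 * k + 1) := by
    rw [show (1 - 2 * ((k + 1 : ℕ) : ℤ)) = -((2 * k + 1 : ℕ) : ℤ) by push_cast; ring,
      zpow_neg, zpow_natCast, one_div]
  have e4 : (-1 : ℂ) ^ (2 * k + 1) = -1 := by rw [pow_succ, pow_mul]; norm_num
  have hk : (k : ℂ) + 1 ≠ 0 := by exact_mod_cast Nat.succ_ne_zero k
  have hk2 : (2 * (k : ℂ) + 1 + 1) = 2 * (k + 1) := by ring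
  rw [e4, h2] at hev
  rw [e2, e3, show 2 * (k + 1) = 2 * k + 1 + 1 by ring]
  have hP : (2 : ℂ) ^ (2 * k + 1) ≠ 0 := pow_ne_zero _ two_ne_zero
  push_cast at hev ⊢
  rw [hk2] at hev
  generalize (2 : ℂ) ^ (2 * k + 1) = P at *
  have : hurwitzZetaEven ((1 / 4 : ℝ) : UnitAddCircle) (-(2 * (k : ℂ) + 1)) =
    1 / 2 * ((P ^ 2)⁻¹ * (1 - P) * (-1 * bernoulli (2 * k + 1 + 1) / (2 * (k + 1)))) := by
      rw [← hev]; ring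
  rw [this]
  field_simp
  ring

end HurwitzQuarter

/-! ### An identity theorem. -/

section MeromorphicIdentity

/-- The identity theorem for meromorphic functions. -/
theorem MeromorphicOn.eventuallyEq_of_isPreconnected {f g : ℂ → ℂ} {U : Set ℂ}
    (hf : MeromorphicOn f U) (hg : MeromorphicOn g U) (hU : IsPreconnected U) {x y : ℂ}
    (hx : x ∈ U) (hy : y ∈ U) (h : f =ᶠ[𝓝[≠] x] g) : f =ᶠ[𝓝[≠] y] g := by
  have hsub : MeromorphicOn (f - g) U := hf.sub hg
  have hxt : meromorphicOrderAt (f - g) x = ⊤ := by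
    rw [meromorphicOrderAt_eq_top_iff]
    filter_upwards [h] with z hz
    simp [hz]
  have hyt : meromorphicOrderAt (f - g) y = ⊤ := by
    by_contra hne
    exact hsub.meromorphicOrderAt_ne_top_of_isPreconnected hU hy hx hne hxt
  rw [meromorphicOrderAt_eq_top_iff] at hyt
  filter_upwards [hyt] with z hz
  simpa [sub_eq_zero] using hz

end MeromorphicIdentity

/-! ### Analyticity of Dirichlet series with complex bases. -/

section PowerSeries

theorem norm_cpow_neg_le (w σ : ℂ) :
    ‖w ^ (-σ)‖ ≤ ‖w‖ ^ (-σ.re) * Real.exp (Real.pi * |σ.im|) := by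
  refine (Complex.norm_cpow_le w (-σ)).trans ?_
  rw [div_eq_mul_inv, ← Real.exp_neg, Complex.neg_re, Complex.neg_im]
  refine mul_le_mul_of_nonneg_left (Real.exp_le_exp.2 ?_) (Real.rpow_nonneg (norm_nonneg _) _)
  have h1 : |w.arg * σ.im| ≤ Real.pi * |σ.im| := by
    rw [abs_mul]
    exact mul_le_mul_of_nonneg_right (Complex.abs_arg_le_pi w) (abs_nonneg _)
  have := (abs_le.1 h1).2
  linarith

variable {ι : Type*} {w : ι → ℂ} {m : ι → ℕ} {p₀ : ℝ}

theorem summable_norm_mul_cpow_neg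
    (hs : ∀ p : ℝ, p₀ < p → Summable fun i => (m i : ℝ) * ‖w i‖ ^ (-p)) {σ : ℂ}
    (hσ : p₀ < σ.re) : Summable fun i => ‖(m i : ℂ) * w i ^ (-σ)‖ := by
  refine Summable.of_nonneg_of_le (fun i => norm_nonneg _) (fun i => ?_)
    ((hs _ hσ).mul_right (Real.exp (Real.pi * |σ.im|)))
  rw [norm_mul, Complex.norm_natCast, mul_assoc]
  exact mul_le_mul_of_nonneg_left (norm_cpow_neg_le _ _) (Nat.cast_nonneg _)

/-- On a bounded box about `σ`, `|w|^(-Re z)` is at most the sum of its values at the extreme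
exponents `p` and `Re σ + 1`, whether `|w|` is above or below 1; both are summable. -/
theorem differentiableAt_tsum_mul_cpow_neg (hw : ∀ i, w i ≠ 0)
    (hs : ∀ p : ℝ, p₀ < p → Summable fun i => (m i : ℝ) * ‖w i‖ ^ (-p)) {σ : ℂ}
    (hσ : p₀ < σ.re) : DifferentiableAt ℂ (fun σ => ∑' i, (m i : ℂ) * w i ^ (-σ)) σ := by
  obtain ⟨p, hp, hpσ⟩ := exists_between hσ
  set K := Real.exp (Real.pi * (|σ.im| + 1)) with hK
  set U : Set ℂ := {z : ℂ | p < z.re ∧ z.re < σ.re + 1 ∧ |z.im| < |σ.im| + 1} with hU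
  have hopen : IsOpen U := (isOpen_lt continuous_const Complex.continuous_re).inter
    ((isOpen_lt Complex.continuous_re continuous_const).inter
      (isOpen_lt (continuous_abs.comp Complex.continuous_im) continuous_const))
  have hsum : Summable fun i => ((m i : ℝ) * ‖w i‖ ^ (-p) + (m i : ℝ) * ‖w i‖ ^ (-(σ.re + 1))) * K :=
    ((hs p hp).add (hs (σ.re + 1) (by linarith))).mul_right K
  refine (Complex.differentiableOn_tsum_of_summable_norm hsum (fun i => ?_) hopen
    (fun i z hz => ?_)).differentiableAt (hopen.mem_nhds ⟨hpσ, by simp, by simp⟩)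
  · intro z _
    exact ((differentiableAt_id.neg.const_cpow (Or.inl (hw i))).const_mul
      _).differentiableWithinAt
  · obtain ⟨h1, h2, h3⟩ := hz
    rw [norm_mul, Complex.norm_natCast, ← mul_add, mul_assoc]
    refine mul_le_mul_of_nonneg_left ((norm_cpow_neg_le _ _).trans ?_) (Nat.cast_nonneg _)
    have hpos : 0 < ‖w i‖ := norm_pos_iff.2 (hw i)
    refine mul_le_mul ?_ (Real.exp_le_exp.2 (mul_le_mul_of_nonneg_left h3.le Real.pi_pos.le))
      (Real.exp_pos _).le (by positivity)
    rcases le_total 1 ‖w i‖ with h | h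
    · exact (Real.rpow_le_rpow_of_exponent_le h (by linarith)).trans
        (le_add_of_nonneg_right (by positivity))
    · exact (Real.rpow_le_rpow_of_exponent_ge hpos h (by linarith)).trans
        (le_add_of_nonneg_left (by positivity))

end PowerSeries

/-! ### The unshifted series as a Mellin transform. -/

section ZeroSeries

theorem zeroTau_ne_zero (ρ : upperZetaZeros) : zeroTau ρ ≠ 0 := fun h => by
  have := zeroTau_re_pos ρ
  rw [h] at this
  simp at this

theorem summable_zetaMult_sq_rpow {p : ℝ} (hp : 1 / 2 < p) :
    Summable fun ρ : upperZetaZeros => (zetaMult ρ : ℝ) * ‖zeroTau ρ ^ 2‖ ^ (-p) := by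
  refine (summable_zetaMult_div (q := 2 * p) (by linarith)).congr fun ρ => ?_
  rw [norm_pow, ← Real.rpow_natCast, ← Real.rpow_mul (norm_nonneg _), div_eq_mul_inv,
    ← Real.rpow_neg (norm_nonneg _)]
  congr 2
  push_cast
  ring

/-- The series `∑ τ ^ (-2 σ)`. -/
noncomputable def zeroSeries (σ : ℂ) : ℂ :=
  ∑' ρ : upperZetaZeros, (zetaMult ρ : ℂ) * (zeroTau ρ ^ 2) ^ (-σ)

theorem hasSum_zeroSeries {σ : ℂ} (hσ : 1 / 2 < σ.re) :
    HasSum (fun ρ : upperZetaZeros => (zetaMult ρ : ℂ) * (zeroTau ρ ^ 2) ^ (-σ)) (zeroSeries σ) :=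
  (summable_norm_mul_cpow_neg (fun _ => summable_zetaMult_sq_rpow) hσ).of_norm.hasSum

theorem analyticAt_zeroSeries {σ : ℂ} (hσ : 1 / 2 < σ.re) : AnalyticAt ℂ zeroSeries σ := by
  rw [Complex.analyticAt_iff_eventually_differentiableAt]
  filter_upwards [(isOpen_lt continuous_const Complex.continuous_re).mem_nhds hσ] with z hz
  exact differentiableAt_tsum_mul_cpow_neg (fun ρ => pow_ne_zero 2 (zeroTau_ne_zero ρ))
    (fun _ => summable_zetaMult_sq_rpow) hz

theorem Gamma_mul_Gamma_two_sub {σ : ℂ} (h1 : 1 / 2 < σ.re) (h2 : σ.re < 1) :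
    Complex.sin (Real.pi * σ) ≠ 0 ∧ Complex.cos (Real.pi * σ) ≠ 0 ∧
    Complex.Gamma (2 - 2 * σ) * Complex.Gamma (2 * σ) =
      (1 - 2 * σ) * Real.pi / (2 * Complex.sin (Real.pi * σ) * Complex.cos (Real.pi * σ)) := by
  have hne : 1 - 2 * σ ≠ 0 := fun h => by
    have := congrArg Complex.re h
    simp at this
    linarith
  have hG := Complex.Gamma_mul_Gamma_one_sub (2 * σ)
  have hs : Complex.sin (Real.pi * (2 * σ)) = 2 * Complex.sin (Real.pi * σ) *
      Complex.cos (Real.pi * σ) := by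
    rw [← Complex.sin_two_mul]; ring_nf
  have hG1 : Complex.Gamma (2 * σ) ≠ 0 := Complex.Gamma_ne_zero_of_re_pos (by simp; linarith)
  have hG2 : Complex.Gamma (1 - 2 * σ) ≠ 0 := Complex.Gamma_ne_zero fun n h => by
    have h3 := congrArg Complex.re h
    simp at h3
    have h4 : (n : ℝ) < 1 := by linarith
    have h5 : n = 0 := by
      have : n < 1 := by exact_mod_cast h4
      omega
    rw [h5] at h3
    simp at h3
    linarith
  -- Since division by zero yields 0, a vanishing sine would make the reflection formula equate a
  -- product of nonzero Gamma values with 0.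
  have hne2 : Complex.sin (Real.pi * (2 * σ)) ≠ 0 := fun h => by
    rw [h, div_zero] at hG
    exact mul_ne_zero hG1 hG2 hG
  rw [hs] at hne2 hG
  refine ⟨fun h => hne2 (by rw [h]; ring), fun h => hne2 (by rw [h]; ring), ?_⟩
  have e : (2 - 2 * σ : ℂ) = (1 - 2 * σ) + 1 := by ring
  rw [e, Complex.Gamma_add_one _ hne, mul_assoc, mul_comm (Complex.Gamma (1 - 2 * σ)), hG]
  ring

/-- The cosine from the pair `±iτ` cancels one factor of `sin(2πσ)` in the reflection formula,
leaving `sin(πσ)`. -/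
theorem zeroSeries_eq_mellin {σ : ℂ} (h1 : 1 / 2 < σ.re) (h2 : σ.re < 1) :
    zeroSeries σ = mellin xiLogDeriv₂ (2 - 2 * σ) * Complex.sin (Real.pi * σ) /
      (Real.pi * (2 * σ - 1)) := by
  obtain ⟨hs, hc, hG⟩ := Gamma_mul_Gamma_two_sub h1 h2
  have hne : 2 * σ - 1 ≠ 0 := fun h => by
    have := congrArg Complex.re h
    simp at this
    linarith
  have hπ : (Real.pi : ℂ) ≠ 0 := by exact_mod_cast Real.pi_ne_zero
  have h := (hasSum_mellin_xiLogDeriv₂ h1 h2).unique ((hasSum_zeroSeries h1).mul_right _)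
  rw [h, mul_assoc (-(2 * Complex.cos (Real.pi * σ))), hG]
  field_simp
  ring

end ZeroSeries

/-! ### The double pole at `1/2`. -/

section NearHalf

open MeasureTheory Set

/-- The Mellin transform of `xiLogDeriv₂`, with its main term `1 / (2 x)` at infinity removed. -/
noncomputable def mellinReg (s : ℂ) : ℂ :=
  mellin (indicator (Ioc 0 1) xiLogDeriv₂) s +
    mellin (indicator (Ioi 1) fun x => xiLogDeriv₂ x - 1 / (2 * x)) s

theorem continuousOn_xiLogDeriv₂_sub :
    ContinuousOn (fun x : ℝ => xiLogDeriv₂ x - 1 / (2 * x)) (Ici 1) := by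
  refine continuous_xiLogDeriv₂.continuousOn.sub
    (continuousOn_const.div (by fun_prop) fun x hx => ?_)
  have : (0 : ℝ) < x := lt_of_lt_of_le one_pos hx
  simpa using this.ne'

theorem differentiableAt_mellinReg {s : ℂ} (h0 : 0 < s.re) (h2 : s.re < 2) :
    DifferentiableAt ℂ mellinReg s := by
  obtain ⟨C, -, hC⟩ := exists_norm_xiLogDeriv₂_sub_le
  exact (mellin_indicator_Ioc continuous_xiLogDeriv₂.continuousOn h0).2.add
    (mellin_indicator_Ioi continuousOn_xiLogDeriv₂_sub (C := C) (a := 2)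
      (fun x hx => by rw [Real.rpow_two]; exact hC x hx) h2).2

theorem mellin_xiLogDeriv₂ {s : ℂ} (h0 : 0 < s.re) (h1 : s.re < 1) :
    HasMellin xiLogDeriv₂ s (mellinReg s + 1 / (2 * (1 - s))) := by
  obtain ⟨C, -, hC⟩ := exists_norm_xiLogDeriv₂_sub_le
  exact hasMellin_of_norm_sub_le continuous_xiLogDeriv₂.continuousOn hC h0 h1

/-- At `s = 1` the weight is 1 and both integrands are derivatives: of `ξ'/ξ` on `(0, 1]`, and of
`ξ'/ξ - ½ log x` beyond 1. The values at 1 cancel, the value at the origin is 0 by symmetry, and the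
limit at infinity remains. -/
theorem mellinReg_one : mellinReg 1 = ((-(1 / 2) * Real.log (2 * Real.pi) : ℝ) : ℂ) := by
  obtain ⟨C, -, hC⟩ := exists_norm_xiLogDeriv₂_sub_le
  have hind : ∀ {S : Set ℝ} (f : ℝ → ℂ), MeasurableSet S → S ⊆ Ioi 0 →
      mellin (indicator S f) 1 = ∫ x in S, f x := by
    intro S f hS hS'
    rw [mellin]
    simp only [sub_self, Complex.cpow_zero, one_smul]
    rw [setIntegral_indicator hS, inter_eq_right.2 hS']
  have e1 : ∫ x in Ioc (0 : ℝ) 1, xiLogDeriv₂ x = logDeriv riemannXi (1 / 2 + (1 : ℝ)) := by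
    rw [← intervalIntegral.integral_of_le zero_le_one,
      intervalIntegral.integral_eq_sub_of_hasDerivAt
        (fun x _ => hasDerivAt_logDeriv_riemannXi x)
        (continuous_xiLogDeriv₂.intervalIntegrable _ _),
      Complex.ofReal_zero, add_zero, logDeriv_riemannXi_half, sub_zero]
  have e2 : ∫ x in Ioi (1 : ℝ), (xiLogDeriv₂ x - 1 / (2 * x)) =
      ((-(1 / 2) * Real.log (2 * Real.pi) : ℝ) : ℂ) - (logDeriv riemannXi (1 / 2 + (1 : ℝ)) -
        ((1 / 2 * Real.log 1 : ℝ) : ℂ)) := by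
    refine integral_Ioi_of_hasDerivAt_of_tendsto' (fun x hx => ?_) ?_
      tendsto_logDeriv_riemannXi_sub_log
    · have hx : (0 : ℝ) < x := lt_of_lt_of_le one_pos hx
      have h1 := ((Real.hasDerivAt_log hx.ne').const_mul (1 / 2)).ofReal_comp
      refine ((hasDerivAt_logDeriv_riemannXi x).sub h1).congr_deriv ?_
      push_cast
      ring
    · have h := (mellin_indicator_Ioi continuousOn_xiLogDeriv₂_sub (C := C) (a := 2) (s := 1)
        (fun x hx => by rw [Real.rpow_two]; exact hC x hx) (by simp)).1
      rw [MellinConvergent] at h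
      simp only [sub_self, Complex.cpow_zero, one_smul] at h
      rw [IntegrableOn, integrable_indicator_iff measurableSet_Ioi, IntegrableOn,
        Measure.restrict_restrict measurableSet_Ioi, Ioi_inter_Ioi, sup_of_le_left zero_le_one] at h
      exact h
  rw [mellinReg, hind _ measurableSet_Ioc Ioc_subset_Ioi_self,
    hind _ measurableSet_Ioi (Ioi_subset_Ioi zero_le_one), e1, e2, Real.log_one]
  push_cast
  ring

/-- The continuation of the series `zeroSeries` to the strip `0 < Re σ < 1`. -/
noncomputable def nearHalf (σ : ℂ) : ℂ :=
  (mellinReg (2 - 2 * σ) + 1 / (2 * (2 * σ - 1))) * Complex.sin (Real.pi * σ) /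
    (Real.pi * (2 * σ - 1))

theorem zeroSeries_eq_nearHalf {σ : ℂ} (h1 : 1 / 2 < σ.re) (h2 : σ.re < 1) :
    zeroSeries σ = nearHalf σ := by
  have h0' : 0 < (2 - 2 * σ).re := by simp; linarith
  have h1' : (2 - 2 * σ).re < 1 := by simp; linarith
  rw [zeroSeries_eq_mellin h1 h2, (mellin_xiLogDeriv₂ h0' h1').2, nearHalf,
    show 1 - (2 - 2 * σ) = 2 * σ - 1 by ring]

theorem meromorphicAt_nearHalf {σ : ℂ} (h0 : 0 < σ.re) (h1 : σ.re < 1) :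
    MeromorphicAt nearHalf σ := by
  have hA : AnalyticAt ℂ (fun σ => mellinReg (2 - 2 * σ)) σ := by
    rw [Complex.analyticAt_iff_eventually_differentiableAt]
    have hU : IsOpen {z : ℂ | 0 < z.re ∧ z.re < 1} :=
      (isOpen_lt continuous_const Complex.continuous_re).inter
        (isOpen_lt Complex.continuous_re continuous_const)
    filter_upwards [hU.mem_nhds ⟨h0, h1⟩] with z hz
    obtain ⟨hz0, hz1⟩ := hz
    have h := differentiableAt_mellinReg (s := 2 - 2 * z) (by simp; linarith) (by simp; linarith)
    exact DifferentiableAt.comp (f := fun z : ℂ => 2 - 2 * z) z h (by fun_prop)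
  have hlin : AnalyticAt ℂ (fun σ : ℂ => 2 * σ - 1) σ := by fun_prop
  have hsin : AnalyticAt ℂ (fun σ : ℂ => Complex.sin (Real.pi * σ)) σ :=
    Differentiable.analyticAt (by fun_prop) _
  exact ((hA.meromorphicAt.add ((MeromorphicAt.const 1 σ).div
    ((MeromorphicAt.const 2 σ).mul hlin.meromorphicAt))).mul hsin.meromorphicAt).div
      ((MeromorphicAt.const (Real.pi : ℂ) σ).mul hlin.meromorphicAt)

/-- At `1/2 + ε` the function is `(mellinReg(1 - 2ε) + 1/(4ε)) cos(πε)/(2πε)`. As the cosine is `1 +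
O(ε²)`, the second summand gives `1/(8πε²)` with no `1/ε` part, and the first gives the residue
`mellinReg 1 / (2π)`. -/
theorem nearHalf_laurent : ∃ g : ℂ → ℂ, AnalyticAt ℂ g 0 ∧ ∀ᶠ ε in 𝓝[≠] (0 : ℂ),
    nearHalf (1 / 2 + ε) = ((1 / (8 * Real.pi) : ℝ) : ℂ) * (ε ^ 2)⁻¹ +
      ((-(Real.log (2 * Real.pi) / (4 * Real.pi)) : ℝ) : ℂ) * ε⁻¹ + g ε := by
  have hπ : (Real.pi : ℂ) ≠ 0 := by exact_mod_cast Real.pi_ne_zero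
  set k : ℂ → ℂ := fun ε => Complex.cos (Real.pi * ε) with hk
  set q : ℂ → ℂ := fun ε => mellinReg (1 - 2 * ε) * k ε with hq
  have hkA : AnalyticAt ℂ k 0 := Differentiable.analyticAt (by fun_prop) _
  have hqA : AnalyticAt ℂ q 0 := by
    refine AnalyticAt.mul ?_ hkA
    rw [Complex.analyticAt_iff_eventually_differentiableAt]
    have hU : IsOpen {z : ℂ | -(1 / 2) < z.re ∧ z.re < 1 / 2} :=
      (isOpen_lt continuous_const Complex.continuous_re).inter
        (isOpen_lt Complex.continuous_re continuous_const)
    filter_upwards [hU.mem_nhds (x := 0) ⟨by simp, by simp⟩] with z hz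
    obtain ⟨hz0, hz1⟩ := hz
    have h := differentiableAt_mellinReg (s := 1 - 2 * z) (by simp; linarith) (by simp; linarith)
    exact DifferentiableAt.comp (f := fun z : ℂ => 1 - 2 * z) z h (by fun_prop)
  have hk0 : k 0 = 1 := by simp [hk]
  have hk1 : dslope k 0 0 = 0 := by
    rw [dslope_same]
    have := ((hasDerivAt_id (0 : ℂ)).const_mul (Real.pi : ℂ)).ccos
    simpa using this.deriv
  have hq0 : q 0 = ((-(1 / 2) * Real.log (2 * Real.pi) : ℝ) : ℂ) := by
    simp only [hq, hk0, mul_zero, sub_zero, mul_one]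
    exact mellinReg_one
  have hds : ∀ {f : ℂ → ℂ}, AnalyticAt ℂ f 0 → AnalyticAt ℂ (dslope f 0) 0 := fun {f} hf => by
    obtain ⟨p, hp⟩ := hf
    exact ⟨_, hp.has_fpower_series_dslope_fslope⟩
  refine ⟨fun ε => dslope q 0 ε / (2 * Real.pi) + dslope (dslope k 0) 0 ε / (8 * Real.pi),
    ((hds hqA).div_const).add ((hds (hds hkA)).div_const), ?_⟩
  filter_upwards [self_mem_nhdsWithin] with ε hε
  have hε : ε ≠ 0 := hε
  have hsin : Complex.sin (Real.pi * (1 / 2 + ε)) = k ε := by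
    rw [hk, mul_add, mul_one_div, add_comm, Complex.sin_add_pi_div_two]
  have e1 : mellinReg (2 - 2 * (1 / 2 + ε)) * k ε = q 0 + ε * dslope q 0 ε := by
    have h1 := sub_smul_dslope q 0 ε
    rw [smul_eq_mul, sub_zero] at h1
    rw [h1, show (2 : ℂ) - 2 * (1 / 2 + ε) = 1 - 2 * ε by ring]
    simp [hq]
  have e2 : k ε = 1 + ε * (ε * dslope (dslope k 0) 0 ε) := by
    have h1 := sub_smul_dslope k 0 ε
    have h2 := sub_smul_dslope (dslope k 0) 0 ε
    rw [smul_eq_mul, sub_zero] at h1 h2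
    rw [h2, hk1, sub_zero, h1, hk0]
    ring
  have e3 : (2 : ℂ) * (1 / 2 + ε) - 1 = 2 * ε := by ring
  rw [nearHalf, hsin, add_mul, e1, e3, hq0]
  conv_lhs => rw [e2]
  push_cast
  field_simp
  ring

end NearHalf

/-! ### Continuation to `Re σ < 1` and the poles at `1/2 - j`. -/

section Continuation

open MeasureTheory Set HurwitzZeta

/-- The part of the Mellin transform of `xiLogDeriv₂` which is regular for `Re σ < 1`. -/
noncomputable def mellinRest (σ : ℂ) : ℂ :=
  mellin (indicator (Ioc 0 1) fun x => xiLogDeriv₂ x - gammaPart x) (2 - 2 * σ) +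
    mellin (indicator (Ioi 1) fun x : ℝ => deriv (logDeriv riemannZeta) ((1 / 2 + x : ℝ) : ℂ))
      (2 - 2 * σ)

theorem mellinConvergent_rest :
    (∀ s : ℂ, 0 < s.re →
      MellinConvergent (indicator (Ioc 0 1) fun x => xiLogDeriv₂ x - gammaPart x) s ∧
      DifferentiableAt ℂ (mellin (indicator (Ioc 0 1) fun x => xiLogDeriv₂ x - gammaPart x)) s) ∧
    (∀ s : ℂ, MellinConvergent (indicator (Ioi 1)
        fun x : ℝ => deriv (logDeriv riemannZeta) ((1 / 2 + x : ℝ) : ℂ)) s ∧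
      DifferentiableAt ℂ (mellin (indicator (Ioi 1)
        fun x : ℝ => deriv (logDeriv riemannZeta) ((1 / 2 + x : ℝ) : ℂ))) s) := by
  refine ⟨fun s hs => mellin_indicator_Ioc (continuous_xiLogDeriv₂.continuousOn.sub
    (continuousOn_gammaPart.mono Icc_subset_Ici_self)) hs, fun s => ?_⟩
  obtain ⟨C, hC0, hC⟩ := exists_norm_zetaPart_le
  obtain ⟨n, hn⟩ := exists_nat_gt s.re
  obtain ⟨D, hD0, hD⟩ := exists_two_rpow_neg_le n
  refine mellin_indicator_Ioi (C := C * D) (a := n) ?_ (fun x hx => ?_) hn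
  · intro x hx
    have hx : 1 ≤ x := hx
    refine ContinuousAt.continuousWithinAt ?_
    exact ContinuousAt.comp (f := fun x : ℝ => ((1 / 2 + x : ℝ) : ℂ))
      (analyticAt_logDeriv_riemannZeta (by rw [Complex.ofReal_re]; linarith)).deriv.continuousAt
      (by fun_prop)
  · rw [Real.rpow_natCast, mul_div_assoc]
    exact (hC x hx).2.trans (mul_le_mul_of_nonneg_left (hD x hx) hC0)

theorem analyticAt_mellinRest {σ : ℂ} (hσ : σ.re < 1) : AnalyticAt ℂ mellinRest σ := by
  rw [Complex.analyticAt_iff_eventually_differentiableAt]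
  filter_upwards [(isOpen_lt Complex.continuous_re continuous_const).mem_nhds hσ] with z hz
  have hz : z.re < 1 := hz
  have hd : DifferentiableAt ℂ (fun z : ℂ => 2 - 2 * z) z := by fun_prop
  exact (DifferentiableAt.comp (f := fun z : ℂ => 2 - 2 * z) z
      (mellinConvergent_rest.1 _ (by simp; linarith)).2 hd).add
    (DifferentiableAt.comp (f := fun z : ℂ => 2 - 2 * z) z (mellinConvergent_rest.2 _).2 hd)

/-- `gammaPart` is subtracted on the whole half-line and the difference is cut at 1; beyond 1 only
the inverse squares and the `ζ'/ζ` term are left. -/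
theorem mellin_xiLogDeriv₂_eq_rest {σ : ℂ} (h1 : 1 / 2 < σ.re) (h2 : σ.re < 1) :
    mellin xiLogDeriv₂ (2 - 2 * σ) = mellin gammaPart (2 - 2 * σ) + mellinRest σ -
      ∑' k : ℕ, 2 * (2 * k + 1) * (1 / 4) ^ k / (2 * k + 2 - (2 - 2 * σ)) := by
  set s : ℂ := 2 - 2 * σ with hs
  have h0' : 0 < s.re := by simp [hs]; linarith
  have h1' : s.re < 1 := by simp [hs]; linarith
  have hF := (mellin_xiLogDeriv₂ h0' h1').1
  have hΓ : MellinConvergent gammaPart s := (hasMellin_of_norm_sub_le (C := 2)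
    continuousOn_gammaPart (fun x hx => norm_gammaPart_sub_le (by linarith)) h0' h1').1
  have hI := mellinConvergent_rest.1 s h0'
  have hJ := mellin_indicator_inv_sq_add_inv_sq (s := s) (by linarith)
  have htail := hasMellin_sub (mellinConvergent_rest.2 s).1 hJ.1
  have e : (fun t => indicator (Ioi 1)
        (fun x : ℝ => deriv (logDeriv riemannZeta) ((1 / 2 + x : ℝ) : ℂ)) t -
      indicator (Ioi 1) (fun x : ℝ => 1 / ((x : ℂ) + 1 / 2) ^ 2 + 1 / ((x : ℂ) - 1 / 2) ^ 2) t) =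
      indicator (Ioi 1) fun x => xiLogDeriv₂ x - gammaPart x := by
    ext t
    by_cases h : t ∈ Ioi (1 : ℝ)
    · have ht : 1 < t := h
      simp only [indicator_of_mem h]
      rw [xiLogDeriv₂_eq (by linarith)]
      ring
    · simp only [indicator_of_notMem h, sub_zero]
  rw [e] at htail
  have hM := mellin_eq_add_indicator hI.1 htail.1
  have hsub := hasMellin_sub hF hΓ
  have h3 := hM.2
  rw [hsub.2, htail.2, hJ.2] at h3
  rw [mellinRest, ← hs]
  linear_combination h3

/-- The continuation of the series `zeroSeries` to the half-plane `Re σ < 1`. -/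
noncomputable def leftCont (σ : ℂ) : ℂ :=
  -((2 : ℂ) ^ (-(2 * σ)) * hurwitzZeta ((1 / 4 : ℝ) : UnitAddCircle) (2 * σ)) /
      (2 * Complex.cos (Real.pi * σ)) +
    (Complex.sin (Real.pi * σ) * mellinRest σ - poleSeries σ) / (Real.pi * (2 * σ - 1))

theorem zeroSeries_eq_leftCont {σ : ℂ} (h1 : 1 / 2 < σ.re) (h2 : σ.re < 1) :
    zeroSeries σ = leftCont σ := by
  obtain ⟨hs, hc, hG⟩ := Gamma_mul_Gamma_two_sub h1 h2
  have hne : 2 * σ - 1 ≠ 0 := fun h => by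
    have := congrArg Complex.re h
    simp at this
    linarith
  have hπ : (Real.pi : ℂ) ≠ 0 := by exact_mod_cast Real.pi_ne_zero
  rw [zeroSeries_eq_mellin h1 h2, mellin_xiLogDeriv₂_eq_rest h1 h2, mellin_gammaPart h1 h2,
    leftCont, poleSeries_eq (by linarith), hG]
  generalize Complex.sin (Real.pi * σ) = S at *
  generalize Complex.cos (Real.pi * σ) = K at *
  generalize ∑' k : ℕ, (2 * (2 * k + 1) * (1 / 4) ^ k / (2 * k + 2 - (2 - 2 * σ)) : ℂ) = J
  field_simp
  ring

theorem analyticAt_two_cpow (σ : ℂ) : AnalyticAt ℂ (fun σ : ℂ => (2 : ℂ) ^ (-(2 * σ))) σ := by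
  refine Differentiable.analyticAt (fun z => ?_) _
  exact DifferentiableAt.const_cpow (by fun_prop) (Or.inl two_ne_zero)

theorem analyticAt_hurwitzZeta_two_mul (a : UnitAddCircle) {σ : ℂ} (hσ : σ ≠ 1 / 2) :
    AnalyticAt ℂ (fun σ => hurwitzZeta a (2 * σ)) σ := by
  rw [Complex.analyticAt_iff_eventually_differentiableAt]
  filter_upwards [isOpen_compl_singleton.mem_nhds (show σ ∈ ({1 / 2}ᶜ : Set ℂ) from hσ)] with z hz
  refine DifferentiableAt.comp (f := fun z : ℂ => 2 * z) z
    (differentiableAt_hurwitzZeta a fun h => hz ?_) (by fun_prop)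
  rw [mem_singleton_iff]
  linear_combination h / 2

/-- At the pole, subtracting the explicit `1 / ((s - 1) Gammaℝ s)` leaves a function differentiable
near 1. -/
theorem meromorphicAt_hurwitzZeta_two_mul (a : UnitAddCircle) (σ : ℂ) :
    MeromorphicAt (fun σ => hurwitzZeta a (2 * σ)) σ := by
  by_cases hσ : σ = 1 / 2
  · have hG : AnalyticAt ℂ (fun s : ℂ => (Complex.Gammaℝ s)⁻¹) 1 :=
      Complex.differentiable_Gammaℝ_inv.analyticAt 1
    have h1 : MeromorphicAt (fun s => hurwitzZeta a s - 1 / (s - 1) / Complex.Gammaℝ s) 1 := by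
      refine AnalyticAt.meromorphicAt ?_
      rw [Complex.analyticAt_iff_eventually_differentiableAt]
      rw [eventually_iff_exists_mem]
      refine ⟨{z : ℂ | 0 < z.re}, (isOpen_lt continuous_const Complex.continuous_re).mem_nhds
        (by simp), fun z hz => ?_⟩
      have hz : 0 < z.re := hz
      by_cases h : z = 1
      · rw [h]; exact differentiableAt_hurwitzZeta_sub_one_div a
      · have h5 : DifferentiableAt ℂ (fun s : ℂ => (s - 1)⁻¹) z :=
          (differentiableAt_id.sub_const 1).inv (sub_ne_zero.2 h)
        have h6 : DifferentiableAt ℂ (fun s : ℂ => 1 / (s - 1) / Complex.Gammaℝ s) z := by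
          simp only [div_eq_mul_inv, one_mul]
          exact h5.mul (Complex.differentiable_Gammaℝ_inv z)
        exact (differentiableAt_hurwitzZeta a h).sub h6
    have h2 : MeromorphicAt (fun s : ℂ => 1 / (s - 1) / Complex.Gammaℝ s) 1 := by
      simp only [div_eq_mul_inv]
      refine MeromorphicAt.mul (MeromorphicAt.mul (MeromorphicAt.const _ _) ?_) hG.meromorphicAt
      exact (MeromorphicAt.sub (MeromorphicAt.id _) (MeromorphicAt.const _ _)).inv
    have h3 : MeromorphicAt (hurwitzZeta a) 1 := by
      refine (h1.add h2).congr (Eventually.of_forall fun s => ?_)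
      simp
    have h4 : (fun σ : ℂ => 2 * σ) (1 / 2) = 1 := by norm_num
    rw [hσ]
    rw [← h4] at h3
    exact h3.comp_analyticAt (f := hurwitzZeta a) (by fun_prop)
  · exact (analyticAt_hurwitzZeta_two_mul a hσ).meromorphicAt

theorem analyticAt_cos_pi_mul (σ : ℂ) : AnalyticAt ℂ (fun σ : ℂ => Complex.cos (Real.pi * σ)) σ :=
  Differentiable.analyticAt (by fun_prop) _

theorem analyticAt_sin_pi_mul (σ : ℂ) : AnalyticAt ℂ (fun σ : ℂ => Complex.sin (Real.pi * σ)) σ :=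
  Differentiable.analyticAt (by fun_prop) _

theorem meromorphicAt_leftCont {σ : ℂ} (hσ : σ.re < 1) : MeromorphicAt leftCont σ := by
  have hlin : AnalyticAt ℂ (fun σ : ℂ => 2 * σ - 1) σ := by fun_prop
  exact (((analyticAt_two_cpow σ).meromorphicAt.mul
      (meromorphicAt_hurwitzZeta_two_mul _ σ)).neg.div
      ((MeromorphicAt.const 2 σ).mul (analyticAt_cos_pi_mul σ).meromorphicAt)).add
    ((((analyticAt_sin_pi_mul σ).mul (analyticAt_mellinRest hσ)).sub
      (differentiable_poleSeries.analyticAt σ)).meromorphicAt.div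
        ((MeromorphicAt.const (Real.pi : ℂ) σ).mul hlin.meromorphicAt))

theorem analyticAt_rest_div {σ : ℂ} (hσ : σ.re < 1) (hne : σ ≠ 1 / 2) :
    AnalyticAt ℂ (fun σ => (Complex.sin (Real.pi * σ) * mellinRest σ - poleSeries σ) /
      (Real.pi * (2 * σ - 1))) σ := by
  have hlin : AnalyticAt ℂ (fun σ : ℂ => (Real.pi : ℂ) * (2 * σ - 1)) σ := by fun_prop
  refine (((analyticAt_sin_pi_mul σ).mul (analyticAt_mellinRest hσ)).sub
      (differentiable_poleSeries.analyticAt σ)).div hlin ?_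
  refine mul_ne_zero (by exact_mod_cast Real.pi_ne_zero) fun h => hne ?_
  linear_combination h / 2

theorem analyticAt_leftCont {σ : ℂ} (hσ : σ.re < 1) (hne : ∀ m : ℕ, σ ≠ 1 / 2 - m) :
    AnalyticAt ℂ leftCont σ := by
  have hne0 : σ ≠ 1 / 2 := by simpa using hne 0
  -- The cosine vanishes at the half-odd integers, and those with real part below 1 are exactly the
  -- excluded points `1/2 - n`.
  have hcos : Complex.cos (Real.pi * σ) ≠ 0 := fun h => by
    obtain ⟨k, hk⟩ := Complex.cos_eq_zero_iff.1 h
    have hπ : (Real.pi : ℂ) ≠ 0 := by exact_mod_cast Real.pi_ne_zero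
    have h1 : σ = (2 * k + 1) / 2 := by
      refine mul_left_cancel₀ hπ ?_
      rw [hk]; ring
    have h2 : σ.re = (2 * k + 1) / 2 := by
      rw [h1]
      have : ((2 * k + 1) / 2 : ℂ) = (((2 * k + 1) / 2 : ℝ) : ℂ) := by push_cast; rfl
      rw [this, Complex.ofReal_re]
    have h3 : (k : ℝ) < 1 := by linarith
    have h4 : k ≤ 0 := by
      have : k < 1 := by exact_mod_cast h3
      omega
    obtain ⟨n, hn⟩ := Int.eq_ofNat_of_zero_le (show 0 ≤ -k by omega)
    refine hne n ?_
    have h5 : (n : ℂ) = -(k : ℂ) := by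
      have : ((n : ℤ) : ℂ) = ((-k : ℤ) : ℂ) := by rw [hn]
      push_cast at this
      exact this
    rw [h1, h5]
    ring
  refine AnalyticAt.add ?_ (analyticAt_rest_div hσ hne0)
  exact ((analyticAt_two_cpow σ).mul (analyticAt_hurwitzZeta_two_mul _ hne0)).neg.div
    (analyticAt_const.mul (analyticAt_cos_pi_mul σ)) (mul_ne_zero two_ne_zero hcos)

theorem analyticAt_dslope {f : ℂ → ℂ} {z : ℂ} (hf : AnalyticAt ℂ f z) :
    AnalyticAt ℂ (dslope f z) z := by
  obtain ⟨p, hp⟩ := hf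
  exact ⟨_, hp.has_fpower_series_dslope_fslope⟩

theorem sinDiv_zero : sinDiv 0 = Real.pi := by
  rw [sinDiv, dslope_same]
  have := ((hasDerivAt_id (0 : ℂ)).const_mul (Real.pi : ℂ)).csin
  simpa using this.deriv

/-- At `1/2 - j + ε` the cosine is `-(-1)^j sin(πε)`, so the Hurwitz term alone is singular. The
residue is `φ(0) = (-1)^j 2^(2j-1) / (2π)` times the Hurwitz value at `1 - 2j`. -/
theorem leftCont_laurent {j : ℕ} (hj : 1 ≤ j) : ∃ g : ℂ → ℂ, AnalyticAt ℂ g 0 ∧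
    ∀ᶠ ε in 𝓝[≠] (0 : ℂ), leftCont (1 / 2 - j + ε) = (zetaResidue j : ℂ) * ε⁻¹ + g ε := by
  have hπ : (Real.pi : ℂ) ≠ 0 := by exact_mod_cast Real.pi_ne_zero
  set σ₀ : ℂ := 1 / 2 - j with hσ₀
  have hj0 : (j : ℂ) ≠ 0 := by exact_mod_cast (by omega : j ≠ 0)
  have hσne : σ₀ ≠ 1 / 2 := fun h => hj0 (by linear_combination hσ₀ - h)
  have hσre : σ₀.re < 1 := by
    simp [hσ₀]
    linarith [(j.cast_nonneg : (0 : ℝ) ≤ j)]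
  have hshift : ∀ {f : ℂ → ℂ}, AnalyticAt ℂ f σ₀ → AnalyticAt ℂ (fun ε => f (σ₀ + ε)) 0 := by
    intro f hf
    have : AnalyticAt ℂ f ((fun ε : ℂ => σ₀ + ε) 0) := by simpa using hf
    exact AnalyticAt.comp (f := fun ε : ℂ => σ₀ + ε) this (by fun_prop)
  set φ : ℂ → ℂ := fun ε => (-1) ^ j * ((2 : ℂ) ^ (-(2 * (σ₀ + ε))) *
    hurwitzZeta ((1 / 4 : ℝ) : UnitAddCircle) (2 * (σ₀ + ε))) / (2 * sinDiv ε) with hφ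
  have hφA : AnalyticAt ℂ φ 0 := by
    refine AnalyticAt.div (analyticAt_const.mul (hshift ((analyticAt_two_cpow σ₀).mul
      (analyticAt_hurwitzZeta_two_mul _ hσne))))
      (analyticAt_const.mul (differentiable_sinDiv.analyticAt 0)) ?_
    rw [sinDiv_zero]
    exact mul_ne_zero two_ne_zero hπ
  have hφ0 : φ 0 = zetaResidue j := by
    have e1 : 2 * (σ₀ + 0) = 1 - 2 * (j : ℂ) := by rw [hσ₀]; ring
    have e2 : (2 : ℂ) ^ (-(1 - 2 * (j : ℂ))) = 2 ^ (2 * (j : ℤ)) / 2 := by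
      rw [show (-(1 - 2 * (j : ℂ))) = ((2 * (j : ℤ) - 1 : ℤ) : ℂ) by push_cast; ring,
        Complex.cpow_intCast, zpow_sub₀ two_ne_zero, zpow_one]
    simp only [hφ]
    rw [e1, hurwitzZeta_quarter_one_sub hj, sinDiv_zero, e2, zetaResidue, zpow_neg]
    have hP : (2 : ℂ) ^ (2 * (j : ℤ)) ≠ 0 := zpow_ne_zero _ two_ne_zero
    push_cast
    field_simp
    ring
  refine ⟨fun ε => dslope φ 0 ε +
    (Complex.sin (Real.pi * (σ₀ + ε)) * mellinRest (σ₀ + ε) - poleSeries (σ₀ + ε)) /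
      (Real.pi * (2 * (σ₀ + ε) - 1)),
    (analyticAt_dslope hφA).add (hshift (analyticAt_rest_div hσre hσne)), ?_⟩
  filter_upwards [self_mem_nhdsWithin] with ε hε
  have hε : ε ≠ 0 := hε
  have hcos : Complex.cos (Real.pi * (σ₀ + ε)) = -((-1) ^ j * (ε * sinDiv ε)) := by
    have e1 : (Real.pi : ℂ) * (σ₀ + ε) = (Real.pi * ε + Real.pi / 2) - j * Real.pi := by
      rw [hσ₀]; ring
    rw [e1, Complex.cos_antiperiodic.sub_nat_mul_eq, Complex.cos_add_pi_div_two, sinDiv_of_ne hε]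
    field_simp
  have h1 := sub_smul_dslope φ 0 ε
  rw [smul_eq_mul, sub_zero, hφ0] at h1
  have h2 : dslope φ 0 ε = (φ ε - zetaResidue j) / ε := by
    rw [← h1]; field_simp
  have h3 : ((-1 : ℂ) ^ j)⁻¹ = (-1) ^ j := by
    rw [← inv_pow, inv_neg, inv_one]
  have h4 : -((2 : ℂ) ^ (-(2 * (σ₀ + ε))) *
      hurwitzZeta ((1 / 4 : ℝ) : UnitAddCircle) (2 * (σ₀ + ε))) /
      (2 * -((-1) ^ j * (ε * sinDiv ε))) = φ ε / ε := by
    simp only [hφ]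
    rw [div_div, mul_neg, neg_div_neg_eq, mul_left_comm 2, mul_comm ((-1 : ℂ) ^ j) (2 * _),
      ← div_div, div_eq_mul_inv _ ((-1 : ℂ) ^ j), h3]
    ring
  rw [leftCont, hcos, h4, h2]
  ring

end Continuation

/-! ### The unshifted continuation on the whole plane. -/

section ZeroZeta

open Classical in
/-- The meromorphic continuation of the series `zeroSeries` to the plane. -/
noncomputable def zeroZeta (σ : ℂ) : ℂ := if 1 / 2 < σ.re then zeroSeries σ else leftCont σ

theorem zeroZeta_of_lt {σ : ℂ} (h : 1 / 2 < σ.re) : zeroZeta σ = zeroSeries σ := if_pos h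

theorem zeroZeta_eq_leftCont {σ : ℂ} (h : σ.re < 1) : zeroZeta σ = leftCont σ := by
  by_cases h2 : 1 / 2 < σ.re
  · rw [zeroZeta_of_lt h2, zeroSeries_eq_leftCont h2 h]
  · exact if_neg h2

theorem hasSum_zeroZeta {σ : ℂ} (hσ : 1 / 2 < σ.re) :
    HasSum (fun ρ : upperZetaZeros => (zetaMult ρ : ℂ) * (zeroTau ρ ^ 2) ^ (-σ)) (zeroZeta σ) := by
  rw [zeroZeta_of_lt hσ]
  exact hasSum_zeroSeries hσ

theorem zeroZeta_eventuallyEq_leftCont {σ : ℂ} (h : σ.re < 1) : zeroZeta =ᶠ[𝓝 σ] leftCont := by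
  filter_upwards [(isOpen_lt Complex.continuous_re continuous_const).mem_nhds h] with z hz
  exact zeroZeta_eq_leftCont hz

theorem analyticAt_zeroZeta {σ : ℂ} (hσ : ∀ m : ℕ, σ ≠ 1 / 2 - m) : AnalyticAt ℂ zeroZeta σ := by
  rcases lt_or_ge (1 / 2) σ.re with h | h
  · refine (analyticAt_zeroSeries h).congr ?_
    filter_upwards [(isOpen_lt continuous_const Complex.continuous_re).mem_nhds h] with z hz
    exact (zeroZeta_of_lt hz).symm
  · have h1 : σ.re < 1 := by linarith
    exact (analyticAt_leftCont h1 hσ).congr (zeroZeta_eventuallyEq_leftCont h1).symm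

/-- The coefficient of `ε ^ (-2)` of `zeroZeta` at `1 / 2 - m`. -/
noncomputable def doublePole (m : ℕ) : ℝ := if m = 0 then 1 / (8 * Real.pi) else 0

/-- The coefficient of `ε ^ (-1)` of `zeroZeta` at `1 / 2 - m`. -/
noncomputable def simplePole (m : ℕ) : ℝ :=
  if m = 0 then -(Real.log (2 * Real.pi) / (4 * Real.pi)) else zetaResidue m

/-- Both functions continue the same series from `1/2 < Re σ < 1`, so they agree throughout the
strip `0 < Re σ < 1`. At `1/2` the polar part is visible on `nearHalf`, whereas the pieces of
`leftCont` would have to be combined. -/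
theorem leftCont_eventuallyEq_nearHalf : leftCont =ᶠ[𝓝[≠] (1 / 2)] nearHalf := by
  have hconv : Convex ℝ {z : ℂ | 0 < z.re ∧ z.re < 1} :=
    (convex_halfSpace_re_gt 0).inter (convex_halfSpace_re_lt 1)
  refine MeromorphicOn.eventuallyEq_of_isPreconnected (U := {z : ℂ | 0 < z.re ∧ z.re < 1})
    (fun z hz => meromorphicAt_leftCont hz.2) (fun z hz => meromorphicAt_nearHalf hz.1 hz.2)
    hconv.isPreconnected (x := 3 / 4) ⟨by norm_num, by norm_num⟩ ⟨by norm_num, by norm_num⟩ ?_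
  refine Filter.Eventually.filter_mono nhdsWithin_le_nhds ?_
  have hU : IsOpen {z : ℂ | 1 / 2 < z.re ∧ z.re < 1} :=
    (isOpen_lt continuous_const Complex.continuous_re).inter
      (isOpen_lt Complex.continuous_re continuous_const)
  filter_upwards [hU.mem_nhds (x := 3 / 4) ⟨by norm_num, by norm_num⟩] with z hz
  rw [← zeroSeries_eq_leftCont hz.1 hz.2, zeroSeries_eq_nearHalf hz.1 hz.2]

theorem tendsto_const_add_nhdsNE (c : ℂ) : Tendsto (fun ε : ℂ => c + ε) (𝓝[≠] 0) (𝓝[≠] c) := by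
  refine tendsto_nhdsWithin_iff.2 ⟨?_, ?_⟩
  · have : Tendsto (fun ε : ℂ => c + ε) (𝓝 0) (𝓝 (c + 0)) := by
      exact (continuous_const.add continuous_id).tendsto 0
    rw [add_zero] at this
    exact this.mono_left nhdsWithin_le_nhds
  · filter_upwards [self_mem_nhdsWithin] with ε hε h
    exact hε (by simpa using h)

theorem zeroZeta_laurent (m : ℕ) : ∃ g : ℂ → ℂ, AnalyticAt ℂ g 0 ∧ ∀ᶠ ε in 𝓝[≠] (0 : ℂ),
    zeroZeta (1 / 2 - m + ε) = (doublePole m : ℂ) * (ε ^ 2)⁻¹ + (simplePole m : ℂ) * ε⁻¹ + g ε := by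
  have hre : (1 / 2 - m : ℂ).re < 1 := by
    simp
    linarith [(m.cast_nonneg : (0 : ℝ) ≤ m)]
  have hev := (tendsto_const_add_nhdsNE (1 / 2 - m)).eventually
    ((zeroZeta_eventuallyEq_leftCont hre).filter_mono nhdsWithin_le_nhds)
  rcases Nat.eq_zero_or_pos m with rfl | hm
  · obtain ⟨g, hg, h⟩ := nearHalf_laurent
    refine ⟨g, hg, ?_⟩
    have h2 := (tendsto_const_add_nhdsNE (1 / 2)).eventually leftCont_eventuallyEq_nearHalf
    simp only [Nat.cast_zero, sub_zero] at hev ⊢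
    filter_upwards [hev, h2, h] with ε h3 h4 h5
    rw [h3, h4, h5]
    simp [doublePole, simplePole]
  · obtain ⟨g, hg, h⟩ := leftCont_laurent hm
    refine ⟨g, hg, ?_⟩
    filter_upwards [hev, h] with ε h3 h5
    rw [h3, h5]
    simp [doublePole, simplePole, hm.ne']

end ZeroZeta

/-! ### Uniqueness of the continuation. -/

section Uniqueness

/-- A meromorphic function which is the sum of the Dirichlet series where that converges is, up to
normal form, the function `secondaryZeta`. -/
theorem secondaryZeta_of_continuation {v : ℝ} {f : ℂ → ℂ} (hf : ∀ σ, MeromorphicAt f σ)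
    (hsum : ∀ σ : ℂ, 1 / 2 < σ.re → HasSum (fun ρ : upperZetaZeros =>
      (zetaMult ρ : ℂ) * (zeroTau ρ ^ 2 + (v : ℂ)) ^ (-σ)) (f σ))
    (han : ∀ σ : ℂ, 1 / 2 < σ.re → AnalyticAt ℂ f σ) :
    IsSecondaryZetaContinuation v (fun σ => secondaryZeta σ v) ∧
    (∀ σ, AnalyticAt ℂ f σ → (fun s => secondaryZeta s v) =ᶠ[𝓝 σ] f) ∧
    ∀ σ, (fun s => secondaryZeta s v) =ᶠ[𝓝[≠] σ] f := by
  have hfU : MeromorphicOn f Set.univ := fun σ _ => hf σ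
  have hex : ∃ g, IsSecondaryZetaContinuation v g := by
    refine ⟨toMeromorphicNFOn f Set.univ, meromorphicNFOn_toMeromorphicNFOn f Set.univ,
      fun σ hσ => ?_⟩
    -- Passing to normal form does not change the value where `f` is already analytic, so the series
    -- still sums to it.
    have h1 : toMeromorphicNFOn f Set.univ σ = f σ := by
      have h2 : f =ᶠ[𝓝[≠] σ] toMeromorphicNFOn f Set.univ :=
        (hfU.toMeromorphicNFOn_eq_self_on_nhdsNE (Set.mem_univ σ)).symm
      have h3 := ((han σ hσ).meromorphicNFAt.eventuallyEq_nhdsNE_iff_eventuallyEq_nhds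
        (meromorphicNFOn_toMeromorphicNFOn f Set.univ (Set.mem_univ σ))).1 h2
      exact h3.eq_of_nhds.symm
    rw [h1]
    exact hsum σ hσ
  have hsec : (fun σ => secondaryZeta σ v) = hex.choose := by
    ext σ
    rw [secondaryZeta, dif_pos hex]
  rw [hsec]
  obtain ⟨hNF, hS⟩ := hex.choose_spec
  set h := hex.choose
  have heq : ∀ σ : ℂ, 1 / 2 < σ.re → h σ = f σ := fun σ hσ => (hS σ hσ).unique (hsum σ hσ)
  have h1 : h =ᶠ[𝓝[≠] 1] f := by
    refine Filter.Eventually.filter_mono nhdsWithin_le_nhds ?_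
    filter_upwards [(isOpen_lt continuous_const Complex.continuous_re).mem_nhds
      (show 1 / 2 < (1 : ℂ).re by norm_num)] with z hz
    exact heq z hz
  have hall : ∀ σ, h =ᶠ[𝓝[≠] σ] f := fun σ =>
    MeromorphicOn.eventuallyEq_of_isPreconnected hNF.meromorphicOn hfU isPreconnected_univ
      (Set.mem_univ 1) (Set.mem_univ σ) h1
  exact ⟨⟨hNF, hS⟩, fun σ hσ => ((hNF (Set.mem_univ σ)).eventuallyEq_nhdsNE_iff_eventuallyEq_nhds
    hσ.meromorphicNFAt).1 (hall σ), hall⟩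

end Uniqueness

/-! ### The binomial expansion of `(w + v)^(-σ)`. -/

section Binomial

theorem descPochhammer_smeval_eq_prod (a : ℂ) (l : ℕ) :
    (descPochhammer ℤ l).smeval a = ∏ j ∈ Finset.range l, (a - j) := by
  induction l with
  | zero => simp
  | succ l ih =>
    rw [descPochhammer_succ_right, Polynomial.smeval_mul, ih, Finset.prod_range_succ,
      Polynomial.smeval_sub, Polynomial.smeval_X, Polynomial.smeval_natCast]
    simp

theorem shiftCoeff_eq_choose (σ : ℂ) (l : ℕ) : shiftCoeff σ l = Ring.choose (-σ) l := by
  rw [Ring.choose_eq_smul, descPochhammer_smeval_eq_prod, shiftCoeff, smul_eq_mul, div_eq_inv_mul]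

theorem hasSum_shiftCoeff {z : ℂ} (hz : ‖z‖ < 1) (σ : ℂ) :
    HasSum (fun l : ℕ => shiftCoeff σ l * z ^ l) ((1 + z) ^ (-σ)) := by
  have h := (Complex.one_add_cpow_hasFPowerSeriesOnBall_zero (a := -σ)).hasSum (y := z)
    (by simpa [Metric.mem_eball, edist_zero_right, enorm_eq_nnnorm, ← NNReal.coe_lt_coe] using hz)
  simp only [binomialSeries_apply, List.ofFn_const, List.prod_replicate, smul_eq_mul,
    zero_add] at h
  simpa only [shiftCoeff_eq_choose] using h

theorem add_mul_mem_slitPlane {w : ℂ} (hw : w ∈ Complex.slitPlane) {v : ℝ} (hv : |v| < ‖w‖) :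
    w + (v : ℂ) ∈ Complex.slitPlane := by
  rw [Complex.mem_slitPlane_iff] at hw ⊢
  by_cases him : w.im = 0
  · left
    have h1 : 0 < w.re := hw.resolve_right (not_not.2 him)
    have h2 : ‖w‖ = w.re := by
      have : w = (w.re : ℂ) := Complex.ext rfl (by simpa using him)
      rw [this, Complex.norm_of_nonneg h1.le, Complex.ofReal_re]
    rw [h2] at hv
    have := (abs_lt.1 hv).1
    simp
    linarith
  · right
    simpa using him

theorem one_add_mem_slitPlane {z : ℂ} (hz : ‖z‖ < 1) : 1 + z ∈ Complex.slitPlane := by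
  rw [Complex.mem_slitPlane_iff]
  left
  have h1 := (abs_le.1 (Complex.abs_re_le_norm z)).1
  simp
  linarith

/-- In general such an identity holds only modulo `2πi`. Here `log(w + tv) - log(1 + tv/w)` has
derivative 0 for `0 ≤ t ≤ 1`, both arguments staying in the slit plane, and equals `log w` at `t =
0`. -/
theorem log_add_ofReal {w : ℂ} (hw : w ∈ Complex.slitPlane) {v : ℝ} (hv : |v| < ‖w‖) :
    Complex.log (w + v) = Complex.log w + Complex.log (1 + v / w) := by
  have hw0 := Complex.slitPlane_ne_zero hw
  have hwpos : 0 < ‖w‖ := norm_pos_iff.2 hw0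
  have ht : ∀ t ∈ Set.Icc (0 : ℝ) 1, |t * v| < ‖w‖ := fun t ht => by
    rw [abs_mul, abs_of_nonneg ht.1]
    exact (mul_le_of_le_one_left (abs_nonneg v) ht.2).trans_lt hv
  have hd : ∀ t ∈ Set.Icc (0 : ℝ) 1, HasDerivAt (fun t : ℝ =>
      Complex.log (w + t * v) - Complex.log (1 + t * v / w)) 0 t := by
    intro t hti
    have h1 := add_mul_mem_slitPlane hw (ht t hti)
    have h2 : 1 + (t * v : ℂ) / w ∈ Complex.slitPlane := by
      refine one_add_mem_slitPlane ?_
      rw [norm_div, div_lt_one hwpos, ← Complex.ofReal_mul, Complex.norm_real]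
      exact ht t hti
    push_cast at h1
    have e1 : HasDerivAt (fun t : ℂ => w + t * v) (v : ℂ) (t : ℂ) := by
      simpa using ((hasDerivAt_id (t : ℂ)).mul_const (v : ℂ)).const_add w
    have e2 : HasDerivAt (fun t : ℂ => 1 + t * v / w) (v / w : ℂ) (t : ℂ) := by
      simpa using (((hasDerivAt_id (t : ℂ)).mul_const (v : ℂ)).div_const w).const_add 1
    have h3 := ((e1.clog h1).sub (e2.clog h2)).comp_ofReal
    refine h3.congr_deriv ?_
    have h4 := Complex.slitPlane_ne_zero h1
    have h6 : 1 + (t * v : ℂ) / w = (w + t * v) / w := by field_simp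
    rw [h6]
    field_simp
    simp
  have hconst := constant_of_has_deriv_right_zero
    (fun t ht => (hd t ht).continuousAt.continuousWithinAt)
    (fun t ht => (hd t (Set.Ico_subset_Icc_self ht)).hasDerivWithinAt) 1 (by simp)
  simp at hconst
  linear_combination hconst

theorem hasSum_shiftCoeff_cpow {w : ℂ} (hw : w ∈ Complex.slitPlane) {v : ℝ} (hv : |v| < ‖w‖)
    (σ : ℂ) : HasSum (fun l : ℕ => shiftCoeff σ l * w ^ (-(σ + l)) * (v : ℂ) ^ l)
      ((w + v) ^ (-σ)) := by
  have hw0 := Complex.slitPlane_ne_zero hw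
  have hwpos : 0 < ‖w‖ := norm_pos_iff.2 hw0
  have hz : ‖(v : ℂ) / w‖ < 1 := by
    rw [norm_div, div_lt_one hwpos, Complex.norm_real]
    exact hv
  have h := (hasSum_shiftCoeff hz σ).mul_left (w ^ (-σ))
  have e1 : w ^ (-σ) * (1 + v / w) ^ (-σ) = (w + v) ^ (-σ) := by
    rw [Complex.cpow_def_of_ne_zero hw0,
      Complex.cpow_def_of_ne_zero (Complex.slitPlane_ne_zero (one_add_mem_slitPlane hz)),
      Complex.cpow_def_of_ne_zero (Complex.slitPlane_ne_zero (add_mul_mem_slitPlane hw hv)),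
      log_add_ofReal hw hv, ← Complex.exp_add]
    ring_nf
  rw [e1] at h
  refine h.congr_fun fun l => ?_
  rw [neg_add, Complex.cpow_add _ _ hw0, Complex.cpow_neg w (l : ℂ), Complex.cpow_natCast, div_pow]
  field_simp

/-- A majorant of `shiftCoeff σ l` for `‖σ‖ ≤ K`. -/
noncomputable def shiftMajorant (K : ℝ) (l : ℕ) : ℝ :=
  (∏ j ∈ Finset.range l, (K + j)) / l.factorial

theorem norm_shiftCoeff_le {σ : ℂ} {K : ℝ} (h : ‖σ‖ ≤ K) (l : ℕ) :
    ‖shiftCoeff σ l‖ ≤ shiftMajorant K l := by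
  rw [shiftCoeff, shiftMajorant, norm_div, Complex.norm_natCast, norm_prod]
  refine div_le_div_of_nonneg_right (Finset.prod_le_prod (fun _ _ => norm_nonneg _)
    fun j _ => ?_) (Nat.cast_nonneg _)
  refine (norm_sub_le _ _).trans ?_
  rw [norm_neg, Complex.norm_natCast]
  linarith

theorem summable_shiftMajorant {K x : ℝ} (hK : 0 < K) (hx0 : 0 ≤ x) (hx : x < 1) :
    Summable fun l => shiftMajorant K l * x ^ l := by
  have hpos : ∀ l, 0 < shiftMajorant K l := fun l =>
    div_pos (Finset.prod_pos fun j _ => by positivity) (by positivity)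
  -- A larger ratio `y > 0` keeps the terms nonzero for the ratio test even when `x = 0`;
  -- consecutive terms have ratio `y (K + l)/(l + 1)`, which tends to `y`.
  obtain ⟨y, hxy, hy⟩ := exists_between hx
  have hy0 : 0 < y := hx0.trans_lt hxy
  have hs : Summable fun l => shiftMajorant K l * y ^ l := by
    refine summable_of_ratio_test_tendsto_lt_one hy
      (Eventually.of_forall fun l => (mul_pos (hpos l) (pow_pos hy0 l)).ne') ?_
    have h1 : Tendsto (fun l : ℕ => (1 + (K - 1) * (1 / ((l : ℝ) + 1))) * y) atTop
        (𝓝 ((1 + (K - 1) * 0) * y)) :=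
      ((tendsto_one_div_add_atTop_nhds_zero_nat.const_mul _).const_add _).mul_const _
    rw [mul_zero, add_zero, one_mul] at h1
    refine h1.congr fun l => ?_
    have hl := hpos l
    have e : shiftMajorant K (l + 1) = shiftMajorant K l * ((K + l) / (l + 1)) := by
      rw [shiftMajorant, shiftMajorant, Finset.prod_range_succ, Nat.factorial_succ]
      push_cast
      field_simp
    rw [e, Real.norm_of_nonneg (by positivity), Real.norm_of_nonneg (by positivity)]
    field_simp
    ring
  refine Summable.of_nonneg_of_le (fun l => mul_nonneg (hpos l).le (pow_nonneg hx0 l))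
    (fun l => mul_le_mul_of_nonneg_left (pow_le_pow_left₀ hx0 hxy.le l) (hpos l).le) hs

end Binomial

/-! ### The shifted function: convergence and analyticity. -/

section Shift

theorem meromorphicAt_zeroZeta (σ : ℂ) : MeromorphicAt zeroZeta σ := by
  by_cases h : σ.re < 1
  · exact (meromorphicAt_leftCont h).congr
      ((zeroZeta_eventuallyEq_leftCont h).symm.filter_mono nhdsWithin_le_nhds)
  · refine (analyticAt_zeroZeta fun m hm => h ?_).meromorphicAt
    rw [hm]
    simp
    linarith [(m.cast_nonneg : (0 : ℝ) ≤ m)]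

theorem zeroTau_sq_mem_slitPlane (ρ : upperZetaZeros) : zeroTau ρ ^ 2 ∈ Complex.slitPlane := by
  have hre := zeroTau_re_pos ρ
  rw [Complex.mem_slitPlane_iff]
  by_cases him : (zeroTau ρ).im = 0
  · left
    simp only [sq, Complex.mul_re, him, mul_zero, sub_zero]
    positivity
  · right
    simp only [sq, Complex.mul_im]
    rw [mul_comm (zeroTau ρ).im, ← two_mul]
    exact mul_ne_zero two_ne_zero (mul_ne_zero hre.ne' him)

/-- If `τ² = -v` is real and `Re τ > 0`, then `τ` is real and `v = -(Re τ)²`, against admissibility.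
-/
theorem zeroTau_sq_add_ne_zero {v : ℝ} (hv : IsAdmissibleShift v) (ρ : upperZetaZeros) :
    zeroTau ρ ^ 2 + (v : ℂ) ≠ 0 := by
  have hre := zeroTau_re_pos ρ
  intro h
  have him : (zeroTau ρ).im = 0 := by
    have h2 := congrArg Complex.im h
    simp only [sq, Complex.add_im, Complex.mul_im, Complex.ofReal_im, Complex.zero_im] at h2
    have : (zeroTau ρ).re * (zeroTau ρ).im = 0 := by linarith
    exact (mul_eq_zero.1 this).resolve_left hre.ne'
  have h3 := congrArg Complex.re h
  simp only [sq, Complex.add_re, Complex.mul_re, him, Complex.ofReal_re, Complex.zero_re] at h3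
  have h4 := hv ρ ρ.2
  nlinarith

/-- The function `zeroZeta` without the finitely many terms in `A`. -/
noncomputable def restZeta (A : Finset upperZetaZeros) (σ : ℂ) : ℂ :=
  zeroZeta σ - ∑ ρ ∈ A, (zetaMult ρ : ℂ) * (zeroTau ρ ^ 2) ^ (-σ)

variable (A : Finset upperZetaZeros)

theorem hasSum_restZeta {σ : ℂ} (hσ : 1 / 2 < σ.re) :
    HasSum (fun ρ : {ρ // ρ ∉ A} => (zetaMult ρ.1 : ℂ) * (zeroTau ρ.1 ^ 2) ^ (-σ))
      (restZeta A σ) := by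
  refine (Finset.hasSum_compl_iff A
    (f := fun ρ : upperZetaZeros => (zetaMult ρ : ℂ) * (zeroTau ρ ^ 2) ^ (-σ))).2 ?_
  rw [restZeta, sub_add_cancel]
  exact hasSum_zeroZeta hσ

theorem differentiable_sum_cpow_neg {w : upperZetaZeros → ℂ} (hw : ∀ ρ, w ρ ≠ 0) :
    Differentiable ℂ fun σ : ℂ => ∑ ρ ∈ A, (zetaMult ρ : ℂ) * w ρ ^ (-σ) := by
  refine Differentiable.fun_sum fun ρ _ σ => ?_
  exact (differentiableAt_id.neg.const_cpow (Or.inl (hw ρ))).const_mul _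

theorem differentiable_sum_zeroTau :
    Differentiable ℂ fun σ : ℂ => ∑ ρ ∈ A, (zetaMult ρ : ℂ) * (zeroTau ρ ^ 2) ^ (-σ) :=
  differentiable_sum_cpow_neg A (w := fun ρ => zeroTau ρ ^ 2)
    fun ρ => pow_ne_zero 2 (zeroTau_ne_zero ρ)

theorem analyticAt_restZeta {σ : ℂ} (hσ : ∀ m : ℕ, σ ≠ 1 / 2 - m) :
    AnalyticAt ℂ (restZeta A) σ :=
  (analyticAt_zeroZeta hσ).sub ((differentiable_sum_zeroTau A).analyticAt σ)

theorem meromorphicAt_restZeta (σ : ℂ) : MeromorphicAt (restZeta A) σ :=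
  (meromorphicAt_zeroZeta σ).sub ((differentiable_sum_zeroTau A).analyticAt σ).meromorphicAt

variable {A} {r v : ℝ}

/-- Every remaining zero has `|τ²| ≥ r`, so `r^(1 - Re σ)` comes out of each term and the convergent
sum at exponent 1 is left. Hence the decay `r^(-ℓ)` at `σ + ℓ`. -/
theorem norm_restZeta_le (hr : 0 < r) (hA : ∀ ρ ∉ A, r ≤ ‖zeroTau ρ ^ 2‖) :
    ∃ S : ℝ, 0 ≤ S ∧ ∀ σ : ℂ, 1 ≤ σ.re →
      ‖restZeta A σ‖ ≤ S * r ^ (1 - σ.re) * Real.exp (Real.pi * |σ.im|) := by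
  have hs : Summable fun ρ : {ρ // ρ ∉ A} => (zetaMult ρ.1 : ℝ) * ‖zeroTau ρ.1 ^ 2‖ ^ (-(1 : ℝ)) :=
    (summable_zetaMult_sq_rpow (p := 1) (by norm_num)).comp_injective Subtype.val_injective
  refine ⟨∑' ρ : {ρ // ρ ∉ A}, (zetaMult ρ.1 : ℝ) * ‖zeroTau ρ.1 ^ 2‖ ^ (-(1 : ℝ)),
    tsum_nonneg fun ρ => by positivity, fun σ hσ => ?_⟩
  rw [← (hasSum_restZeta A (by linarith : 1 / 2 < σ.re)).tsum_eq, mul_assoc]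
  refine tsum_of_norm_bounded (hs.hasSum.mul_right _) fun ρ => ?_
  have h1 := hA ρ.1 ρ.2
  have h0 : 0 < ‖zeroTau ρ.1 ^ 2‖ := hr.trans_le h1
  rw [norm_mul, Complex.norm_natCast, mul_assoc]
  refine mul_le_mul_of_nonneg_left ((norm_cpow_neg_le _ _).trans ?_) (Nat.cast_nonneg _)
  rw [← mul_assoc]
  refine mul_le_mul_of_nonneg_right ?_ (Real.exp_pos _).le
  rw [show -σ.re = -(1 : ℝ) + (1 - σ.re) by ring, Real.rpow_add h0]
  refine mul_le_mul_of_nonneg_left ?_ (by positivity)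
  exact Real.rpow_le_rpow_of_nonpos hr h1 (by linarith)

/-- The terms of the expansion in powers of `v`. -/
noncomputable def shiftTerm (A : Finset upperZetaZeros) (v : ℝ) (σ : ℂ) (l : ℕ) : ℂ :=
  shiftCoeff σ l * restZeta A (σ + l) * (v : ℂ) ^ l

/-- The decay `r^(-ℓ)` of the rest beats `|v|^ℓ`, and the coefficients are absorbed by their
majorant. The condition `K + 1 ≤ ℓ` places `σ + ℓ` in `Re ≥ 1` uniformly in `|σ| ≤ K`. -/
theorem exists_norm_shiftTerm_le (hr : |v| < r) (hA : ∀ ρ ∉ A, r ≤ ‖zeroTau ρ ^ 2‖) {K : ℝ}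
    (hK : 0 < K) : ∃ u : ℕ → ℝ, Summable u ∧ ∀ σ : ℂ, ‖σ‖ ≤ K → ∀ l : ℕ, K + 1 ≤ l →
      ‖shiftTerm A v σ l‖ ≤ u l := by
  have hr0 : 0 < r := (abs_nonneg v).trans_lt hr
  obtain ⟨S, hS, h⟩ := norm_restZeta_le hr0 hA
  refine ⟨fun l => (S * (r ^ (1 + K) + r ^ (1 - K)) * Real.exp (Real.pi * K)) *
    (shiftMajorant K l * (|v| / r) ^ l), (summable_shiftMajorant hK (by positivity)
      ((div_lt_one hr0).2 hr)).mul_left _, fun σ hσ l hl => ?_⟩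
  have hre := abs_le.1 ((Complex.abs_re_le_norm σ).trans hσ)
  have him := (Complex.abs_im_le_norm σ).trans hσ
  have h1 : (σ + l).re = σ.re + l := by simp
  have h2 : (σ + l).im = σ.im := by simp
  have h3 := h (σ + l) (by rw [h1]; linarith)
  rw [h1, h2] at h3
  have h4 : r ^ (1 - (σ.re + l)) ≤ (r ^ (1 + K) + r ^ (1 - K)) / r ^ l := by
    rw [show 1 - (σ.re + l) = (1 - σ.re) - l by ring, Real.rpow_sub hr0, Real.rpow_natCast]
    refine div_le_div_of_nonneg_right ?_ (by positivity)
    rcases le_total 1 r with hr1 | hr1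
    · exact (Real.rpow_le_rpow_of_exponent_le hr1 (by linarith)).trans
        (le_add_of_nonneg_right (by positivity))
    · exact (Real.rpow_le_rpow_of_exponent_ge hr0 hr1 (by linarith)).trans
        (le_add_of_nonneg_left (by positivity))
  have h5 : ‖restZeta A (σ + l)‖ ≤ S * ((r ^ (1 + K) + r ^ (1 - K)) / r ^ l) *
      Real.exp (Real.pi * K) := by
    refine h3.trans ?_
    gcongr
  rw [shiftTerm, norm_mul, norm_mul, norm_pow, Complex.norm_real, Real.norm_eq_abs]
  have hM := (norm_nonneg _).trans (norm_shiftCoeff_le hσ l)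
  calc ‖shiftCoeff σ l‖ * ‖restZeta A (σ + l)‖ * |v| ^ l ≤ shiftMajorant K l *
      (S * ((r ^ (1 + K) + r ^ (1 - K)) / r ^ l) * Real.exp (Real.pi * K)) * |v| ^ l := by
        gcongr
        exact norm_shiftCoeff_le hσ l
    _ = _ := by simp only [div_pow]; ring

theorem summable_shiftTerm (hr : |v| < r) (hA : ∀ ρ ∉ A, r ≤ ‖zeroTau ρ ^ 2‖) (σ : ℂ) :
    Summable (shiftTerm A v σ) := by
  obtain ⟨u, hu, h⟩ := exists_norm_shiftTerm_le hr hA (K := ‖σ‖ + 1) (by positivity)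
  refine Summable.of_norm_bounded_eventually_nat hu ?_
  obtain ⟨N, hN⟩ := exists_nat_ge (‖σ‖ + 1 + 1)
  filter_upwards [eventually_ge_atTop N] with l hl
  exact h σ (by linarith) l (hN.trans (by exact_mod_cast hl))

/-- The continuation of `∑ (τ ^ 2 + v) ^ (-σ)`. -/
noncomputable def shiftedZeta (A : Finset upperZetaZeros) (v : ℝ) (σ : ℂ) : ℂ :=
  ∑ ρ ∈ A, (zetaMult ρ : ℂ) * (zeroTau ρ ^ 2 + (v : ℂ)) ^ (-σ) + ∑' l, shiftTerm A v σ l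

theorem differentiable_shiftCoeff (l : ℕ) : Differentiable ℂ fun σ => shiftCoeff σ l := by
  unfold shiftCoeff
  refine Differentiable.div_const ?_ _
  exact Differentiable.fun_finsetProd fun j _ => by fun_prop

theorem analyticAt_shiftTerm {σ : ℂ} {l : ℕ} (hσ : ∀ m : ℕ, σ + l ≠ 1 / 2 - m) :
    AnalyticAt ℂ (fun σ => shiftTerm A v σ l) σ := by
  have h1 : AnalyticAt ℂ (fun σ => restZeta A (σ + l)) σ :=
    AnalyticAt.comp (f := fun σ : ℂ => σ + l) (analyticAt_restZeta A hσ) (by fun_prop)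
  exact (((differentiable_shiftCoeff l).analyticAt σ).mul h1).mul analyticAt_const

theorem meromorphicAt_shiftTerm (σ : ℂ) (l : ℕ) :
    MeromorphicAt (fun σ => shiftTerm A v σ l) σ := by
  have h1 : MeromorphicAt (fun σ => restZeta A (σ + l)) σ :=
    MeromorphicAt.comp_analyticAt (f := restZeta A) (g := fun σ : ℂ => σ + l)
      (meromorphicAt_restZeta A _) (by fun_prop)
  exact (((differentiable_shiftCoeff l).analyticAt σ).meromorphicAt.mul h1).mul
    (MeromorphicAt.const _ _)

/-- Away from finitely many terms, the expansion in powers of `v` is analytic. -/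
theorem exists_shiftedZeta_eq (hv : IsAdmissibleShift v) (hr : |v| < r)
    (hA : ∀ ρ ∉ A, r ≤ ‖zeroTau ρ ^ 2‖) (σ₀ : ℂ) (N₀ : ℕ) :
    ∃ N, N₀ ≤ N ∧ ∃ h : ℂ → ℂ, AnalyticAt ℂ h σ₀ ∧
      shiftedZeta A v =ᶠ[𝓝 σ₀] fun σ => ∑ l ∈ Finset.range N, shiftTerm A v σ l + h σ := by
  -- Terms with `ℓ ≥ N` are evaluated at `σ + ℓ` of real part at least 1, clear of all poles, so the
  -- tail is analytic on the ball of radius `K`; the head is finite.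
  set K : ℝ := ‖σ₀‖ + 1 with hK
  obtain ⟨u, hu, hb⟩ := exists_norm_shiftTerm_le hr hA (K := K) (by positivity)
  obtain ⟨N₁, hN₁⟩ := exists_nat_ge (K + 1)
  set N := max N₀ N₁ with hN
  have hNK : K + 1 ≤ N := hN₁.trans (by exact_mod_cast le_max_right _ _)
  have hmem : σ₀ ∈ Metric.ball (0 : ℂ) K := by simp [hK]
  refine ⟨N, le_max_left _ _, fun σ =>
    ∑ ρ ∈ A, (zetaMult ρ : ℂ) * (zeroTau ρ ^ 2 + (v : ℂ)) ^ (-σ) + ∑' l, shiftTerm A v σ (l + N),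
    ?_, Eventually.of_forall fun σ => ?_⟩
  · refine ((differentiable_sum_cpow_neg A (w := fun ρ => zeroTau ρ ^ 2 + (v : ℂ))
      (zeroTau_sq_add_ne_zero hv)).analyticAt σ₀).add ?_
    refine DifferentiableOn.analyticAt (s := Metric.ball 0 K) ?_
      (Metric.isOpen_ball.mem_nhds hmem)
    refine Complex.differentiableOn_tsum_of_summable_norm
      (hu.comp_injective (add_left_injective N)) (fun l z hz => ?_) Metric.isOpen_ball
      (fun l z hz => ?_)
    · rw [mem_ball_zero_iff] at hz
      refine (analyticAt_shiftTerm fun m hm => ?_).differentiableAt.differentiableWithinAt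
      have h1 := congrArg Complex.re hm
      simp at h1
      have h2 := (abs_le.1 (Complex.abs_re_le_norm z)).1
      linarith [(m.cast_nonneg : (0 : ℝ) ≤ m), (l.cast_nonneg : (0 : ℝ) ≤ l)]
    · rw [mem_ball_zero_iff] at hz
      refine hb z hz.le (l + N) ?_
      push_cast
      linarith [(l.cast_nonneg : (0 : ℝ) ≤ l)]
  · simp only [shiftedZeta]
    rw [← (summable_shiftTerm hr hA σ).sum_add_tsum_nat_add N]
    ring

theorem analyticAt_shiftedZeta (hv : IsAdmissibleShift v) (hr : |v| < r)
    (hA : ∀ ρ ∉ A, r ≤ ‖zeroTau ρ ^ 2‖) {σ : ℂ} (hσ : ∀ m : ℕ, σ ≠ 1 / 2 - m) :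
    AnalyticAt ℂ (shiftedZeta A v) σ := by
  obtain ⟨N, -, h, hh, heq⟩ := exists_shiftedZeta_eq hv hr hA σ 0
  refine AnalyticAt.congr ?_ heq.symm
  refine AnalyticAt.add (Finset.analyticAt_fun_sum _ fun l _ => analyticAt_shiftTerm fun m hm =>
    hσ (m + l) ?_) hh
  push_cast
  linear_combination hm

theorem meromorphicAt_shiftedZeta (hv : IsAdmissibleShift v) (hr : |v| < r)
    (hA : ∀ ρ ∉ A, r ≤ ‖zeroTau ρ ^ 2‖) (σ : ℂ) : MeromorphicAt (shiftedZeta A v) σ := by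
  obtain ⟨N, -, h, hh, heq⟩ := exists_shiftedZeta_eq hv hr hA σ 0
  refine MeromorphicAt.congr ?_ (heq.symm.filter_mono nhdsWithin_le_nhds)
  exact (MeromorphicAt.fun_sum fun l _ => meromorphicAt_shiftTerm σ l).add hh.meromorphicAt

/-- The double series over zeros outside `A` and over `ℓ` is absolutely summable, since
`(|v|/|τ²|)^ℓ ≤ (|v|/r)^ℓ`. Its rows are binomial expansions, its columns the terms of the power
series in `v`; the finitely many zeros of `A` are added back. -/
theorem hasSum_shiftedZeta (hr : |v| < r) (hA : ∀ ρ ∉ A, r ≤ ‖zeroTau ρ ^ 2‖) {σ : ℂ}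
    (hσ : 1 / 2 < σ.re) :
    HasSum (fun ρ : upperZetaZeros => (zetaMult ρ : ℂ) * (zeroTau ρ ^ 2 + (v : ℂ)) ^ (-σ))
      (shiftedZeta A v σ) := by
  have hr0 : 0 < r := (abs_nonneg v).trans_lt hr
  set F : {ρ // ρ ∉ A} × ℕ → ℂ := fun p =>
    shiftCoeff σ p.2 * ((zetaMult p.1.1 : ℂ) * (zeroTau p.1.1 ^ 2) ^ (-(σ + p.2))) *
      (v : ℂ) ^ p.2 with hF
  have hne : ∀ ρ : upperZetaZeros, zeroTau ρ ^ 2 ≠ 0 := fun ρ => pow_ne_zero 2 (zeroTau_ne_zero ρ)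
  have hFs : Summable F := by
    have h1 : Summable fun ρ : {ρ // ρ ∉ A} => ‖(zetaMult ρ.1 : ℂ) * (zeroTau ρ.1 ^ 2) ^ (-σ)‖ :=
      (hasSum_restZeta A hσ).summable.norm
    have h2 := summable_shiftMajorant (K := ‖σ‖ + 1) (x := |v| / r) (by positivity) (by positivity)
      ((div_lt_one hr0).2 hr)
    have hM : ∀ l, ‖shiftCoeff σ l‖ ≤ shiftMajorant (‖σ‖ + 1) l :=
      norm_shiftCoeff_le (by linarith)
    have h3 := h1.mul_of_nonneg h2 (fun _ => norm_nonneg _) fun l =>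
      mul_nonneg ((norm_nonneg _).trans (hM l)) (by positivity)
    refine Summable.of_norm_bounded h3 fun p => ?_
    obtain ⟨ρ, l⟩ := p
    have h4 := hA ρ.1 ρ.2
    have e : (zeroTau ρ.1 ^ 2) ^ (-(σ + l)) = (zeroTau ρ.1 ^ 2) ^ (-σ) / (zeroTau ρ.1 ^ 2) ^ l := by
      rw [neg_add, Complex.cpow_add _ _ (hne ρ.1), Complex.cpow_neg _ (l : ℂ),
        Complex.cpow_natCast, div_eq_mul_inv]
    simp only [hF]
    rw [e, norm_mul, norm_mul, norm_mul, norm_div, norm_mul, norm_pow _ l, norm_pow _ l,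
      Complex.norm_real, Real.norm_eq_abs, div_pow]
    have h0 := (norm_nonneg _).trans (hM l)
    calc ‖shiftCoeff σ l‖ * (‖(zetaMult ρ.1 : ℂ)‖ *
          (‖(zeroTau ρ.1 ^ 2) ^ (-σ)‖ / ‖zeroTau ρ.1 ^ 2‖ ^ l)) * |v| ^ l ≤
        shiftMajorant (‖σ‖ + 1) l * (‖(zetaMult ρ.1 : ℂ)‖ *
          (‖(zeroTau ρ.1 ^ 2) ^ (-σ)‖ / r ^ l)) * |v| ^ l := by
          gcongr
          exact hM l
      _ = _ := by ring
  have hrow : ∀ ρ : {ρ // ρ ∉ A}, HasSum (fun l => F (ρ, l))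
      ((zetaMult ρ.1 : ℂ) * (zeroTau ρ.1 ^ 2 + (v : ℂ)) ^ (-σ)) := fun ρ => by
    have h := (hasSum_shiftCoeff_cpow (zeroTau_sq_mem_slitPlane ρ.1)
      (hr.trans_le (hA ρ.1 ρ.2)) σ).mul_left (zetaMult ρ.1 : ℂ)
    refine h.congr_fun fun l => ?_
    simp only [hF]
    ring
  have hcol : ∀ l : ℕ, HasSum (fun ρ : {ρ // ρ ∉ A} => F (ρ, l)) (shiftTerm A v σ l) := fun l => by
    have h := ((hasSum_restZeta A (σ := σ + l) (by
      simp
      linarith [(l.cast_nonneg : (0 : ℝ) ≤ l)])).mul_left (shiftCoeff σ l)).mul_right ((v : ℂ) ^ l)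
    exact h
  have h1 := hFs.hasSum.prod_fiberwise hrow
  have h2 : HasSum (shiftTerm A v σ) (∑' p, F p) := by
    have h3 : HasSum (F ∘ Prod.swap) (∑' p, F p) :=
      (Equiv.prodComm ℕ {ρ // ρ ∉ A}).hasSum_iff.2 hFs.hasSum
    exact h3.prod_fiberwise hcol
  rw [← h2.tsum_eq] at h1
  rw [shiftedZeta, add_comm]
  exact (Finset.hasSum_compl_iff A
    (f := fun ρ : upperZetaZeros => (zetaMult ρ : ℂ) * (zeroTau ρ ^ 2 + (v : ℂ)) ^ (-σ))).1 h1

end Shift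

/-! ### Polar parts of the shifted function. -/

section ShiftLaurent

variable {A : Finset upperZetaZeros} {r v : ℝ}

/-- The terms `mult · |τ²|^(-1)` of a convergent series are eventually small, and multiplicities are
at least 1, so `|τ²|` is large off a finite set. -/
theorem exists_finset_le_norm_zeroTau_sq (v : ℝ) : ∃ A : Finset upperZetaZeros, ∃ r : ℝ, |v| < r ∧
    ∀ ρ ∉ A, r ≤ ‖zeroTau ρ ^ 2‖ := by
  have h := (summable_zetaMult_sq_rpow (p := 1) (by norm_num)).tendsto_cofinite_zero
  have hpos : (0 : ℝ) < 1 / (|v| + 1) := by positivity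
  have h2 := h.eventually (gt_mem_nhds hpos)
  refine ⟨(Filter.eventually_cofinite.1 h2).toFinset, |v| + 1, by linarith, fun ρ hρ => ?_⟩
  have h3 : (zetaMult ρ : ℝ) * ‖zeroTau ρ ^ 2‖ ^ (-(1 : ℝ)) < 1 / (|v| + 1) := by
    by_contra hcon
    exact hρ ((Set.Finite.mem_toFinset _).2 hcon)
  have h0 : 0 < ‖zeroTau ρ ^ 2‖ := norm_pos_iff.2 (pow_ne_zero 2 (zeroTau_ne_zero ρ))
  have hm : (1 : ℝ) ≤ zetaMult ρ := by exact_mod_cast zetaMult_pos ρ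
  have h4 : 1 / ‖zeroTau ρ ^ 2‖ < 1 / (|v| + 1) := by
    refine lt_of_le_of_lt ?_ h3
    rw [Real.rpow_neg_one, one_div]
    exact le_mul_of_one_le_left (by positivity) hm
  exact ((one_div_lt_one_div h0 (by positivity)).1 h4).le

/-- Smallness is assumed zero by zero; it becomes uniform because only finitely many zeros lie near
the bound. No zero then has to be set aside. -/
theorem exists_le_norm_zeroTau_sq_of_isSmallShift (hv : IsSmallShift v) : ∃ r : ℝ, |v| < r ∧
    ∀ ρ : upperZetaZeros, r ≤ ‖zeroTau ρ ^ 2‖ := by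
  obtain ⟨A, r, hr, hA⟩ := exists_finset_le_norm_zeroTau_sq v
  have h1 : ∀ᶠ x in 𝓝[>] |v|, ∀ ρ ∈ A, x ≤ ‖zeroTau ρ ^ 2‖ := by
    rw [Filter.eventually_all_finset]
    intro ρ _
    have h2 : |v| < ‖zeroTau ρ ^ 2‖ := by
      refine (hv ρ ρ.2).trans_le ?_
      rw [norm_pow]
      exact sq_le_sq.2 ((Complex.abs_re_le_norm _).trans (le_abs_self _))
    filter_upwards [Ioo_mem_nhdsGT h2] with x hx
    exact hx.2.le
  obtain ⟨x, hx, hx1, hx2⟩ := (h1.and (Ioo_mem_nhdsGT hr)).exists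
  refine ⟨x, hx1, fun ρ => ?_⟩
  by_cases hρ : ρ ∈ A
  · exact hx ρ hρ
  · exact hx2.le.trans (hA ρ hρ)

theorem IsSmallShift.isAdmissibleShift (hv : IsSmallShift v) : IsAdmissibleShift v :=
  fun ρ hρ => (abs_lt.1 (hv ρ hρ)).1

theorem comp_const_add_analyticAt {f : ℂ → ℂ} {c : ℂ} (hf : AnalyticAt ℂ f c) :
    AnalyticAt ℂ (fun ε => f (c + ε)) 0 := by
  have : AnalyticAt ℂ f ((fun ε : ℂ => c + ε) 0) := by simpa using hf
  exact AnalyticAt.comp (f := fun ε : ℂ => c + ε) this (by fun_prop)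

/-- The Laurent expansion of a term of the expansion in powers of `v`. -/
theorem shiftTerm_laurent {M l : ℕ} (hl : l ≤ M) : ∃ g : ℂ → ℂ, AnalyticAt ℂ g 0 ∧
    ∀ᶠ ε in 𝓝[≠] (0 : ℂ), shiftTerm A v (1 / 2 - M + ε) l =
      (doublePole (M - l) * shiftCoeff (1 / 2 - M) l * (v : ℂ) ^ l) * (ε ^ 2)⁻¹ +
      ((doublePole (M - l) * deriv (fun σ => shiftCoeff σ l) (1 / 2 - M) +
        simplePole (M - l) * shiftCoeff (1 / 2 - M) l) * (v : ℂ) ^ l) * ε⁻¹ + g ε := by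
  obtain ⟨g, hg, h⟩ := zeroZeta_laurent (M - l)
  set c : ℂ → ℂ := fun ε => shiftCoeff (1 / 2 - M + ε) l with hc
  have hcA : AnalyticAt ℂ c 0 :=
    comp_const_add_analyticAt ((differentiable_shiftCoeff l).analyticAt _)
  have hc0 : c 0 = shiftCoeff (1 / 2 - M) l := by simp [hc]
  have hc1 : dslope c 0 0 = deriv (fun σ => shiftCoeff σ l) (1 / 2 - M) := by
    have := deriv_comp_const_add (fun σ => shiftCoeff σ l) (1 / 2 - M : ℂ) 0
    rw [dslope_same, hc, this, add_zero]
  set s : ℂ → ℂ := fun σ => ∑ ρ ∈ A, (zetaMult ρ : ℂ) * (zeroTau ρ ^ 2) ^ (-σ) with hs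
  have hsA : AnalyticAt ℂ (fun ε => s (1 / 2 - (M - l : ℕ) + ε)) 0 :=
    comp_const_add_analyticAt ((differentiable_sum_zeroTau A).analyticAt _)
  have hd1 := analyticAt_dslope hcA
  have hd2 := analyticAt_dslope hd1
  refine ⟨fun ε => (v : ℂ) ^ l * (doublePole (M - l) * dslope (dslope c 0) 0 ε +
    simplePole (M - l) * dslope c 0 ε + c ε * (g ε - s (1 / 2 - (M - l : ℕ) + ε))),
    analyticAt_const.mul (((analyticAt_const.mul hd2).add (analyticAt_const.mul hd1)).add
      (hcA.mul (hg.sub hsA))), ?_⟩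
  filter_upwards [h, self_mem_nhdsWithin] with ε hε hε0
  have hε0 : ε ≠ 0 := hε0
  have e1 : (1 / 2 - M + ε + l : ℂ) = 1 / 2 - (M - l : ℕ) + ε := by
    rw [Nat.cast_sub hl]; ring
  have h1 := sub_smul_dslope c 0 ε
  have h2 := sub_smul_dslope (dslope c 0) 0 ε
  rw [smul_eq_mul, sub_zero] at h1 h2
  have hcε : c ε = shiftCoeff (1 / 2 - M) l + ε * dslope c 0 ε := by rw [h1, hc0]; ring
  have hdε : dslope c 0 ε = deriv (fun σ => shiftCoeff σ l) (1 / 2 - M) +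
      ε * dslope (dslope c 0) 0 ε := by rw [h2, hc1]; ring
  have h3 : shiftTerm A v (1 / 2 - M + ε) l =
      c ε * (zeroZeta (1 / 2 - (M - l : ℕ) + ε) - s (1 / 2 - (M - l : ℕ) + ε)) * (v : ℂ) ^ l := by
    rw [shiftTerm, restZeta, e1]
  rw [h3, hε]
  -- The coefficient, expanded to second order against the double pole, feeds its derivative into
  -- the `1/ε` term.
  have e2 : c ε * (ε ^ 2)⁻¹ = shiftCoeff (1 / 2 - M) l * (ε ^ 2)⁻¹ +
      deriv (fun σ => shiftCoeff σ l) (1 / 2 - M) * ε⁻¹ + dslope (dslope c 0) 0 ε := by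
    rw [hcε, hdε]; field_simp; ring
  have e3 : c ε * ε⁻¹ = shiftCoeff (1 / 2 - M) l * ε⁻¹ + dslope c 0 ε := by
    rw [hcε]; field_simp
  linear_combination (v : ℂ) ^ l * doublePole (M - l) * e2 + (v : ℂ) ^ l * simplePole (M - l) * e3

/-- The term `ℓ` sees the unshifted function at `1/2 - (M - ℓ)`: a pole when `ℓ ≤ M`, and a point to
the right of all poles otherwise. -/
theorem shiftedZeta_laurent (hv : IsAdmissibleShift v) (hr : |v| < r)
    (hA : ∀ ρ ∉ A, r ≤ ‖zeroTau ρ ^ 2‖) (M : ℕ) : ∃ g : ℂ → ℂ, AnalyticAt ℂ g 0 ∧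
    ∀ᶠ ε in 𝓝[≠] (0 : ℂ), shiftedZeta A v (1 / 2 - M + ε) =
      (∑ l ∈ Finset.range (M + 1),
        doublePole (M - l) * shiftCoeff (1 / 2 - M) l * (v : ℂ) ^ l) * (ε ^ 2)⁻¹ +
      (∑ l ∈ Finset.range (M + 1),
        (doublePole (M - l) * deriv (fun σ => shiftCoeff σ l) (1 / 2 - M) +
          simplePole (M - l) * shiftCoeff (1 / 2 - M) l) * (v : ℂ) ^ l) * ε⁻¹ + g ε := by
  obtain ⟨N, hN, h, hh, heq⟩ := exists_shiftedZeta_eq hv hr hA (1 / 2 - M) (M + 1)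
  obtain ⟨k, rfl⟩ := Nat.exists_eq_add_of_le hN
  have hlau : ∀ l : ℕ, ∃ g : ℂ → ℂ, AnalyticAt ℂ g 0 ∧ (l ∈ Finset.range (M + 1) →
    ∀ᶠ ε in 𝓝[≠] (0 : ℂ), shiftTerm A v (1 / 2 - M + ε) l =
      (doublePole (M - l) * shiftCoeff (1 / 2 - M) l * (v : ℂ) ^ l) * (ε ^ 2)⁻¹ +
      ((doublePole (M - l) * deriv (fun σ => shiftCoeff σ l) (1 / 2 - M) +
        simplePole (M - l) * shiftCoeff (1 / 2 - M) l) * (v : ℂ) ^ l) * ε⁻¹ + g ε) := by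
    intro l
    by_cases hl : l ≤ M
    · obtain ⟨g, hg, h'⟩ := shiftTerm_laurent (A := A) (v := v) hl
      exact ⟨g, hg, fun _ => h'⟩
    · exact ⟨0, analyticAt_const, fun h' => absurd (Finset.mem_range_succ_iff.1 h') hl⟩
  choose g hg hgl using hlau
  set rest : ℂ → ℂ := fun σ => ∑ x ∈ Finset.range k, shiftTerm A v σ (M + 1 + x) with hrest
  have hrestA : AnalyticAt ℂ rest (1 / 2 - M) := by
    refine Finset.analyticAt_fun_sum _ fun x _ => analyticAt_shiftTerm fun m hm => ?_
    push_cast at hm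
    have h1 : ((1 + x + m : ℕ) : ℂ) = 0 := by push_cast; linear_combination hm
    have h2 : 1 + x + m = 0 := by exact_mod_cast h1
    omega
  refine ⟨fun ε => ∑ l ∈ Finset.range (M + 1), g l ε +
    (rest (1 / 2 - M + ε) + h (1 / 2 - M + ε)),
    (Finset.analyticAt_fun_sum _ fun l _ => hg l).add
      ((comp_const_add_analyticAt hrestA).add (comp_const_add_analyticAt hh)), ?_⟩
  have hev := (tendsto_const_add_nhdsNE (1 / 2 - M)).eventually
    (heq.filter_mono nhdsWithin_le_nhds)
  have hall := (Filter.eventually_all_finset (Finset.range (M + 1))).2 hgl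
  filter_upwards [hev, hall] with ε h1 h2
  rw [h1, Finset.sum_range_add, Finset.sum_congr rfl h2, Finset.sum_add_distrib,
    Finset.sum_add_distrib, ← Finset.sum_mul, ← Finset.sum_mul]
  simp only [hrest]
  ring

theorem shiftCoeff_half_sub {M l : ℕ} (hl : l ≤ M) : shiftCoeff (1 / 2 - M) l =
    ((Real.Gamma (1 / 2 + M) / (l.factorial * Real.Gamma (1 / 2 + (M - l : ℕ))) : ℝ) : ℂ) := by
  rw [shiftCoeff_eq_Gamma]
  · have e1 : (1 - (1 / 2 - M) : ℂ) = ((1 / 2 + M : ℝ) : ℂ) := by push_cast; ring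
    have e2 : (((1 / 2 + M : ℝ) : ℂ) - l) = ((1 / 2 + (M - l : ℕ) : ℝ) : ℂ) := by
      push_cast [Nat.cast_sub hl]; ring
    rw [e1, e2, Complex.Gamma_ofReal, Complex.Gamma_ofReal]
    push_cast
    rfl
  · intro n hn
    have h1 := congrArg Complex.re hn
    simp at h1
    linarith [(n.cast_nonneg : (0 : ℝ) ≤ n), (M.cast_nonneg : (0 : ℝ) ≤ M)]

theorem sum_range_reflect_Icc {R : Type*} [AddCommMonoid R] (M : ℕ) (f : ℕ → ℕ → R) :
    ∑ l ∈ Finset.range M, f (M - l) l = ∑ j ∈ Finset.Icc 1 M, f j (M - j) := by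
  refine Finset.sum_nbij' (fun l => M - l) (fun j => M - j) ?_ ?_ ?_ ?_ ?_
  · intro l hl
    simp only [Finset.mem_range, Finset.mem_Icc] at hl ⊢
    omega
  · intro l hl
    simp only [Finset.mem_range, Finset.mem_Icc] at hl ⊢
    omega
  · intro l hl
    simp only [Finset.mem_range] at hl
    omega
  · intro l hl
    simp only [Finset.mem_Icc] at hl
    omega
  · intro l hl
    simp only [Finset.mem_range] at hl
    have : M - (M - l) = l := by omega
    rw [this]

/-- Logarithmic differentiation of the product: the factor `-σ - j` contributes `-1/(M - 1/2 - j) =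
-2/(2(M - j) - 1)`, and reversing the order gives the reciprocals of odd numbers. -/
theorem deriv_shiftCoeff_half_sub (M : ℕ) : deriv (fun σ => shiftCoeff σ M) (1 / 2 - M) =
    shiftCoeff (1 / 2 - M) M * (-2 * ∑ j ∈ Finset.Icc 1 M, 1 / (2 * (j : ℂ) - 1)) := by
  have hne : ∀ j ∈ Finset.range M, (-(1 / 2 - M : ℂ) - j) ≠ 0 := fun j hj h => by
    have h1 := congrArg Complex.re h
    simp at h1
    have h2 : (j : ℝ) + 1 ≤ M := by exact_mod_cast Finset.mem_range.1 hj
    linarith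
  have hprod : ∏ j ∈ Finset.range M, (-(1 / 2 - M : ℂ) - j) ≠ 0 := Finset.prod_ne_zero_iff.2 hne
  have hlog := logDeriv_prod (s := Finset.range M) (f := fun (j : ℕ) (σ : ℂ) => -σ - j)
    (x := 1 / 2 - M) hne (fun j _ => by fun_prop)
  have e : ∀ j ∈ Finset.range M, logDeriv (fun σ : ℂ => -σ - j) (1 / 2 - M) =
      -2 * (1 / (2 * ((M - j : ℕ) : ℂ) - 1)) := fun j hj => by
    have hd : HasDerivAt (fun σ : ℂ => -σ - j) (-1) (1 / 2 - M) :=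
      ((hasDerivAt_id _).neg).sub_const _
    have h1 := hne j hj
    rw [logDeriv_apply, hd.deriv, Nat.cast_sub (Finset.mem_range.1 hj).le]
    have h2 : (2 * (M - j) - 1 : ℂ) = 2 * (-(1 / 2 - M) - j) := by ring
    rw [h2]
    field_simp
  rw [Finset.sum_congr rfl e, ← Finset.mul_sum,
    sum_range_reflect_Icc M fun j _ => 1 / (2 * (j : ℂ) - 1), logDeriv_apply,
    div_eq_iff hprod] at hlog
  have hcd : deriv (fun σ => shiftCoeff σ M) (1 / 2 - M) =
      deriv (fun σ : ℂ => ∏ j ∈ Finset.range M, (-σ - j)) (1 / 2 - M) / M.factorial := by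
    simp only [shiftCoeff]
    rw [deriv_div_const]
  rw [hcd, hlog, shiftCoeff]
  ring

/-- Only `ℓ = M` reaches the double pole at `1/2`. -/
theorem doublePole_sum (M : ℕ) (v : ℝ) :
    ∑ l ∈ Finset.range (M + 1), doublePole (M - l) * shiftCoeff (1 / 2 - M) l * (v : ℂ) ^ l =
      ((1 / (8 * Real.pi) * (Real.Gamma (M + 1 / 2) / (M.factorial * Real.Gamma (1 / 2))) *
        v ^ M : ℝ) : ℂ) := by
  rw [Finset.sum_range_succ, Finset.sum_eq_zero, zero_add, shiftCoeff_half_sub le_rfl, Nat.sub_self]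
  · simp only [doublePole, if_true, Nat.cast_zero, add_zero]
    rw [add_comm (1 / 2 : ℝ) M]
    push_cast
    ring
  · intro l hl
    have : M - l ≠ 0 := by
      have := Finset.mem_range.1 hl
      omega
    simp [doublePole, this]

/-- The term `ℓ = M` supplies the bracket in `𝓡_m(v)`: the derivative with weight `-2/(8π) =
-1/(4π)`, and the residue of `𝒵` at `1/2`. The term `ℓ = M - j` meets the simple pole at `1/2 - j`
and supplies `𝓡_j`. -/
theorem simplePole_sum (M : ℕ) (v : ℝ) :
    ∑ l ∈ Finset.range (M + 1),
      (doublePole (M - l) * deriv (fun σ => shiftCoeff σ l) (1 / 2 - M) +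
        simplePole (M - l) * shiftCoeff (1 / 2 - M) l) * (v : ℂ) ^ l =
      (shiftedResidue M v : ℂ) := by
  have h1 : ∀ l ∈ Finset.range M, (doublePole (M - l) * deriv (fun σ => shiftCoeff σ l) (1 / 2 - M) +
        simplePole (M - l) * shiftCoeff (1 / 2 - M) l) * (v : ℂ) ^ l =
      (fun (j l : ℕ) => ((Real.Gamma (1 / 2 + M) / (l.factorial * Real.Gamma (1 / 2 + j)) *
          zetaResidue j * v ^ l : ℝ) : ℂ)) (M - l) l := fun l hl => by
    have h2 := Finset.mem_range.1 hl
    have h3 : M - l ≠ 0 := by omega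
    rw [shiftCoeff_half_sub h2.le]
    simp only [doublePole, simplePole, if_neg h3]
    push_cast
    ring
  rw [Finset.sum_range_succ, Finset.sum_congr rfl h1,
    sum_range_reflect_Icc M fun (j l : ℕ) => ((Real.Gamma (1 / 2 + M) /
      (l.factorial * Real.Gamma (1 / 2 + j)) * zetaResidue j * v ^ l : ℝ) : ℂ),
    deriv_shiftCoeff_half_sub, shiftCoeff_half_sub le_rfl, Nat.sub_self, shiftedResidue]
  simp only [doublePole, simplePole, if_true, Nat.cast_zero, add_zero]
  rw [add_comm (1 / 2 : ℝ) M]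
  push_cast
  ring

end ShiftLaurent

/-! ### Assembly and the values at `-m`. -/

section MainTheorem

theorem secondaryZeta_zero : (∀ σ : ℂ, (∀ m : ℕ, σ ≠ 1 / 2 - m) → secondaryZeta σ 0 = zeroZeta σ) ∧
    ∀ σ, (fun s => secondaryZeta s 0) =ᶠ[𝓝[≠] σ] zeroZeta := by
  obtain ⟨-, h1, h2⟩ := secondaryZeta_of_continuation (v := 0) (f := zeroZeta)
    meromorphicAt_zeroZeta (fun σ hσ => by simpa using hasSum_zeroZeta hσ) fun σ hσ =>
      analyticAt_zeroZeta fun m hm => by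
        rw [hm] at hσ
        simp at hσ
        linarith [(m.cast_nonneg : (0 : ℝ) ≤ m)]
  exact ⟨fun σ hσ => (h1 σ (analyticAt_zeroZeta hσ)).eq_of_nhds, h2⟩

theorem secondaryZeta_eq_shiftedZeta {A : Finset upperZetaZeros} {r v : ℝ}
    (hv : IsAdmissibleShift v) (hr : |v| < r) (hA : ∀ ρ ∉ A, r ≤ ‖zeroTau ρ ^ 2‖) :
    IsSecondaryZetaContinuation v (fun σ => secondaryZeta σ v) ∧
    (∀ σ : ℂ, (∀ m : ℕ, σ ≠ 1 / 2 - m) →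
      (fun s => secondaryZeta s v) =ᶠ[𝓝 σ] shiftedZeta A v) ∧
    ∀ σ, (fun s => secondaryZeta s v) =ᶠ[𝓝[≠] σ] shiftedZeta A v := by
  obtain ⟨h0, h1, h2⟩ := secondaryZeta_of_continuation (v := v) (f := shiftedZeta A v)
    (meromorphicAt_shiftedZeta hv hr hA) (fun σ hσ => hasSum_shiftedZeta hr hA hσ) fun σ hσ =>
      analyticAt_shiftedZeta hv hr hA fun m hm => by
        rw [hm] at hσ
        simp at hσ
        linarith [(m.cast_nonneg : (0 : ℝ) ≤ m)]
  exact ⟨h0, fun σ hσ => h1 σ (analyticAt_shiftedZeta hv hr hA hσ), h2⟩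

theorem add_natCast_ne_half_sub {σ : ℂ} (hσ : ∀ m : ℕ, σ ≠ 1 / 2 - m) (l m : ℕ) :
    σ + l ≠ 1 / 2 - m := fun h => hσ (m + l) (by push_cast; linear_combination h)

theorem neg_natCast_ne_half_sub (n m : ℕ) : -(n : ℂ) ≠ 1 / 2 - m := fun h => by
  have h1 : ((2 * m : ℤ) : ℂ) = ((2 * n + 1 : ℤ) : ℂ) := by push_cast; linear_combination 2 * h
  have h2 : (2 * m : ℤ) = 2 * n + 1 := by exact_mod_cast h1
  omega

theorem shiftCoeff_neg_natCast (M l : ℕ) : shiftCoeff (-(M : ℂ)) l = (M.choose l : ℂ) := by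
  rw [shiftCoeff_eq_choose, neg_neg, Ring.choose_natCast]

/-- At `-M` the coefficients are binomial, so the series stops at `ℓ = M`. For each zero of `A`, the
removed powers `∑ C(M, ℓ) v^ℓ τ^(2(M - ℓ))` sum to `(τ² + v)^M`, which cancels the term added back;
the result no longer depends on `A`. -/
theorem shiftedZeta_neg_natCast (A : Finset upperZetaZeros) (v : ℝ) (M : ℕ) :
    shiftedZeta A v (-(M : ℂ)) =
      ∑ l ∈ Finset.range (M + 1), (M.choose l : ℂ) * zeroZeta (-(M : ℂ) + l) * (v : ℂ) ^ l := by
  have h1 : ∑' l, shiftTerm A v (-(M : ℂ)) l =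
      ∑ l ∈ Finset.range (M + 1), shiftTerm A v (-(M : ℂ)) l := by
    refine tsum_eq_sum fun l hl => ?_
    have h2 : M < l := by
      by_contra h
      exact hl (Finset.mem_range.2 (by omega))
    rw [shiftTerm, shiftCoeff_neg_natCast, Nat.choose_eq_zero_of_lt h2]
    simp
  have h2 : ∀ l ∈ Finset.range (M + 1), shiftTerm A v (-(M : ℂ)) l =
      (M.choose l : ℂ) * zeroZeta (-(M : ℂ) + l) * (v : ℂ) ^ l -
        ∑ ρ ∈ A, (zetaMult ρ : ℂ) *
          ((v : ℂ) ^ l * (zeroTau ρ ^ 2) ^ (M - l) * (M.choose l : ℂ)) := fun l hl => by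
    have hl := Finset.mem_range_succ_iff.1 hl
    have e : -(-(M : ℂ) + l) = ((M - l : ℕ) : ℂ) := by rw [Nat.cast_sub hl]; ring
    rw [shiftTerm, shiftCoeff_neg_natCast, restZeta, e]
    simp only [Complex.cpow_natCast]
    rw [mul_sub, sub_mul, Finset.mul_sum, Finset.sum_mul]
    congr 1
    exact Finset.sum_congr rfl fun ρ _ => by ring
  rw [shiftedZeta, h1, Finset.sum_congr rfl h2, Finset.sum_sub_distrib, Finset.sum_comm]
  simp only [neg_neg, Complex.cpow_natCast, ← Finset.mul_sum, ← add_pow]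
  simp only [add_comm (v : ℂ)]
  ring

theorem isBigO_one_of_laurent {f g : ℂ → ℂ} (hg : AnalyticAt ℂ g 0)
    (h : ∀ᶠ ε in 𝓝[≠] (0 : ℂ), f ε = g ε) : f =O[𝓝[≠] 0] (fun _ => (1 : ℂ)) :=
  ((hg.continuousAt.tendsto.isBigO_one ℂ).mono nhdsWithin_le_nhds).congr' (h.mono fun _ h => h.symm)
    EventuallyEq.rfl

end MainTheorem

theorem mainTheorem8 :
    -- `𝒵(σ, v)` is the meromorphic continuation of its Dirichlet series,
    -- and is holomorphic except at the points `1/2 - m`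
    (∀ v : ℝ, IsAdmissibleShift v →
      IsSecondaryZetaContinuation v (fun σ => secondaryZeta σ v) ∧
      ∀ σ : ℂ, (∀ m : ℕ, σ ≠ 1 / 2 - (m : ℂ)) →
        AnalyticAt ℂ (fun s => secondaryZeta s v) σ) ∧
    -- the expansion in powers of `v`
    (∀ v : ℝ, IsSmallShift v → ∀ σ : ℂ, (∀ m : ℕ, σ ≠ 1 / 2 - (m : ℂ)) →
      HasSum (fun l : ℕ => shiftCoeff σ l * secondaryZeta (σ + (l : ℂ)) 0 * (v : ℂ) ^ l)
        (secondaryZeta σ v)) ∧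
    -- `𝓡_j` is the residue of `𝒵(σ) = 𝒵(σ, 0)` at its simple pole `1/2 - j`, for `j ≥ 1`
    (∀ j : ℕ, 1 ≤ j →
      (fun ε : ℂ => secondaryZeta (-(j : ℂ) + 1 / 2 + ε) 0 - (zetaResidue j : ℂ) * ε⁻¹)
        =O[𝓝[≠] 0] (fun _ => (1 : ℂ))) ∧
    -- the polar part of `𝒵(σ, v)` at `1/2 - m`
    (∀ v : ℝ, IsAdmissibleShift v → ∀ m : ℕ,
      (fun ε : ℂ => secondaryZeta (-(m : ℂ) + 1 / 2 + ε) v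
          - ((1 / (8 * Real.pi) *
              (Real.Gamma (m + 1 / 2) / (m.factorial * Real.Gamma (1 / 2))) * v ^ m : ℝ) : ℂ)
            * (ε ^ 2)⁻¹
          - (shiftedResidue m v : ℂ) * ε⁻¹)
        =O[𝓝[≠] 0] (fun _ => (1 : ℂ))) ∧
    -- the trace identities
    (∀ v : ℝ, IsAdmissibleShift v → ∀ m : ℕ,
      secondaryZeta (-(m : ℂ)) v =
        ∑ l ∈ Finset.range (m + 1),
          (m.choose l : ℂ) * secondaryZeta (-(m : ℂ) + (l : ℂ)) 0 * (v : ℂ) ^ l) := by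
  refine ⟨fun v hv => ?_, fun v hv σ hσ => ?_, fun j hj => ?_, fun v hv m => ?_, fun v hv m => ?_⟩
  · obtain ⟨A, r, hr, hA⟩ := exists_finset_le_norm_zeroTau_sq v
    obtain ⟨h0, h1, -⟩ := secondaryZeta_eq_shiftedZeta hv hr hA
    exact ⟨h0, fun σ hσ => (analyticAt_shiftedZeta hv hr hA hσ).congr (h1 σ hσ).symm⟩
  · obtain ⟨r, hr, hA⟩ := exists_le_norm_zeroTau_sq_of_isSmallShift hv
    -- For a small shift `A` can be empty, so `restZeta` is the full function and the series is the
    -- asserted one.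
    have hA' : ∀ ρ ∉ (∅ : Finset upperZetaZeros), r ≤ ‖zeroTau ρ ^ 2‖ := fun ρ _ => hA ρ
    obtain ⟨-, h1, -⟩ := secondaryZeta_eq_shiftedZeta hv.isAdmissibleShift hr hA'
    have h2 : secondaryZeta σ v = ∑' l, shiftTerm ∅ v σ l := by
      rw [(h1 σ hσ).eq_of_nhds, shiftedZeta, Finset.sum_empty, zero_add]
    rw [h2]
    refine (summable_shiftTerm hr hA' σ).hasSum.congr_fun fun l => ?_
    rw [secondaryZeta_zero.1 _ (add_natCast_ne_half_sub hσ l), shiftTerm, restZeta,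
      Finset.sum_empty, sub_zero]
  · obtain ⟨g, hg, h⟩ := zeroZeta_laurent j
    refine isBigO_one_of_laurent hg ?_
    filter_upwards [h, (tendsto_const_add_nhdsNE (1 / 2 - j)).eventually
      (secondaryZeta_zero.2 (1 / 2 - j))] with ε h1 h2
    have hj0 : j ≠ 0 := by omega
    rw [show (-(j : ℂ) + 1 / 2 + ε) = 1 / 2 - j + ε by ring, h2, h1]
    simp [doublePole, simplePole, hj0]
  · obtain ⟨A, r, hr, hA⟩ := exists_finset_le_norm_zeroTau_sq v
    obtain ⟨-, -, h1⟩ := secondaryZeta_eq_shiftedZeta hv hr hA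
    obtain ⟨g, hg, h⟩ := shiftedZeta_laurent hv hr hA m
    rw [doublePole_sum, simplePole_sum] at h
    refine isBigO_one_of_laurent hg ?_
    filter_upwards [h, (tendsto_const_add_nhdsNE (1 / 2 - m)).eventually
      (h1 (1 / 2 - m))] with ε h2 h3
    rw [show (-(m : ℂ) + 1 / 2 + ε) = 1 / 2 - m + ε by ring, h3, h2]
    ring
  · obtain ⟨A, r, hr, hA⟩ := exists_finset_le_norm_zeroTau_sq v
    obtain ⟨-, h1, -⟩ := secondaryZeta_eq_shiftedZeta hv hr hA
    rw [(h1 _ (neg_natCast_ne_half_sub m)).eq_of_nhds, shiftedZeta_neg_natCast]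
    refine Finset.sum_congr rfl fun l _ => ?_
    rw [secondaryZeta_zero.1 _ (add_natCast_ne_half_sub (neg_natCast_ne_half_sub m) l)]
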